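/- Let $\Omega\subset\mathbb R^3$ be a bounded open set whose boundary $\Gamma$ is a $C^1$ surface with $\Omega$ on one side of it, up to a subset of zero area (edges, corners); let $\mathbf n$ be the outer unit normal, $d\Gamma$ the surface measure, and $\Sigma=\{(\mathbf x,\boldsymbol\omega)\in\Gamma\times\mathbb S^2:\boldsymbol\omega\cdot\mathbf n(\mathbf x)<0\}$. For each frequency $\nu>0$ let $\kappa_\nu>0$, $a_\nu\in[0,1]$, $\beta_\nu$ be bounded measurable functions of $\mathbf x\in\Omega$, let $R_\nu\in[0,1]$ and $Q_\nu$ be bounded measurable functions on $\Sigma$, and let $B_\nu(T)=\frac{2\hbar\nu^3}{c^2[e^{\hbar\nu/(kT)}-1]}$ be the Planck function ($\hbar,c,k>0$, $B_\nu(0)=0$). Assume that $R_\nu$ vanishes outside $M$ disjoint measurable flat pieces $\Gamma_1,\dots,\Gamma_M$ of $\Gamma$ (the reflecting boundaries; each lies in a plane and $\mathbf n$ is constant on it). Given $\mathbf x\in\Omega$ and $\mathbf y\in\Omega\cup\Gamma$, let $\mathbf x'_n=\mathbf x'_n(\mathbf x,\mathbf y)\in\Gamma_n$ be the point (there is at most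 one) such that the open segments $(\mathbf x,\mathbf x'_n)$ and $(\mathbf x'_n,\mathbf y)$ are in $\Omega$, $\boldsymbol\omega=\frac{\mathbf x-\mathbf x'_n}{|\mathbf x-\mathbf x'_n|}$ satisfies $\boldsymbol\omega\cdot\mathbf n(\mathbf x'_n)<0$, and $\frac{\mathbf x'_n-\mathbf y}{|\mathbf x'_n-\mathbf y|}=\boldsymbol\omega-2(\mathbf n\cdot\boldsymbol\omega)\mathbf n$ with $\mathbf n=\mathbf n(\mathbf x'_n)$. Let $\int_{[\mathbf x,\mathbf y]}\kappa$ be the integral of $\kappa_\nu$ along the segment with respect to arc length, let $\int_{[\mathbf x,\mathbf x'_n]\cup[\mathbf x'_n,\mathbf y]}\kappa$ be the one along the broken path, let $[r]_-=\max(-r,0)$, and write $\ell_n=|\mathbf x-\mathbf x'_n|+|\mathbf x'_n-\mathbf y|$. For a function $S$ of position and direction put $$S^E_{\nu,1}(\mathbf x)=\tfrac1{4\pi}\int_\Gamma Q_\nu\big(\mathbf y,\tfrac{\mathbf x-\mathbf y}{|\mathbf x-\mathbf y|}\big)\frac{[(\mathbf x-\mathbf y)\cdot\mathbf n(\mathbf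 y)]_-}{|\mathbf x-\mathbf y|^3}e^{-\int_{[\mathbf x,\mathbf y]}\kappa}\,d\Gamma(\mathbf y),$$ $$S^E_{\nu,2}(\mathbf x)=\sum_{n=1}^M\tfrac1{4\pi}\int_\Gamma R_\nu\big(\mathbf x'_n,\tfrac{\mathbf x-\mathbf x'_n}{|\mathbf x-\mathbf x'_n|}\big)Q_\nu\big(\mathbf y,\tfrac{\mathbf x'_n-\mathbf y}{|\mathbf x'_n-\mathbf y|}\big)\frac{[(\mathbf x'_n-\mathbf y)\cdot\mathbf n(\mathbf y)]_-\,e^{-\int_{[\mathbf x,\mathbf x'_n]\cup[\mathbf x'_n,\mathbf y]}\kappa}}{|\mathbf x'_n-\mathbf y|\,\ell_n^2}\,d\Gamma(\mathbf y),$$ $$\bar{\mathcal J}[S](\mathbf x)=\tfrac1{4\pi}\int_\Omega\Big\{\frac{e^{-\int_{[\mathbf x,\mathbf y]}\kappa}}{|\mathbf x-\mathbf y|^2}S\big(\mathbf y,\tfrac{\mathbf x-\mathbf y}{|\mathbf x-\mathbf y|}\big)+\sum_{n=1}^M\frac{e^{-\int_{[\mathbf x,\mathbf x'_n]\cup[\mathbf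 x'_n,\mathbf y]}\kappa}}{\ell_n^2}R_\nu\big(\mathbf x'_n,\tfrac{\mathbf x-\mathbf x'_n}{|\mathbf x-\mathbf x'_n|}\big)S\big(\mathbf y,\tfrac{\mathbf x'_n-\mathbf y}{|\mathbf x'_n-\mathbf y|}\big)\Big\}d\mathbf y,$$ where direct terms are counted only if the open segment $(\mathbf x,\mathbf y)$ is in $\Omega$ (always true if $\Omega$ is convex), and reflected terms only if $\mathbf x'_n$ exists. Let $\mathbf K^E_{\nu,1},\mathbf K^E_{\nu,2},\bar{\mathcal K}[S]$ be given by the same formulas with the direct integrands multiplied by the unit vector $\frac{\mathbf x-\mathbf y}{|\mathbf x-\mathbf y|}$ and the reflected integrands multiplied by the unit vector $\frac{\mathbf x-\mathbf x'_n}{|\mathbf x-\mathbf x'_n|}$. For functions $J,\mathbf K,T$ on $\Omega$ let $\mathcal S_\nu[J,\mathbf K,T](\mathbf x,\boldsymbol\omega)=\kappa_\nu(1-a_\nu)\big(B_\nu(T)+\beta_\nu\,\boldsymbol\omega\cdot\mathbf K\big)+\kappa_\nu a_\nu J$, and for an intensity $I_\nu$ let $J_\nu=\frac1{4\pi}\int_{\mathbb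 S^2}I_\nu\,d\omega$ and $\mathbf K_\nu=\frac1{4\pi}\int_{\mathbb S^2}\boldsymbol\omega I_\nu\,d\omega$. Consider $$\boldsymbol\omega\cdot\nabla I_\nu+\kappa_\nu I_\nu=\mathcal S_\nu\ \text{ in }\Omega\times\mathbb S^2,\qquad I_\nu(\mathbf x,\boldsymbol\omega)=R_\nu(\mathbf x,\boldsymbol\omega)\,I_\nu(\mathbf x,\boldsymbol\omega-2(\mathbf n\cdot\boldsymbol\omega)\mathbf n)+Q_\nu(\mathbf x,\boldsymbol\omega)\ \text{ on }\Sigma,\qquad(*)$$ the first equation meaning that along every segment of direction $\boldsymbol\omega$ in $\Omega$ (including end points on $\Gamma$) $I_\nu(\cdot,\boldsymbol\omega)$ is absolutely continuous and satisfies the equation almost everywhere. Let $\mathbf x\in\Omega$ and $\nu>0$ be such that no ray arriving at $\mathbf x$ is reflected more than once: $R_\nu(\mathbf z,\boldsymbol\omega)\,R_\nu(\mathbf y,\boldsymbol\omega^*)=0$ whenever a ray of direction $\boldsymbol\omega$ arrives at $\mathbf x$ from $\mathbf z$, $(\mathbf z,\boldsymbol\omega)\in\Sigma$, and its reflection at $\mathbf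 z$, of direction $\boldsymbol\omega^*=\boldsymbol\omega-2(\mathbf n(\mathbf z)\cdot\boldsymbol\omega)\mathbf n(\mathbf z)$, arrives at $\mathbf z$ from $\mathbf y$, $(\mathbf y,\boldsymbol\omega^*)\in\Sigma$. Then all integrals below converge absolutely and $$J_\nu(\mathbf x)=S^E_{\nu,1}(\mathbf x)+S^E_{\nu,2}(\mathbf x)+\bar{\mathcal J}[\mathcal S_\nu](\mathbf x),\qquad \mathbf K_\nu(\mathbf x)=\mathbf K^E_{\nu,1}(\mathbf x)+\mathbf K^E_{\nu,2}(\mathbf x)+\bar{\mathcal K}[\mathcal S_\nu](\mathbf x)$$ in each of the following two cases. (i) (One step of the iterations.) $I_\nu$ solves $(*)$ with $\mathcal S_\nu=\mathcal S_\nu[J^0,\mathbf K^0,T^0]$ for given bounded measurable $J^0,\mathbf K^0$ and $T^0\ge0$, and $J_\nu,\mathbf K_\nu$ are the moments of $I_\nu$. (ii) (The radiative transfer equations.) $(I,T)$, with $I_\nu$ and $T\ge0$ bounded and measurable, solves for all $\nu>0$ the system $(*)$ with $\mathcal S_\nu=\mathcal S_\nu[J_\nu,\mathbf K_\nu,T]$,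 $J_\nu$, $\mathbf K_\nu$ being the moments of $I_\nu$ itself, together with $\int_0^\infty\kappa_\nu(1-a_\nu)(J_\nu-B_\nu(T))\,d\nu=0$ in $\Omega$ (absolutely convergent). -/

import Mathlib

open MeasureTheory Set Topology
open scoped RealInnerProductSpace

noncomputable section

namespace RadiativeTransfer

/-- Physical space. -/
abbrev E3 : Type := EuclideanSpace ℝ (Fin 3)

/-! ### Geometry of the domain -/

/-- `m` is the outer unit normal of `Ω` at the boundary point `y`: near `y` the set `Ω` is the
strict sublevel set `{f < 0}` of a `C¹` function `f` with `f y = 0` and nonvanishing gradient at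
`y`, and `m` is the normalized gradient. -/
def IsOuterUnitNormal (Ω : Set E3) (y m : E3) : Prop :=
  ∃ f : E3 → ℝ, ContDiffAt ℝ 1 f y ∧ f y = 0 ∧ gradient f y ≠ 0 ∧
    (∀ᶠ z in 𝓝 y, z ∈ Ω ↔ f z < 0) ∧ m = ‖gradient f y‖⁻¹ • gradient f y

/-- The boundary points at which the boundary is a `C¹` surface with `Ω` on one side of it. -/
def regularBoundary (Ω : Set E3) : Set E3 := {y | ∃ m, IsOuterUnitNormal Ω y m}

open Classical in
/-- The outer unit normal field `n`, equal to `0` at the points that are not regular (edges and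
corners), so that such points never satisfy `ω · n < 0`. -/
def outerNormal (Ω : Set E3) (y : E3) : E3 :=
  if h : ∃ m, IsOuterUnitNormal Ω y m then h.choose else 0

/-- The surface measure `dΓ` on the boundary: two-dimensional Hausdorff measure, normalized so as
to agree with the area on planes. -/
def surfaceMeasure (Ω : Set E3) : Measure E3 := μHE[2].restrict (frontier Ω)

/-- A bounded open set whose boundary is a `C¹` surface, with the set on one side of it, up to a
set of zero area (edges, corners). -/
structure IsPiecewiseC1Domain (Ω : Set E3) : Prop where
  isOpen : IsOpen Ω
  isBounded : Bornology.IsBounded Ω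
  ae_regular : (μHE[2] : Measure E3) (frontier Ω \ regularBoundary Ω) = 0

/-- A flat piece of the boundary: it lies in a plane, and the outer normal of `Ω` on it is
a normal of that plane. -/
def IsFlatPiece (Ω F : Set E3) : Prop :=
  MeasurableSet F ∧ F ⊆ frontier Ω ∧
    ∃ (e : E3) (b : ℝ), ‖e‖ = 1 ∧ ∀ y ∈ F, outerNormal Ω y = e ∧ ⟪e, y⟫ = b

/-- The unit vector pointing from `x` to `y`. -/
def dir (x y : E3) : E3 := ‖y - x‖⁻¹ • (y - x)

/-- `[r]₋`, the negative part of a real number. -/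
def negPart (r : ℝ) : ℝ := max (-r) 0

/-- Specular reflection of the direction `ω` in the plane orthogonal to the normal at `y`. -/
def reflectDir (Ω : Set E3) (y ω : E3) : E3 := ω - (2 * ⟪outerNormal Ω y, ω⟫) • outerNormal Ω y

/-- The straight ray between `x` and `y` stays in `Ω`. -/
def Visible (Ω : Set E3) (x y : E3) : Prop := openSegment ℝ x y ⊆ Ω

/-- `z ∈ F` is a point of reflection of a ray between `x` and `y` via `z`: the two straight parts
of the ray are in `Ω`, the direction from `z` to `x` enters `Ω`, and it is related to the
direction from `y` to `z` by the law of specular reflection at `z`. -/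
def IsReflectionPoint (Ω F : Set E3) (x y z : E3) : Prop :=
  z ∈ F ∧ Visible Ω x z ∧ Visible Ω z y ∧
    ⟪dir z x, outerNormal Ω z⟫ < 0 ∧ dir y z = reflectDir Ω z (dir z x)

open Classical in
/-- `v` if `y` is visible from `x`, and `0` otherwise. -/
def ifVisible {V : Type*} [Zero V] (Ω : Set E3) (x y : E3) (v : V) : V :=
  if Visible Ω x y then v else 0

open Classical in
/-- `g z` where `z` is the point of reflection on `F` of the ray between `x` and `y`
(on a flat piece there is at most one), and `0` if there is no such ray. -/
def ifReflected {V : Type*} [Zero V] (Ω F : Set E3) (x y : E3) (g : E3 → V) : V :=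
  if h : ∃ z, IsReflectionPoint Ω F x y z then g h.choose else 0

/-- The integral of `κ` along the segment `[x, y]`, with respect to arc length. -/
def opticalDepth (κ : E3 → ℝ) (x y : E3) : ℝ := ∫ s in (0 : ℝ)..‖y - x‖, κ (x + s • dir x y)

/-! ### The equations -/

/-- The Planck function. -/
def planck (hbar c k ν T : ℝ) : ℝ :=
  2 * hbar * ν ^ 3 / (c ^ 2 * (Real.exp (hbar * ν / (k * T)) - 1))

/-- The source `S_ν(x, ω)` (at one frequency), made from `B = B_ν(T)`, `J` and `K`. -/
def source (κ a β B J : E3 → ℝ) (K : E3 → E3) (x ω : E3) : ℝ :=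
  κ x * (1 - a x) * (B x + β x * ⟪ω, K x⟫) + κ x * a x * J x

/-- `J(x)`, the mean of `I(x, ·)` over the unit sphere. -/
def meanIntensity (I : E3 → E3 → ℝ) (x : E3) : ℝ :=
  (4 * Real.pi)⁻¹ *
    ∫ ω : Metric.sphere (0 : E3) 1, I x ω ∂(volume : Measure E3).toSphere

/-- `K(x)`, the mean of `ω I(x, ω)` over the unit sphere. -/
def meanFlux (I : E3 → E3 → ℝ) (x : E3) : E3 :=
  (4 * Real.pi)⁻¹ •
    ∫ ω : Metric.sphere (0 : E3) 1, I x ω • (ω : E3) ∂(volume : Measure E3).toSphere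

/-- `ω · ∇I + κ I = S` in `Ω`: for every unit vector `ω`, along every segment of direction `ω` whose
interior is in `Ω`, the function `I(·, ω)` is absolutely continuous up to the end points (which
may be boundary points) and has almost everywhere the directional derivative `S - κ I`. -/
def SolvesTransport (Ω : Set E3) (κ : E3 → ℝ) (S I : E3 → E3 → ℝ) : Prop :=
  ∀ (p ω : E3) (l : ℝ), ‖ω‖ = 1 → 0 < l → (∀ s ∈ Ioo 0 l, p + s • ω ∈ Ω) →
    AbsolutelyContinuousOnInterval (fun s : ℝ => I (p + s • ω) ω) 0 l ∧
    ∀ᵐ s ∂(volume.restrict (Ioo 0 l)),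
      HasDerivAt (fun s : ℝ => I (p + s • ω) ω)
        (S (p + s • ω) ω - κ (p + s • ω) * I (p + s • ω) ω) s

/-- The set `Σ` of pairs of a boundary point and a direction entering `Ω` there. -/
def inflow (Ω : Set E3) : Set (E3 × E3) :=
  {q | q.1 ∈ frontier Ω ∧ ‖q.2‖ = 1 ∧ ⟪q.2, outerNormal Ω q.1⟫ < 0}

/-- The partially reflective boundary condition on `Σ`. -/
def ReflectiveBC (Ω : Set E3) (R Q I : E3 → E3 → ℝ) : Prop :=
  ∀ y ω, (y, ω) ∈ inflow Ω → I y ω = R y ω * I y (reflectDir Ω y ω) + Q y ω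

/-- A real or vector valued function is bounded on `s`. -/
def BoundedOn {X V : Type*} [Norm V] (f : X → V) (s : Set X) : Prop := ∃ C : ℝ, ∀ x ∈ s, ‖f x‖ ≤ C

/-- `(I, T)` solves the radiative transfer equations with the reflective boundary condition:
for every frequency `ν > 0` the transport equation, with the source made from the moments of `I`
itself, and the boundary condition; and the temperature equation. -/
structure IsRTESolution (hbar c k : ℝ) (Ω : Set E3) (κ a β : ℝ → E3 → ℝ) (R Q : ℝ → E3 → E3 → ℝ)
    (I : ℝ → E3 → E3 → ℝ) (T : E3 → ℝ) : Prop where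
  measurable_I : ∀ ν > 0, Measurable (Function.uncurry (I ν))
  bounded_I : ∀ ν > 0, BoundedOn (Function.uncurry (I ν)) (Ω ×ˢ Metric.sphere (0 : E3) 1)
  measurable_T : Measurable T
  bounded_T : BoundedOn T Ω
  nonneg_T : ∀ x ∈ Ω, 0 ≤ T x
  transport : ∀ ν > 0, SolvesTransport Ω (κ ν)
    (source (κ ν) (a ν) (β ν) (fun x => planck hbar c k ν (T x))
      (meanIntensity (I ν)) (meanFlux (I ν))) (I ν)
  boundary : ∀ ν > 0, ReflectiveBC Ω (R ν) (Q ν) (I ν)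
  integrable_temperature : ∀ x ∈ Ω, IntegrableOn
    (fun ν => κ ν x * (1 - a ν x) * (meanIntensity (I ν) x - planck hbar c k ν (T x))) (Ioi 0)
  temperature : ∀ x ∈ Ω,
    ∫ ν in Ioi (0 : ℝ), κ ν x * (1 - a ν x) *
      (meanIntensity (I ν) x - planck hbar c k ν (T x)) = 0

/-- No multiple reflection on the rays arriving at `x`: if the ray arriving at `x` from
`z ∈ Γ` was reflected at `z` and had left the boundary at `y ∈ Γ` before, then it is not partly
reflected at both points. -/
def NoMultipleReflectionAt (Ω : Set E3) (R : E3 → E3 → ℝ) (x : E3) : Prop :=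
  ∀ y z, (y, dir y z) ∈ inflow Ω → IsReflectionPoint Ω (frontier Ω) x y z →
    R z (dir z x) * R y (dir y z) = 0

/-! ### The integral formulas -/

variable (Ω : Set E3) (κ : E3 → ℝ) (R Q S : E3 → E3 → ℝ)

/-- The attenuated direct contribution of the boundary source at `y ∈ Γ` to `J(x)`. -/
def kernelSE1 (x y : E3) : ℝ :=
  ifVisible Ω x y
    (Q y (dir y x) * (negPart ⟪x - y, outerNormal Ω y⟫ / ‖x - y‖ ^ 3) *
      Real.exp (-opticalDepth κ x y))

/-- The contribution of the boundary source at `y ∈ Γ` to `J(x)` by reflection on `F`. -/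
def kernelSE2 (F : Set E3) (x y : E3) : ℝ :=
  ifReflected Ω F x y fun z =>
    R z (dir z x) * Q y (dir y z) *
      (negPart ⟪z - y, outerNormal Ω y⟫ *
          Real.exp (-(opticalDepth κ x z + opticalDepth κ z y)) /
        (‖z - y‖ * (‖x - z‖ + ‖z - y‖) ^ 2))

/-- The contribution of the volume source at `y ∈ Ω` to `J(x)`, direct and by reflection. -/
def kernelJ {M : ℕ} (F : Fin M → Set E3) (x y : E3) : ℝ :=
  ifVisible Ω x y (Real.exp (-opticalDepth κ x y) / ‖x - y‖ ^ 2 * S y (dir y x)) +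
    ∑ n, ifReflected Ω (F n) x y fun z =>
      Real.exp (-(opticalDepth κ x z + opticalDepth κ z y)) / (‖x - z‖ + ‖z - y‖) ^ 2 *
        R z (dir z x) * S y (dir y z)

/-- The direct contribution of the boundary source at `y ∈ Γ` to `K(x)`. -/
def kernelKE1 (x y : E3) : E3 :=
  ifVisible Ω x y
    ((Q y (dir y x) * (negPart ⟪x - y, outerNormal Ω y⟫ / ‖x - y‖ ^ 4) *
      Real.exp (-opticalDepth κ x y)) • (x - y))

/-- The contribution of the boundary source at `y ∈ Γ` to `K(x)` by reflection on `F`. -/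
def kernelKE2 (F : Set E3) (x y : E3) : E3 :=
  ifReflected Ω F x y fun z =>
    (R z (dir z x) * Q y (dir y z) *
      (negPart ⟪z - y, outerNormal Ω y⟫ *
          Real.exp (-(opticalDepth κ x z + opticalDepth κ z y)) /
        (‖z - y‖ * (‖x - z‖ + ‖z - y‖) ^ 2))) • (‖x - z‖⁻¹ • (x - z))

/-- The contribution of the volume source at `y ∈ Ω` to `K(x)`, direct and by reflection. -/
def kernelK {M : ℕ} (F : Fin M → Set E3) (x y : E3) : E3 :=
  ifVisible Ω x y
      ((Real.exp (-opticalDepth κ x y) / ‖x - y‖ ^ 3 * S y (dir y x)) • (x - y)) +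
    ∑ n, ifReflected Ω (F n) x y fun z =>
      (Real.exp (-(opticalDepth κ x z + opticalDepth κ z y)) / (‖x - z‖ + ‖z - y‖) ^ 2 *
        R z (dir z x) * S y (dir y z)) • (‖x - z‖⁻¹ • (x - z))

/-- `S^E_{ν,1}(x)` -/
def sourceE1 (x : E3) : ℝ :=
  (4 * Real.pi)⁻¹ * ∫ y, kernelSE1 Ω κ Q x y ∂(surfaceMeasure Ω)

/-- `S^E_{ν,2}(x)` -/
def sourceE2 {M : ℕ} (F : Fin M → Set E3) (x : E3) : ℝ :=
  ∑ n, (4 * Real.pi)⁻¹ * ∫ y, kernelSE2 Ω κ R Q (F n) x y ∂(surfaceMeasure Ω)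

/-- The operator `S ↦ 𝓙[S](x)` -/
def volumeJ {M : ℕ} (F : Fin M → Set E3) (x : E3) : ℝ :=
  (4 * Real.pi)⁻¹ * ∫ y in Ω, kernelJ Ω κ R S F x y

/-- `K^E_{ν,1}(x)` -/
def fluxE1 (x : E3) : E3 :=
  (4 * Real.pi)⁻¹ • ∫ y, kernelKE1 Ω κ Q x y ∂(surfaceMeasure Ω)

/-- `K^E_{ν,2}(x)` -/
def fluxE2 {M : ℕ} (F : Fin M → Set E3) (x : E3) : E3 :=
  ∑ n, (4 * Real.pi)⁻¹ • ∫ y, kernelKE2 Ω κ R Q (F n) x y ∂(surfaceMeasure Ω)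

/-- The operator `S ↦ 𝓚[S](x)` -/
def volumeK {M : ℕ} (F : Fin M → Set E3) (x : E3) : E3 :=
  (4 * Real.pi)⁻¹ • ∫ y in Ω, kernelK Ω κ R S F x y

/-- All integrals involved converge absolutely, and the moments `J(x)` and `K(x)` of `I` are given
by the integral formulas. -/
structure MomentFormulasAt {M : ℕ} (F : Fin M → Set E3) (I : E3 → E3 → ℝ) (x : E3) : Prop where
  integrable_I : Integrable (fun ω : Metric.sphere (0 : E3) 1 => I x ω)
    (volume : Measure E3).toSphere
  integrable_SE1 : Integrable (kernelSE1 Ω κ Q x) (surfaceMeasure Ω)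
  integrable_SE2 : ∀ n, Integrable (kernelSE2 Ω κ R Q (F n) x) (surfaceMeasure Ω)
  integrable_J : IntegrableOn (kernelJ Ω κ R S F x) Ω
  integrable_KE1 : Integrable (kernelKE1 Ω κ Q x) (surfaceMeasure Ω)
  integrable_KE2 : ∀ n, Integrable (kernelKE2 Ω κ R Q (F n) x) (surfaceMeasure Ω)
  integrable_K : IntegrableOn (kernelK Ω κ R S F x) Ω
  formula_J : meanIntensity I x = sourceE1 Ω κ Q x + sourceE2 Ω κ R Q F x + volumeJ Ω κ R S F x
  formula_K : meanFlux I x = fluxE1 Ω κ Q x + fluxE2 Ω κ R Q F x + volumeK Ω κ R S F x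

end RadiativeTransfer

end

open RadiativeTransfer

namespace RadiativeTransfer
open scoped ENNReal NNReal

/-- The surface measure of the unit sphere, as a measure on the whole space. -/
noncomputable def sphereMeasure : Measure E3 :=
  ((volume : Measure E3).toSphere).map ((↑) : Metric.sphere (0 : E3) 1 → E3)

/-- The measure `r² dr` on the positive half-line. -/
noncomputable def radialMeasure : Measure ℝ :=
  (volume.restrict (Ioi (0 : ℝ))).withDensity fun r => ENNReal.ofReal (r ^ 2)

lemma measurableEmbedding_sphere_coe :
    MeasurableEmbedding ((↑) : Metric.sphere (0 : E3) 1 → E3) :=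
  MeasurableEmbedding.subtype_coe Metric.isClosed_sphere.measurableSet

instance : IsFiniteMeasure sphereMeasure := by
  unfold sphereMeasure; infer_instance

lemma ae_norm_eq_one : ∀ᵐ ω ∂sphereMeasure, ‖ω‖ = 1 := by
  rw [sphereMeasure, measurableEmbedding_sphere_coe.ae_map_iff]
  exact Filter.Eventually.of_forall fun ω => by simp

lemma integral_sphere_eq {V : Type*} [NormedAddCommGroup V] [NormedSpace ℝ V] (f : E3 → V) :
    ∫ ω : Metric.sphere (0 : E3) 1, f ω ∂(volume : Measure E3).toSphere =
      ∫ ω, f ω ∂sphereMeasure := by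
  rw [sphereMeasure, measurableEmbedding_sphere_coe.integral_map]

lemma integrable_sphere_iff {V : Type*} [NormedAddCommGroup V] (f : E3 → V) :
    Integrable (fun ω : Metric.sphere (0 : E3) 1 => f ω) (volume : Measure E3).toSphere ↔
      Integrable f sphereMeasure := by
  rw [sphereMeasure, measurableEmbedding_sphere_coe.integrable_map_iff]
  rfl

instance : SFinite radialMeasure := by
  unfold radialMeasure; infer_instance

lemma map_volumeIoiPow_two :
    (Measure.volumeIoiPow 2).map ((↑) : Ioi (0 : ℝ) → ℝ) = radialMeasure := by
  ext s hs
  rw [Measure.map_apply measurable_subtype_coe hs, Measure.volumeIoiPow, radialMeasure,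
    withDensity_apply _ hs, withDensity_apply _ (measurable_subtype_coe hs),
    setLIntegral_subtype measurableSet_Ioi _ fun a : ℝ ↦ ENNReal.ofReal (a ^ 2),
    Measure.restrict_restrict hs]
  congr 2
  ext x
  simp [and_comm]

lemma finrank_E3 : Module.finrank ℝ E3 = 3 := by simp

/-- Polar coordinates centered at `p`. -/
lemma map_polar (p : E3) :
    (sphereMeasure.prod radialMeasure).map (fun q : E3 × ℝ => p - q.2 • q.1) = volume := by
  have h1 := (volume : Measure E3).measurePreserving_homeomorphUnitSphereProd
  have h2 : (sphereMeasure.prod radialMeasure) =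
      ((volume : Measure E3).toSphere.prod (Measure.volumeIoiPow 2)).map
        (Prod.map ((↑) : Metric.sphere (0 : E3) 1 → E3) ((↑) : Ioi (0 : ℝ) → ℝ)) := by
    rw [sphereMeasure, ← map_volumeIoiPow_two,
      Measure.map_prod_map _ _ measurable_subtype_coe measurable_subtype_coe]
  have h3 : Module.finrank ℝ E3 - 1 = 2 := by simp
  rw [h3] at h1
  rw [h2, ← h1.map_eq, Measure.map_map (by fun_prop) (by fun_prop),
    Measure.map_map (by fun_prop) (by fun_prop)]
  have h4 : ((fun q : E3 × ℝ => p - q.2 • q.1) ∘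
      Prod.map ((↑) : Metric.sphere (0 : E3) 1 → E3) ((↑) : Ioi (0 : ℝ) → ℝ)) ∘
      (homeomorphUnitSphereProd E3) = (fun v : E3 => p - v) ∘ ((↑) : ({0}ᶜ : Set E3) → E3) := by
    funext v
    have hv : ‖(v : E3)‖ ≠ 0 := norm_ne_zero_iff.2 v.2
    simp [smul_smul, hv]
  rw [h4, ← Measure.map_map (by fun_prop) (by fun_prop),
    map_comap_subtype_coe (measurableSet_singleton _).compl, restrict_compl_singleton]
  exact (volume.measurePreserving_sub_left p).map_eq

lemma lintegral_polar (p : E3) {g : E3 → ℝ≥0∞} (hg : Measurable g) :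
    ∫⁻ y, g y = ∫⁻ ω, (∫⁻ r in Ioi (0 : ℝ), ENNReal.ofReal (r ^ 2) * g (p - r • ω)) ∂sphereMeasure := by
  rw [← map_polar p, lintegral_map hg (by fun_prop), lintegral_prod _ (by fun_prop)]
  refine lintegral_congr fun ω => ?_
  rw [radialMeasure, lintegral_withDensity_eq_lintegral_mul _ (by fun_prop) (by fun_prop)]
  rfl

lemma sphereMeasure_apply {B : Set E3} (hB : MeasurableSet B) (hB1 : ∀ ω ∈ B, ‖ω‖ = 1) :
    sphereMeasure B = 3 * volume (image2 (fun (t : ℝ) (ω : E3) => t • ω) (Ioo 0 1) B) := by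
  rw [sphereMeasure, Measure.map_apply measurable_subtype_coe hB,
    Measure.toSphere_apply' _ (measurable_subtype_coe hB), finrank_E3]
  congr 2
  rw [← image2_smul]
  congr 1
  ext ω
  simp only [mem_image, mem_preimage, Subtype.exists, exists_and_left, exists_prop]
  constructor
  · rintro ⟨a, ha, _, rfl⟩; exact ha
  · intro h; exact ⟨ω, h, by simp [hB1 ω h], rfl⟩

/-- The surface measure of the sphere is invariant under linear isometries. -/
lemma map_sphereMeasure (ρ : E3 ≃ₗᵢ[ℝ] E3) : sphereMeasure.map ρ = sphereMeasure := by
  have hS : MeasurableSet (Metric.sphere (0 : E3) 1) := Metric.isClosed_sphere.measurableSet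
  have key : ∀ B : Set E3, MeasurableSet B → (∀ ω ∈ B, ‖ω‖ = 1) →
      sphereMeasure (ρ ⁻¹' B) = sphereMeasure B := by
    intro B hB hB1
    rw [sphereMeasure_apply hB hB1, sphereMeasure_apply (ρ.continuous.measurable hB)
      (fun ω h => by rw [← ρ.norm_map]; exact hB1 _ h)]
    congr 1
    rw [← ρ.measurePreserving.measure_preimage_emb ρ.toMeasurableEquiv.measurableEmbedding
      (image2 (fun (t : ℝ) (ω : E3) => t • ω) (Ioo 0 1) B)]
    congr 1
    ext v
    simp only [mem_preimage, mem_image2]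
    constructor
    · rintro ⟨t, ht, ω, hω, rfl⟩
      exact ⟨t, ht, ρ ω, hω, by simp⟩
    · rintro ⟨t, ht, ω, hω, h⟩
      exact ⟨t, ht, ρ.symm ω, by simpa using hω, by rw [← map_smul, h, ρ.symm_apply_apply]⟩
  ext B hB
  rw [Measure.map_apply ρ.continuous.measurable hB]
  have h0 : ∀ C : Set E3, sphereMeasure C = sphereMeasure (C ∩ Metric.sphere 0 1) := by
    intro C
    refine (measure_inter_conull ?_).symm
    exact measure_mono_null (fun ω h => by simpa using h) ae_norm_eq_one
  rw [h0, h0 B, ← key _ (hB.inter hS) (by simp)]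
  congr 1
  ext ω; simp

end RadiativeTransfer

namespace RadiativeTransfer
open scoped ENNReal NNReal

lemma euclideanHausdorff_image_le {K : ℝ≥0} {f : E3 → E3} {A : Set E3}
    (hf : LipschitzOnWith K f A) :
    (μHE[2] : Measure E3) (f '' A) ≤ (K : ℝ≥0∞) ^ 2 * (μHE[2] : Measure E3) A := by
  simp only [Measure.euclideanHausdorffMeasure_def, Measure.smul_apply, ENNReal.smul_def,
    smul_eq_mul]
  have h := hf.hausdorffMeasure_image_le (d := ((2 : ℕ) : ℝ)) (by positivity)
  rw [ENNReal.rpow_natCast] at h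
  calc _ ≤ _ := mul_le_mul_right h _
    _ = _ := by ring

lemma euclideanHausdorff_le_image {K : ℝ≥0} {f : E3 → E3} {A : Set E3}
    (hf : ∀ x ∈ A, ∀ y ∈ A, dist x y ≤ K * dist (f x) (f y)) :
    (μHE[2] : Measure E3) A ≤ (K : ℝ≥0∞) ^ 2 * (μHE[2] : Measure E3) (f '' A) := by
  have hinj : InjOn f A := fun x hx y hy h => dist_le_zero.1 (by simpa [h] using hf x hx y hy)
  have hg : ∀ x ∈ A, Function.invFunOn f A (f x) = x := fun x hx => hinj.leftInvOn_invFunOn hx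
  have h1 : LipschitzOnWith K (Function.invFunOn f A) (f '' A) := by
    refine LipschitzOnWith.of_dist_le_mul ?_
    rintro _ ⟨x, hx, rfl⟩ _ ⟨y, hy, rfl⟩
    rw [hg x hx, hg y hy]
    exact hf x hx y hy
  have h2 : Function.invFunOn f A '' (f '' A) = A := hinj.leftInvOn_invFunOn.image_image
  simpa only [h2] using euclideanHausdorff_image_le h1

/-- Volume of a right cylinder over a planar set. -/
lemma volume_cylinder {n : E3} (hn : ‖n‖ = 1) {B : Set E3} (hB : MeasurableSet B)
    (hB0 : ∀ b ∈ B, ⟪n, b⟫ = 0) (δ : ℝ) :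
    volume {q : E3 | q - ⟪n, q⟫ • n ∈ B ∧ ⟪n, q⟫ ∈ Ioo 0 δ} =
      ENNReal.ofReal δ * (μHE[2] : Measure E3) B := by
  have hn0 : n ≠ 0 := by rintro rfl; simp at hn
  have hnn : ⟪n, n⟫ = 1 := by rw [real_inner_self_eq_norm_sq, hn]; norm_num
  have hm : MeasurableSet {q : E3 | q - ⟪n, q⟫ • n ∈ B ∧ ⟪n, q⟫ ∈ Ioo 0 δ} := by
    have h1 : Measurable fun q : E3 => q - ⟪n, q⟫ • n := by fun_prop
    have h2 : Measurable fun q : E3 => ⟪n, q⟫ := by fun_prop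
    exact (h1 hB).inter (h2 measurableSet_Ioo)
  have h := EuclideanGeometry.euclideanHausdorffMeasure_eq_lintegral (0 : E3) hn0 hm
  rw [InnerProductSpace.euclideanHausdorffMeasure_eq_volume] at h
  have h3 : Module.finrank ℝ E3 - 1 = 2 := by simp
  rw [h, h3, enorm_eq_nnnorm, show ‖n‖₊ = 1 from NNReal.eq hn, ENNReal.coe_one, one_mul]
  have h4 : ∀ x : ℝ, (μHE[2] : Measure E3) ({q : E3 | q - ⟪n, q⟫ • n ∈ B ∧ ⟪n, q⟫ ∈ Ioo 0 δ} ∩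
      (AffineSubspace.mk' (x • n +ᵥ (0 : E3)) (ℝ ∙ n)ᗮ : Set E3)) =
      (Ioo 0 δ).indicator (fun _ => (μHE[2] : Measure E3) B) x := by
    intro x
    have hmem : ∀ q : E3, q ∈ (AffineSubspace.mk' (x • n +ᵥ (0 : E3)) (ℝ ∙ n)ᗮ : Set E3) ↔
        ⟪n, q⟫ = x := by
      intro q
      rw [SetLike.mem_coe, AffineSubspace.mem_mk', Submodule.mem_orthogonal_singleton_iff_inner_right]
      simp [inner_sub_right, inner_smul_right, hn, sub_eq_zero]
    by_cases hx : x ∈ Ioo 0 δ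
    · rw [indicator_of_mem hx, ← (IsometryEquiv.addRight (x • n)).isometry.euclideanHausdorffMeasure_image B]
      congr 1
      ext q
      simp only [mem_inter_iff, hmem, mem_image, IsometryEquiv.addRight_apply, mem_ofPred_eq]
      constructor
      · rintro ⟨⟨h1, -⟩, rfl⟩
        exact ⟨_, h1, by simp⟩
      · rintro ⟨b, hb, rfl⟩
        have : ⟪n, b + x • n⟫ = x := by
          rw [inner_add_right, inner_smul_right, hnn, hB0 b hb]; ring
        rw [this]
        exact ⟨⟨by simpa using hb, hx⟩, rfl⟩
    · rw [indicator_of_notMem hx]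
      convert measure_empty (μ := (μHE[2] : Measure E3))
      ext q
      simp only [mem_inter_iff, hmem, mem_empty_iff_false, iff_false, mem_ofPred_eq]
      rintro ⟨⟨-, h1⟩, rfl⟩
      exact hx h1
  simp_rw [h4]
  rw [lintegral_indicator measurableSet_Ioo, setLIntegral_const, Real.volume_Ioo, sub_zero, mul_comm]

/-- The part between `A` and its homothetic copies of the cone over `A` with vertex `p`. -/
def coneSlice (p : E3) (δ : ℝ) (A : Set E3) : Set E3 :=
  image2 (fun (c : ℝ) (y : E3) => p + (1 + c) • (y - p)) (Ioo 0 δ) A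

lemma sub_norm_smul_dir (p y : E3) : p - ‖p - y‖ • dir y p = y := by
  by_cases h : ‖p - y‖ = 0
  · rw [h, zero_smul, sub_zero]; exact sub_eq_zero.1 (norm_eq_zero.1 h)
  · rw [dir, smul_smul, mul_inv_cancel₀ h, one_smul]; abel

lemma norm_dir {p y : E3} (h : y ≠ p) : ‖dir y p‖ = 1 := by
  have : ‖p - y‖ ≠ 0 := norm_ne_zero_iff.2 (sub_ne_zero.2 h.symm)
  rw [dir, norm_smul, norm_inv, norm_norm, inv_mul_cancel₀ this]

lemma dir_sub_smul {p ω : E3} {r : ℝ} (hr : 0 < r) (hω : ‖ω‖ = 1) : dir (p - r • ω) p = ω := by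
  rw [dir, sub_sub_cancel, norm_smul, hω, mul_one, Real.norm_of_nonneg hr.le, smul_smul,
    inv_mul_cancel₀ hr.ne', one_smul]

lemma measurable_dir_left (p : E3) : Measurable fun y : E3 => dir y p := by
  unfold dir; fun_prop

lemma norm_smul_dir (p y : E3) : ‖p - y‖ • dir y p = p - y := by
  rw [eq_sub_iff_add_eq, add_comm]
  exact (sub_eq_iff_eq_add.1 (sub_norm_smul_dir p y)).symm

lemma add_smul_sub_eq (p y : E3) (c : ℝ) :
    p + (1 + c) • (y - p) = p - ((1 + c) * ‖p - y‖) • dir y p := by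
  rw [mul_smul, norm_smul_dir]
  module

lemma mul_sphereMeasure_le_volume_coneSlice {p : E3} {δ a : ℝ} (hδ : 0 < δ) (ha : 0 < a)
    {A : Set E3} (hA : ∀ y ∈ A, a ≤ ‖p - y‖) :
    ENNReal.ofReal (a ^ 3 * δ) * sphereMeasure ((fun y => dir y p) '' A) ≤
      volume (coneSlice p δ A) := by
  set S := toMeasurable volume (coneSlice p δ A)
  have hS : MeasurableSet S := measurableSet_toMeasurable _ _
  rw [← measure_toMeasurable (coneSlice p δ A), ← lintegral_indicator_one hS,
    lintegral_polar p (measurable_one.indicator hS)]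
  refine le_trans (mul_le_mul_right (measure_mono ?_) _) (mul_meas_ge_le_lintegral ?_ _)
  · rintro _ ⟨y, hy, rfl⟩
    set ρ := ‖p - y‖
    have hρ : a ≤ ρ := hA y hy
    have hρ0 : 0 < ρ := ha.trans_le hρ
    calc ENNReal.ofReal (a ^ 3 * δ) ≤ ENNReal.ofReal (ρ ^ 2) * ENNReal.ofReal ((1 + δ) * ρ - ρ) := by
          rw [← ENNReal.ofReal_mul (by positivity)]
          apply ENNReal.ofReal_le_ofReal
          have : ρ ^ 2 * ((1 + δ) * ρ - ρ) = ρ ^ 3 * δ := by ring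
          rw [this]; gcongr
      _ = ∫⁻ r in Ioo ρ ((1 + δ) * ρ), ENNReal.ofReal (ρ ^ 2) := by
          rw [setLIntegral_const, Real.volume_Ioo]
      _ ≤ ∫⁻ r in Ioo ρ ((1 + δ) * ρ), ENNReal.ofReal (r ^ 2) * S.indicator 1 (p - r • dir y p) := by
          refine setLIntegral_mono' measurableSet_Ioo fun r hr => ?_
          have hmem : p - r • dir y p ∈ S := by
            apply subset_toMeasurable
            refine ⟨r / ρ - 1, ⟨?_, ?_⟩, y, hy, ?_⟩
            · rw [sub_pos, one_lt_div hρ0]; exact hr.1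
            · rw [sub_lt_iff_lt_add, div_lt_iff₀ hρ0, add_comm]; exact hr.2
            · beta_reduce
              rw [add_smul_sub_eq]
              congr 2
              change (1 + (r / ρ - 1)) * ρ = r
              field_simp; ring
          rw [indicator_of_mem hmem, Pi.one_apply, mul_one]
          apply ENNReal.ofReal_le_ofReal
          have := hr.1.le
          gcongr
      _ ≤ _ := lintegral_mono_set fun r hr => hρ0.trans hr.1
  · refine (Measurable.lintegral_prod_right' (f := fun q : E3 × ℝ =>
      ENNReal.ofReal (q.2 ^ 2) * S.indicator 1 (p - q.2 • q.1)) ?_)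
    have := (measurable_one (α := ℝ≥0∞)).indicator hS
    fun_prop

lemma volume_coneSlice_le {p : E3} {δ b : ℝ} (hδ : 0 < δ)
    {A : Set E3} (hA : MeasurableSet A) (hpA : ∀ y ∈ A, y ≠ p) (hAb : ∀ y ∈ A, ‖p - y‖ ≤ b)
    (hinj : InjOn (fun y => dir y p) A) :
    volume (coneSlice p δ A) ≤
      ENNReal.ofReal (b ^ 3 * (δ * (1 + δ) ^ 2)) * sphereMeasure ((fun y => dir y p) '' A) := by
  have hd := measurable_dir_left p
  have hPA : MeasurableSet ((fun y => dir y p) '' A) := hA.image_of_measurable_injOn hd hinj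
  have hinj2 : InjOn (fun q : ℝ × E3 => p + (1 + q.1) • (q.2 - p)) (Ioo 0 δ ×ˢ A) := by
    rintro ⟨c, y⟩ ⟨hc, hy⟩ ⟨c', y'⟩ ⟨hc', hy'⟩ h
    simp only [add_smul_sub_eq] at h hc hc' hy hy'
    have hp : 0 < ‖p - y‖ := norm_pos_iff.2 (sub_ne_zero.2 (hpA y hy).symm)
    have hp' : 0 < ‖p - y'‖ := norm_pos_iff.2 (sub_ne_zero.2 (hpA y' hy').symm)
    have e : dir y p = dir y' p := by
      rw [← dir_sub_smul (p := p) (mul_pos (by linarith [hc.1] : 0 < 1 + c) hp) (norm_dir (hpA y hy)), h,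
        dir_sub_smul (mul_pos (by linarith [hc'.1] : 0 < 1 + c') hp') (norm_dir (hpA y' hy'))]
    have hyy : y = y' := hinj hy hy' e
    subst hyy
    have := congrArg (fun v => ‖p - v‖) h
    simp only [sub_sub_cancel, norm_smul, norm_dir (hpA y hy), mul_one, Real.norm_eq_abs] at this
    rw [abs_of_pos (mul_pos (by linarith [hc.1]) hp), abs_of_pos (mul_pos (by linarith [hc'.1]) hp)] at this
    have := mul_right_cancel₀ hp.ne' this
    simp only [Prod.mk.injEq, and_true]; linarith
  have hS : MeasurableSet (coneSlice p δ A) := by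
    rw [coneSlice, ← image_prod]
    exact (measurableSet_Ioo.prod hA).image_of_measurable_injOn (by fun_prop) hinj2
  rw [← lintegral_indicator_one hS, lintegral_polar p (measurable_one.indicator hS),
    ← lintegral_indicator_const hPA]
  have hae := ae_norm_eq_one
  refine lintegral_mono_ae ?_
  filter_upwards [hae] with ω hω
  have hmem : ∀ r : ℝ, 0 < r → p - r • ω ∈ coneSlice p δ A →
      ∃ y ∈ A, dir y p = ω ∧ r ∈ Ioo ‖p - y‖ ((1 + δ) * ‖p - y‖) := by
    rintro r hr ⟨c, hc, y, hy, h⟩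
    simp only [add_smul_sub_eq] at h
    have hp : 0 < ‖p - y‖ := norm_pos_iff.2 (sub_ne_zero.2 (hpA y hy).symm)
    have e : dir y p = ω := by
      rw [← dir_sub_smul (p := p) (mul_pos (by linarith [hc.1] : 0 < 1 + c) hp) (norm_dir (hpA y hy)), h,
        dir_sub_smul hr hω]
    have h' := congrArg (fun v => ‖p - v‖) h
    simp only [sub_sub_cancel, norm_smul, norm_dir (hpA y hy), hω, mul_one, Real.norm_eq_abs] at h'
    rw [abs_of_pos (mul_pos (by linarith [hc.1]) hp), abs_of_pos hr] at h'
    refine ⟨y, hy, e, ?_, ?_⟩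
    · rw [← h']; nlinarith [hc.1]
    · rw [← h']; nlinarith [hc.2]
  by_cases hω' : ω ∈ (fun y => dir y p) '' A
  · rw [indicator_of_mem hω']
    obtain ⟨y, hy, hyω⟩ := hω'
    set ρ := ‖p - y‖
    have hρ : 0 ≤ ρ := norm_nonneg _
    calc _ ≤ ∫⁻ r in Ioi (0 : ℝ), (Ioo ρ ((1 + δ) * ρ)).indicator
            (fun _ => ENNReal.ofReal (((1 + δ) * ρ) ^ 2)) r := by
          refine setLIntegral_mono' measurableSet_Ioi fun r hr => ?_
          by_cases h : p - r • ω ∈ coneSlice p δ A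
          · obtain ⟨y', hy', e, hr'⟩ := hmem r hr h
            obtain rfl : y' = y := hinj hy' hy (e.trans hyω.symm)
            rw [indicator_of_mem h, indicator_of_mem hr', Pi.one_apply, mul_one]
            apply ENNReal.ofReal_le_ofReal
            have h1 : 0 ≤ r := le_of_lt hr
            have h2 := hr'.2.le
            gcongr
          · simp [indicator_of_notMem h]
      _ ≤ ∫⁻ r, (Ioo ρ ((1 + δ) * ρ)).indicator
            (fun _ => ENNReal.ofReal (((1 + δ) * ρ) ^ 2)) r := setLIntegral_le_lintegral _ _
      _ = ENNReal.ofReal (((1 + δ) * ρ) ^ 2) * ENNReal.ofReal ((1 + δ) * ρ - ρ) := by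
          rw [lintegral_indicator_const measurableSet_Ioo, Real.volume_Ioo]
      _ ≤ _ := by
          rw [← ENNReal.ofReal_mul (by positivity)]
          apply ENNReal.ofReal_le_ofReal
          have : ((1 + δ) * ρ) ^ 2 * ((1 + δ) * ρ - ρ) = ρ ^ 3 * (δ * (1 + δ) ^ 2) := by ring
          rw [this]
          have := hAb y hy
          gcongr
  · rw [indicator_of_notMem hω', nonpos_iff_eq_zero, lintegral_eq_zero_of_ae_eq_zero]
    filter_upwards [ae_restrict_mem measurableSet_Ioi] with r hr
    have : p - r • ω ∉ coneSlice p δ A := fun h => by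
      obtain ⟨y, hy, e, -⟩ := hmem r hr h
      exact hω' ⟨y, hy, e⟩
    simp [indicator_of_notMem this]

end RadiativeTransfer

namespace RadiativeTransfer
open scoped ENNReal NNReal

/-- `G` is tangent at `y₀`, in the strict sense, to the plane with normal `n`. -/
def FlatAt (G : Set E3) (y₀ n : E3) : Prop :=
  ∀ ε > 0, ∃ U ∈ 𝓝 y₀, ∀ z ∈ G ∩ U, ∀ w ∈ G ∩ U, |⟪n, z - w⟫| ≤ ε * ‖z - w‖

/-- The derivative of the conical chart used in `FlatAt.exists_slice`. -/
noncomputable def coneChart (n v : E3) : E3 →L[ℝ] E3 :=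
  ContinuousLinearMap.id ℝ E3 + (innerSL ℝ n).smulRight (v - n)

lemma coneChart_apply (n v x : E3) : coneChart n v x = x + ⟪n, x⟫ • (v - n) := rfl

lemma det_coneChart {n : E3} (hn : ‖n‖ = 1) (v : E3) : (coneChart n v).det = ⟪n, v⟫ := by
  have h : ((coneChart n v : E3 →L[ℝ] E3) : E3 →ₗ[ℝ] E3) =
      LinearMap.transvection (innerSL ℝ n : E3 →ₗ[ℝ] ℝ) (v - n) := by
    ext1; rfl
  rw [ContinuousLinearMap.det, h, LinearMap.transvection.det]
  simp [inner_sub_right, hn]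

lemma FlatAt.exists_slice {G : Set E3} {y₀ n : E3} (hG : FlatAt G y₀ n) (hn : ‖n‖ = 1) (p : E3)
    {η δ₀ : ℝ} (hη : 0 < η) (hδ₀ : 0 < δ₀) :
    ∃ U ∈ 𝓝 y₀, ∃ δ ∈ Ioc 0 η, (∀ y ∈ U, ‖y - y₀‖ ≤ η) ∧
      ∀ A ⊆ G ∩ U, MeasurableSet A → ∃ (s : Set E3) (f : E3 → E3),
        ApproximatesLinearOn f (coneChart n (y₀ - p)) s δ₀.toNNReal ∧ f '' s = coneSlice p δ A ∧
        volume s ≤ ENNReal.ofReal δ * (μHE[2] : Measure E3) A ∧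
        ENNReal.ofReal δ * (μHE[2] : Measure E3) A ≤ ENNReal.ofReal ((1 + η) ^ 2) * volume s ∧
        volume s < ⊤ := by
  set κ := min (δ₀ / 5) (min (η / (1 + η)) (1 / 2)) with hκ
  have hκ0 : 0 < κ := by positivity
  have hκ1 : κ ≤ δ₀ / 5 := min_le_left _ _
  have hκ2 : κ ≤ η / (1 + η) := (min_le_right _ _).trans (min_le_left _ _)
  have hκ3 : κ ≤ 1 / 2 := (min_le_right _ _).trans (min_le_right _ _)
  obtain ⟨U, hU, hUG⟩ := hG κ hκ0
  set r := min κ η with hr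
  have hr0 : 0 < r := lt_min hκ0 hη
  refine ⟨U ∩ Metric.closedBall y₀ (r / 2), Filter.inter_mem hU
    (Metric.closedBall_mem_nhds _ (by positivity)), r, ⟨hr0, min_le_right _ _⟩, ?_, ?_⟩
  · intro y hy
    have := mem_closedBall_iff_norm.1 hy.2
    have h2 : r ≤ η := min_le_right _ _
    linarith
  intro A hA hAm
  have hnn : ⟪n, n⟫ = 1 := by rw [real_inner_self_eq_norm_sq, hn]; norm_num
  let π : E3 → E3 := fun v => v - ⟪n, v⟫ • n
  have hπsub : ∀ v w, π v - π w = (v - w) - ⟪n, v - w⟫ • n := fun v w => by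
    simp only [π, inner_sub_right]; module
  have hπn : ∀ v, ⟪n, π v⟫ = 0 := fun v => by
    simp only [π, inner_sub_right, inner_smul_right, hnn]; ring
  have hπ1 : ∀ v w, ‖π v - π w‖ ≤ ‖v - w‖ := by
    intro v w
    rw [hπsub]
    set u := v - w
    have h : ‖u - ⟪n, u⟫ • n‖ ^ 2 = ‖u‖ ^ 2 - ⟪n, u⟫ ^ 2 := by
      rw [@norm_sub_sq_real, norm_smul, inner_smul_right, real_inner_comm, hn, mul_one,
        Real.norm_eq_abs, sq_abs]; ring
    exact le_of_sq_le_sq (by rw [h]; nlinarith [sq_nonneg ⟪n, u⟫]) (norm_nonneg _)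
  have hA1 : ∀ z ∈ A, ∀ w ∈ A, |⟪n, z - w⟫| ≤ κ * ‖z - w‖ := fun z hz w hw =>
    hUG z ⟨(hA hz).1, (hA hz).2.1⟩ w ⟨(hA hw).1, (hA hw).2.1⟩
  have hA2 : ∀ z ∈ A, ∀ w ∈ A, (1 - κ) * ‖z - w‖ ≤ ‖π z - π w‖ := by
    intro z hz w hw
    have h1 : ‖z - w‖ ≤ ‖π z - π w‖ + ‖⟪n, z - w⟫ • n‖ := by
      have : z - w = (π z - π w) + ⟪n, z - w⟫ • n := by rw [hπsub]; module
      conv_lhs => rw [this]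
      exact norm_add_le _ _
    rw [norm_smul, hn, mul_one, Real.norm_eq_abs] at h1
    linarith [hA1 z hz w hw]
  have hAr : ∀ z ∈ A, ‖z - y₀‖ ≤ r / 2 := fun z hz => mem_closedBall_iff_norm.1 (hA hz).2.2
  have hπinj : InjOn π A := by
    intro z hz w hw h
    have := hA2 z hz w hw
    rw [h, sub_self, norm_zero] at this
    have h0 : ‖z - w‖ ≤ 0 := by nlinarith [norm_nonneg (z - w)]
    exact sub_eq_zero.1 (norm_le_zero_iff.1 h0)
  have hπm : Measurable π := by fun_prop
  have hB : MeasurableSet (π '' A) := hAm.image_of_measurable_injOn hπm hπinj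
  have hvol := volume_cylinder hn hB (by rintro _ ⟨v, -, rfl⟩; exact hπn v) r
  set Y := Function.invFunOn π A
  have hY : ∀ z ∈ A, Y (π z) = z := fun z hz => hπinj.leftInvOn_invFunOn hz
  refine ⟨{q | π q ∈ π '' A ∧ ⟪n, q⟫ ∈ Ioo 0 r}, fun q => p + (1 + ⟪n, q⟫) • (Y (π q) - p),
    ?_, ?_, ?_, ?_, ?_⟩
  · rintro q ⟨⟨z, hz, hzq⟩, hq⟩ q' ⟨⟨z', hz', hzq'⟩, hq'⟩
    simp only [← hzq, ← hzq', hY z hz, hY z' hz', coneChart_apply]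
    have e1 : q - q' = (π z - π z') + ⟪n, q - q'⟫ • n := by
      rw [hzq, hzq', hπsub]; module
    set c := ⟪n, q⟫
    set c' := ⟪n, q'⟫
    have hcc : ⟪n, q - q'⟫ = c - c' := inner_sub_right _ _ _
    have e2 : p + (1 + c) • (z - p) - (p + (1 + c') • (z' - p)) -
        (q - q' + ⟪n, q - q'⟫ • (y₀ - p - n)) =
        c • (z - z') + ⟪n, z - z'⟫ • n + (c - c') • (z' - y₀) := by
      rw [hcc]
      conv_lhs => rw [e1, hcc, hπsub]
      module
    rw [e2, Real.coe_toNNReal _ hδ₀.le]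
    have hc : |c| ≤ κ := by
      rw [abs_of_pos hq.1]; exact hq.2.le.trans (min_le_left _ _)
    have hcc' : |c - c'| ≤ ‖q - q'‖ := by
      rw [← hcc]; simpa [hn] using abs_real_inner_le_norm n (q - q')
    have hzz : ‖z - z'‖ ≤ 2 * ‖q - q'‖ := by
      have h1 := hA2 z hz z' hz'
      have h2 := hπ1 q q'
      rw [← hzq, ← hzq'] at h2
      nlinarith [norm_nonneg (z - z')]
    have hr' : ‖z' - y₀‖ ≤ κ := by
      have := hAr z' hz'
      have : r ≤ κ := min_le_left _ _
      linarith
    calc _ ≤ ‖c • (z - z')‖ + ‖⟪n, z - z'⟫ • n‖ + ‖(c - c') • (z' - y₀)‖ := norm_add₃_le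
      _ = |c| * ‖z - z'‖ + |⟪n, z - z'⟫| + |c - c'| * ‖z' - y₀‖ := by
          simp only [norm_smul, hn, mul_one, Real.norm_eq_abs]
      _ ≤ κ * (2 * ‖q - q'‖) + κ * (2 * ‖q - q'‖) + ‖q - q'‖ * κ := by
          have h3 := hA1 z hz z' hz'
          have h4 : κ * ‖z - z'‖ ≤ κ * (2 * ‖q - q'‖) := by gcongr
          gcongr
          exact h3.trans h4
      _ ≤ δ₀ * ‖q - q'‖ := by nlinarith [norm_nonneg (q - q')]
  · ext x
    constructor
    · rintro ⟨q, ⟨⟨z, hz, hzq⟩, hq⟩, rfl⟩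
      refine ⟨⟪n, q⟫, hq, z, hz, ?_⟩
      simp only [← hzq, hY z hz]
    · rintro ⟨c, hc, z, hz, rfl⟩
      have h1 : ⟪n, π z + c • n⟫ = c := by
        rw [inner_add_right, hπn, inner_smul_right, hnn]; ring
      have h2 : π (π z + c • n) = π z := by
        change π z + c • n - ⟪n, π z + c • n⟫ • n = π z
        rw [h1]; module
      refine ⟨π z + c • n, ⟨?_, ?_⟩, ?_⟩
      · rw [h2]; exact mem_image_of_mem _ hz
      · rwa [h1]
      · simp only [h1, h2, hY z hz]
  · have hl : LipschitzOnWith 1 π A := LipschitzOnWith.of_dist_le_mul fun z _ w _ => by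
      simpa [dist_eq_norm] using hπ1 z w
    have h1 := euclideanHausdorff_image_le hl
    rw [ENNReal.coe_one, one_pow, one_mul] at h1
    refine le_trans (le_of_eq hvol) (mul_le_mul_right h1 _)
  · have h1 := euclideanHausdorff_le_image (K := (1 + η).toNNReal) (f := π) (A := A) (by
      intro z hz w hw
      rw [Real.coe_toNNReal _ (by positivity), dist_eq_norm, dist_eq_norm]
      have h2 := hA2 z hz w hw
      have h3 : (1 + η) * κ ≤ η := by
        have := mul_le_mul_of_nonneg_left hκ2 (by positivity : 0 ≤ 1 + η)
        rwa [mul_div_cancel₀ _ (by positivity)] at this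
      nlinarith [norm_nonneg (z - w)])
    have e : ((1 + η).toNNReal : ℝ≥0∞) ^ 2 = ENNReal.ofReal ((1 + η) ^ 2) := by
      rw [ENNReal.ofReal_pow (by positivity)]; rfl
    rw [e] at h1
    calc _ ≤ _ := mul_le_mul_right h1 _
      _ = ENNReal.ofReal ((1 + η) ^ 2) * (ENNReal.ofReal r * (μHE[2] : Measure E3) (π '' A)) := by
          ring
      _ = _ := by rw [← hvol]
  · refine lt_of_le_of_lt (measure_mono ?_)
      (measure_closedBall_lt_top (x := (0 : E3)) (r := ‖y₀‖ + r + r))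
    rintro q ⟨⟨z, hz, hzq⟩, hq⟩
    rw [mem_closedBall_zero_iff]
    have e : q = π z + ⟪n, q⟫ • n := by rw [hzq]; simp only [π]; module
    have h1 : ‖π z‖ ≤ ‖z‖ := by simpa [π] using hπ1 z 0
    have h2 : ‖z‖ ≤ ‖z - y₀‖ + ‖y₀‖ := by simpa using norm_add_le (z - y₀) y₀
    have h3 := norm_add_le (π z) (⟪n, q⟫ • n)
    rw [← e, norm_smul, hn, mul_one, Real.norm_eq_abs, abs_of_pos hq.1] at h3
    linarith [hAr z hz, hq.2]

lemma FlatAt.sphereMeasure_le {G : Set E3} {y₀ n p : E3} (hG : FlatAt G y₀ n) (hn : ‖n‖ = 1)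
    (hp : y₀ ≠ p) {m : ℝ} (hm : |⟪n, y₀ - p⟫| / ‖p - y₀‖ ^ 3 < m) :
    ∃ U ∈ 𝓝 y₀, ∀ A ⊆ G ∩ U, MeasurableSet A →
      sphereMeasure ((fun y => dir y p) '' A) ≤ ENNReal.ofReal m * (μHE[2] : Measure E3) A := by
  set h := |⟪n, y₀ - p⟫|
  set d := ‖p - y₀‖
  have hd : 0 < d := norm_pos_iff.2 (sub_ne_zero.2 hp.symm)
  have hh : 0 ≤ h := abs_nonneg _
  obtain ⟨η, ⟨hη1, hη2⟩, hη⟩ : ∃ η ∈ Ioo 0 d, (h + η) / (d - η) ^ 3 < m := by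
    have hc : ContinuousAt (fun η : ℝ => (h + η) / (d - η) ^ 3) 0 := by
      refine ContinuousAt.div (by fun_prop) (by fun_prop) ?_
      simp [hd.ne']
    have h1 : ∀ᶠ η in 𝓝[>] (0 : ℝ), (h + η) / (d - η) ^ 3 < m :=
      nhdsWithin_le_nhds (hc.eventually_lt_const (by simpa using hm))
    have h2 : ∀ᶠ η in 𝓝[>] (0 : ℝ), η ∈ Ioo 0 d := Ioo_mem_nhdsGT hd
    obtain ⟨η, a, b⟩ := (h2.and h1).exists
    exact ⟨η, a, b⟩
  have hdet : ENNReal.ofReal |(coneChart n (y₀ - p)).det| < ((h + η).toNNReal : ℝ≥0∞) := by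
    rw [det_coneChart hn]
    exact (ENNReal.ofReal_lt_ofReal_iff (by positivity)).2 (by linarith)
  have hev := addHaar_image_le_mul_of_det_lt (volume : Measure E3) _ hdet
  obtain ⟨δ₀, hδ₀, hδ₀'⟩ := (hev.and self_mem_nhdsWithin).exists
  obtain ⟨U, hU, δ, hδ, hUη, hA⟩ := hG.exists_slice hn p hη1 (δ₀ := δ₀) hδ₀'
  refine ⟨U, hU, fun A hAG hAm => ?_⟩
  obtain ⟨s, f, hf, hfs, hs1, -, -⟩ := hA A hAG hAm
  rw [Real.toNNReal_coe] at hf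
  have hvol := hδ₀ s f hf
  rw [hfs] at hvol
  have hdη : 0 < d - η := by linarith
  have hlow := mul_sphereMeasure_le_volume_coneSlice (p := p) (A := A) hδ.1 hdη (fun y hy => by
    have := hUη y (hAG hy).2
    have h3 : ‖p - y₀‖ ≤ ‖p - y‖ + ‖y - y₀‖ := by
      simpa using norm_add_le (p - y) (y - y₀)
    linarith)
  have hpos : 0 < (d - η) ^ 3 * δ := mul_pos (by positivity) hδ.1
  have hle := (hlow.trans hvol).trans (mul_le_mul_right hs1 _)
  rw [← mul_assoc, show (((h + η).toNNReal : ℝ≥0∞)) = ENNReal.ofReal (h + η) from rfl,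
    ← ENNReal.ofReal_mul (by positivity)] at hle
  have h5 : (h + η) * δ ≤ (d - η) ^ 3 * δ * m := by
    rw [div_lt_iff₀ (by positivity)] at hη
    nlinarith [hδ.1]
  have hle2 := hle.trans (mul_le_mul_left (ENNReal.ofReal_le_ofReal h5) _)
  rw [ENNReal.ofReal_mul hpos.le, mul_assoc] at hle2
  exact (ENNReal.mul_le_mul_iff_right (by simpa using hpos) ENNReal.ofReal_ne_top).1 hle2

lemma FlatAt.le_sphereMeasure {G : Set E3} {y₀ n p : E3} (hG : FlatAt G y₀ n) (hn : ‖n‖ = 1)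
    (hp : y₀ ≠ p) {m : ℝ} (hm : m < |⟪n, y₀ - p⟫| / ‖p - y₀‖ ^ 3) :
    ∃ U ∈ 𝓝 y₀, ∀ A ⊆ G ∩ U, MeasurableSet A → InjOn (fun y => dir y p) A →
      ENNReal.ofReal m * (μHE[2] : Measure E3) A ≤ sphereMeasure ((fun y => dir y p) '' A) := by
  rcases le_or_gt m 0 with hm0 | hm0
  · exact ⟨univ, Filter.univ_mem, fun A _ _ _ => by simp [ENNReal.ofReal_of_nonpos hm0]⟩
  set h := |⟪n, y₀ - p⟫|
  set d := ‖p - y₀‖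
  have hd : 0 < d := norm_pos_iff.2 (sub_ne_zero.2 hp.symm)
  have hh : 0 < h := by
    by_contra hcon
    have : h / d ^ 3 ≤ 0 := div_nonpos_of_nonpos_of_nonneg (not_lt.1 hcon) (by positivity)
    linarith
  obtain ⟨η, ⟨⟨hη1, hη2⟩, hη3⟩, hη⟩ : ∃ η, (η ∈ Ioo 0 d ∧ η ∈ Ioo 0 h) ∧
      m < (h - η) / ((d + η) ^ 3 * (1 + η) ^ 4) := by
    have hc : ContinuousAt (fun η : ℝ => (h - η) / ((d + η) ^ 3 * (1 + η) ^ 4)) 0 := by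
      refine ContinuousAt.div (by fun_prop) (by fun_prop) ?_
      simp [hd.ne']
    have h1 : ∀ᶠ η in 𝓝[>] (0 : ℝ), m < (h - η) / ((d + η) ^ 3 * (1 + η) ^ 4) :=
      nhdsWithin_le_nhds (hc.eventually_const_lt (by simpa using hm))
    have h2 : ∀ᶠ η in 𝓝[>] (0 : ℝ), η ∈ Ioo 0 d := Ioo_mem_nhdsGT hd
    have h3 : ∀ᶠ η in 𝓝[>] (0 : ℝ), η ∈ Ioo 0 h := Ioo_mem_nhdsGT hh
    exact ((h2.and h3).and h1).exists
  have hhη : 0 < h - η := by linarith [hη3.2]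
  have hdet : ((h - η).toNNReal : ℝ≥0∞) < ENNReal.ofReal |(coneChart n (y₀ - p)).det| := by
    rw [det_coneChart hn]
    exact (ENNReal.ofReal_lt_ofReal_iff hh).2 (by linarith)
  have hev := mul_le_addHaar_image_of_lt_det (volume : Measure E3) _ hdet
  obtain ⟨δ₀, hδ₀, hδ₀'⟩ := (hev.and self_mem_nhdsWithin).exists
  obtain ⟨U, hU, δ, hδ, hUη, hA⟩ := hG.exists_slice hn p hη1 (δ₀ := δ₀) hδ₀'
  refine ⟨U, hU, fun A hAG hAm hinj => ?_⟩
  obtain ⟨s, f, hf, hfs, -, hs2, -⟩ := hA A hAG hAm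
  rw [Real.toNNReal_coe] at hf
  have hvol := hδ₀ s f hf
  rw [hfs] at hvol
  have hb : ∀ y ∈ A, ‖p - y‖ ≤ d + η ∧ d - η ≤ ‖p - y‖ := fun y hy => by
    have h1 := hUη y (hAG hy).2
    have h3 : ‖p - y₀‖ ≤ ‖p - y‖ + ‖y - y₀‖ := by
      simpa using norm_add_le (p - y) (y - y₀)
    have h4 : ‖p - y‖ ≤ ‖p - y₀‖ + ‖y₀ - y‖ := by
      simpa using norm_add_le (p - y₀) (y₀ - y)
    rw [norm_sub_rev y₀ y] at h4
    constructor <;> linarith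
  have hup := volume_coneSlice_le (p := p) (A := A) hδ.1 hAm (fun y hy e => by
    have := (hb y hy).2
    rw [e, sub_self, norm_zero] at this
    linarith) (fun y hy => (hb y hy).1) hinj
  have hle := hvol.trans hup
  set τ := sphereMeasure ((fun y => dir y p) '' A)
  have hδ0 := hδ.1
  have key : ENNReal.ofReal (δ * (h - η)) * (μHE[2] : Measure E3) A ≤
      ENNReal.ofReal (δ * ((d + η) ^ 3 * (1 + η) ^ 4)) * τ := by
    calc _ = ENNReal.ofReal (h - η) * (ENNReal.ofReal δ * (μHE[2] : Measure E3) A) := by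
          rw [mul_comm δ, ENNReal.ofReal_mul hhη.le, mul_assoc]
      _ ≤ ENNReal.ofReal (h - η) * (ENNReal.ofReal ((1 + η) ^ 2) * volume s) := by gcongr
      _ = ENNReal.ofReal ((1 + η) ^ 2) * (ENNReal.ofReal (h - η) * volume s) := by ring
      _ ≤ ENNReal.ofReal ((1 + η) ^ 2) *
          (ENNReal.ofReal ((d + η) ^ 3 * (δ * (1 + δ) ^ 2)) * τ) := mul_le_mul_right hle _
      _ = ENNReal.ofReal ((1 + η) ^ 2 * ((d + η) ^ 3 * (δ * (1 + δ) ^ 2))) * τ := by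
          rw [← mul_assoc, ENNReal.ofReal_mul (p := (1 + η) ^ 2) (by positivity)]
      _ ≤ _ := by
          refine mul_le_mul_left (ENNReal.ofReal_le_ofReal ?_) _
          have h6 : (1 + δ) ^ 2 ≤ (1 + η) ^ 2 := by
            have := hδ.2
            gcongr
          calc (1 + η) ^ 2 * ((d + η) ^ 3 * (δ * (1 + δ) ^ 2))
              ≤ (1 + η) ^ 2 * ((d + η) ^ 3 * (δ * (1 + η) ^ 2)) := by gcongr
            _ = _ := by ring
  have hC : 0 < (d + η) ^ 3 * (1 + η) ^ 4 := by positivity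
  have h5 : δ * ((d + η) ^ 3 * (1 + η) ^ 4) * m ≤ δ * (h - η) := by
    rw [lt_div_iff₀ hC] at hη
    nlinarith
  have hle2 := (mul_le_mul_left (ENNReal.ofReal_le_ofReal h5) ((μHE[2] : Measure E3) A)).trans key
  rw [ENNReal.ofReal_mul (by positivity), mul_assoc] at hle2
  exact (ENNReal.mul_le_mul_iff_right (by simpa using mul_pos hδ0 hC) ENNReal.ofReal_ne_top).1 hle2

end RadiativeTransfer

namespace RadiativeTransfer
open scoped ENNReal NNReal

variable {Ω : Set E3}

lemma hasDerivAt_line {f : E3 → ℝ} {y : E3} (hf : ContDiffAt ℝ 1 f y) (v : E3) :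
    HasDerivAt (fun t : ℝ => f (y + t • v)) ⟪gradient f y, v⟫ 0 := by
  have h1 : HasFDerivAt f (fderiv ℝ f y) (y + (0 : ℝ) • v) := by
    simpa using (hf.differentiableAt (by norm_num)).hasFDerivAt
  have h2 : HasDerivAt (fun t : ℝ => y + t • v) v 0 := by
    simpa using ((hasDerivAt_id (0 : ℝ)).smul_const v).const_add y
  have h3 := h1.comp_hasDerivAt (0 : ℝ) h2
  have h4 : ⟪gradient f y, v⟫ = fderiv ℝ f y v := by simp [gradient]
  rw [h4]; exact h3

lemma eventually_neg_of_hasDerivAt {g : ℝ → ℝ} {g' : ℝ} (h : HasDerivAt g g' 0) (h0 : g 0 = 0)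
    (hg : g' < 0) : ∀ᶠ t in 𝓝[>] (0 : ℝ), g t < 0 := by
  have h1 := (hasDerivAt_iff_tendsto_slope.1 h).mono_left
    (nhdsWithin_mono 0 (fun t (ht : 0 < t) => ht.ne') : 𝓝[>] (0 : ℝ) ≤ 𝓝[≠] 0)
  filter_upwards [h1.eventually_lt_const hg, self_mem_nhdsWithin] with t ht ht0
  rw [slope_def_field, h0, sub_zero, sub_zero, div_neg_iff] at ht
  rcases ht with ⟨-, h⟩ | ⟨h, -⟩
  · exact absurd h (not_lt.2 (le_of_lt ht0))
  · exact h

lemma tendsto_line (y v : E3) : Filter.Tendsto (fun t : ℝ => y + t • v) (𝓝[>] 0) (𝓝 y) := by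
  have : ContinuousAt (fun t : ℝ => y + t • v) 0 := by fun_prop
  simpa [ContinuousAt] using this.tendsto.mono_left nhdsWithin_le_nhds

lemma inner_normalized_neg_iff {g v : E3} (hg : g ≠ 0) : ⟪‖g‖⁻¹ • g, v⟫ < 0 ↔ ⟪g, v⟫ < 0 := by
  have : 0 < ‖g‖⁻¹ := inv_pos.2 (norm_pos_iff.2 hg)
  rw [real_inner_smul_left]
  constructor
  · intro h; by_contra hc; nlinarith
  · intro h; nlinarith

lemma IsOuterUnitNormal.eventually_mem {y m v : E3} (h : IsOuterUnitNormal Ω y m)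
    (hv : ⟪m, v⟫ < 0) : ∀ᶠ t in 𝓝[>] (0 : ℝ), y + t • v ∈ Ω := by
  obtain ⟨f, hf, hf0, hg, hΩ, rfl⟩ := h
  rw [inner_normalized_neg_iff hg] at hv
  filter_upwards [eventually_neg_of_hasDerivAt (hasDerivAt_line hf v) (by simpa using hf0) hv,
    (tendsto_line y v).eventually hΩ] with t h1 h2
  exact h2.2 h1

lemma IsOuterUnitNormal.eventually_notMem {y m v : E3} (h : IsOuterUnitNormal Ω y m)
    (hv : 0 < ⟪m, v⟫) : ∀ᶠ t in 𝓝[>] (0 : ℝ), y + t • v ∉ Ω := by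
  obtain ⟨f, hf, hf0, hg, hΩ, rfl⟩ := h
  rw [← neg_neg ⟪_, v⟫, neg_pos, ← inner_neg_right, inner_normalized_neg_iff hg, inner_neg_right] at hv
  have h1 := (hasDerivAt_line hf v).neg
  filter_upwards [eventually_neg_of_hasDerivAt h1 (by simpa using hf0) hv,
    (tendsto_line y v).eventually hΩ] with t h1 h2
  rw [h2, not_lt]
  exact le_of_lt (by simpa using h1)

lemma IsOuterUnitNormal.norm_eq {y m : E3} (h : IsOuterUnitNormal Ω y m) : ‖m‖ = 1 := by
  obtain ⟨f, -, -, hg, -, rfl⟩ := h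
  rw [norm_smul, norm_inv, norm_norm, inv_mul_cancel₀ (norm_ne_zero_iff.2 hg)]

lemma IsOuterUnitNormal.unique {y m m' : E3} (h : IsOuterUnitNormal Ω y m)
    (h' : IsOuterUnitNormal Ω y m') : m = m' := by
  by_contra hne
  have h1 := h.norm_eq
  have h2 := h'.norm_eq
  have hlt : ⟪m, m'⟫ < 1 := inner_lt_one_iff_real_of_norm_eq_one h1 h2 |>.2 hne
  have e1 : ⟪m, m' - m⟫ < 0 := by
    rw [inner_sub_right, real_inner_self_eq_norm_sq, h1]; linarith
  have e2 : 0 < ⟪m', m' - m⟫ := by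
    rw [inner_sub_right, real_inner_self_eq_norm_sq, h2, real_inner_comm]; linarith
  obtain ⟨t, a, b⟩ := ((h.eventually_mem e1).and (h'.eventually_notMem e2)).exists
  exact b a

lemma IsOuterUnitNormal.outerNormal_eq {y m : E3} (h : IsOuterUnitNormal Ω y m) :
    outerNormal Ω y = m := by
  have hex : ∃ m, IsOuterUnitNormal Ω y m := ⟨m, h⟩
  rw [outerNormal, dif_pos hex]
  exact hex.choose_spec.unique h

lemma isOuterUnitNormal_outerNormal {y : E3} (h : y ∈ regularBoundary Ω) :
    IsOuterUnitNormal Ω y (outerNormal Ω y) := by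
  obtain ⟨m, hm⟩ := h
  rwa [hm.outerNormal_eq]

lemma outerNormal_of_notMem {y : E3} (h : y ∉ regularBoundary Ω) : outerNormal Ω y = 0 := by
  exact dif_neg h

lemma norm_outerNormal {y : E3} (h : y ∈ regularBoundary Ω) : ‖outerNormal Ω y‖ = 1 :=
  (isOuterUnitNormal_outerNormal h).norm_eq

lemma regularBoundary_subset_frontier (hΩ : IsOpen Ω) : regularBoundary Ω ⊆ frontier Ω := by
  rintro y ⟨m, h⟩
  rw [hΩ.frontier_eq]
  constructor
  · have hm : ⟪m, -m⟫ < 0 := by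
      rw [inner_neg_right, real_inner_self_eq_norm_sq, h.norm_eq]; norm_num
    exact mem_closure_of_tendsto (tendsto_line y (-m)) (h.eventually_mem hm)
  · obtain ⟨f, -, hf0, -, he, -⟩ := h
    rw [he.self_of_nhds, hf0]; exact lt_irrefl _

lemma eventually_eq_zero_of_mem_frontier (hΩ : IsOpen Ω) {f : E3 → ℝ} {y : E3}
    (hf : ContDiffAt ℝ 1 f y) (he : ∀ᶠ z in 𝓝 y, z ∈ Ω ↔ f z < 0) :
    ∀ᶠ z in 𝓝 y, z ∈ frontier Ω → f z = 0 := by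
  filter_upwards [he.eventually_nhds, hf.eventually (by simp)] with z hz hc hzf
  rw [hΩ.frontier_eq] at hzf
  apply le_antisymm
  · by_contra hpos
    have h1 := hc.continuousAt.eventually_const_lt (not_le.1 hpos)
    obtain ⟨w, ⟨hw1, hw2⟩, hw3⟩ :=
      ((hz.and h1).and_frequently (mem_closure_iff_frequently.1 hzf.1)).exists
    linarith [hw1.1 hw3]
  · by_contra hneg
    exact hzf.2 (hz.self_of_nhds.2 (not_le.1 hneg))

lemma flatAt_frontier (hΩ : IsOpen Ω) {y : E3} (hy : y ∈ regularBoundary Ω) :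
    FlatAt (frontier Ω) y (outerNormal Ω y) := by
  obtain ⟨m, hm⟩ := hy
  rw [hm.outerNormal_eq]
  obtain ⟨f, hf, hf0, hg, he, rfl⟩ := hm
  have hgpos : 0 < ‖gradient f y‖ := norm_pos_iff.2 hg
  intro ε hε
  have hs := hf.hasStrictFDerivAt (by norm_num)
  have hc : 0 < (ε * ‖gradient f y‖).toNNReal := Real.toNNReal_pos.2 (by positivity)
  obtain ⟨s, hs, happ⟩ := hs.approximates_deriv_on_nhds (Or.inr hc)
  refine ⟨_, Filter.inter_mem hs (eventually_eq_zero_of_mem_frontier hΩ hf he), ?_⟩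
  rintro z ⟨hz, hzs, hz0⟩ w ⟨hw, hws, hw0⟩
  have h := happ z hzs w hws
  rw [hz0 hz, hw0 hw, sub_zero, zero_sub, norm_neg, Real.coe_toNNReal _ (by positivity)] at h
  have h4 : ⟪gradient f y, z - w⟫ = fderiv ℝ f y (z - w) := by simp [gradient]
  rw [← h4, Real.norm_eq_abs] at h
  rw [real_inner_smul_left, abs_mul, abs_inv, abs_norm, inv_mul_le_iff₀ hgpos]
  linarith

lemma eventually_isOuterUnitNormal (hΩ : IsOpen Ω) {y : E3} (hy : y ∈ regularBoundary Ω) :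
    ∃ N : E3 → E3, ContinuousAt N y ∧ ∀ᶠ z in 𝓝 y, z ∈ frontier Ω → IsOuterUnitNormal Ω z (N z) := by
  obtain ⟨m, f, hf, hf0, hg, he, rfl⟩ := hy
  have hcont : ContinuousAt (gradient f) y := by
    have h1 : ContinuousAt (fderiv ℝ f) y :=
      (hf.fderiv_right (m := 0) (by norm_num)).continuousAt
    exact (InnerProductSpace.toDual ℝ E3).symm.continuous.continuousAt.comp h1
  refine ⟨fun z => ‖gradient f z‖⁻¹ • gradient f z,
    (hcont.norm.inv₀ (norm_ne_zero_iff.2 hg)).smul hcont, ?_⟩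
  filter_upwards [eventually_eq_zero_of_mem_frontier hΩ hf he, he.eventually_nhds,
    hf.eventually (by simp), hcont.eventually_ne hg] with z h1 h2 h3 h4 hz
  exact ⟨f, h3, h1 hz, h4, h2, rfl⟩

lemma continuousOn_outerNormal (hΩ : IsOpen Ω) : ContinuousOn (outerNormal Ω) (regularBoundary Ω) := by
  intro y hy
  obtain ⟨N, hN, h⟩ := eventually_isOuterUnitNormal hΩ hy
  refine (hN.continuousWithinAt (s := regularBoundary Ω)).congr_of_eventuallyEq ?_ ?_
  · filter_upwards [nhdsWithin_le_nhds h, self_mem_nhdsWithin] with z h1 h2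
    exact (h1 (regularBoundary_subset_frontier hΩ h2)).outerNormal_eq
  · exact (h.self_of_nhds (regularBoundary_subset_frontier hΩ hy)).outerNormal_eq

lemma measurableSet_regularBoundary (hΩ : IsOpen Ω) : MeasurableSet (regularBoundary Ω) := by
  have : regularBoundary Ω = frontier Ω ∩ interior {y | y ∈ frontier Ω → y ∈ regularBoundary Ω} := by
    ext y
    refine ⟨fun hy => ⟨regularBoundary_subset_frontier hΩ hy, ?_⟩, fun h => interior_subset h.2 h.1⟩
    rw [mem_interior_iff_mem_nhds]
    obtain ⟨N, -, h⟩ := eventually_isOuterUnitNormal hΩ hy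
    filter_upwards [h] with z hz hzf
    exact ⟨_, hz hzf⟩
  rw [this]
  exact isClosed_frontier.measurableSet.inter isOpen_interior.measurableSet

lemma measurable_outerNormal (hΩ : IsOpen Ω) : Measurable (outerNormal Ω) := by
  classical
  have h := (continuousOn_outerNormal hΩ).measurable_piecewise
    (continuousOn_const (c := (0 : E3)) (s := (regularBoundary Ω)ᶜ)) (measurableSet_regularBoundary hΩ)
  convert h using 1
  ext1 y
  by_cases hy : y ∈ regularBoundary Ω
  · simp [hy]
  · simp [hy, outerNormal_of_notMem hy]

end RadiativeTransfer

namespace RadiativeTransfer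
open scoped ENNReal NNReal

variable {Ω : Set E3}

/-- A measurable set on which a property of measurable subsets holds locally can be partitioned
into countably many measurable sets with this property. -/
lemma exists_measurable_partition {X : Type*} [TopologicalSpace X] [SecondCountableTopology X]
    [MeasurableSpace X] [OpensMeasurableSpace X] {A : Set X} (hA : MeasurableSet A)
    {Q : Set X → Prop}
    (h0 : Q ∅) (h : ∀ y ∈ A, ∃ U ∈ 𝓝 y, ∀ B ⊆ A ∩ U, MeasurableSet B → Q B) :
    ∃ s : ℕ → Set X, (∀ i, MeasurableSet (s i)) ∧ Pairwise (fun i j => Disjoint (s i) (s j)) ∧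
      ⋃ i, s i = A ∧ ∀ i, Q (s i) := by
  rcases A.eq_empty_or_nonempty with rfl | ⟨y₀, hy₀⟩
  · exact ⟨fun _ => ∅, by simp, fun _ _ _ => disjoint_bot_left, by simp, fun _ => h0⟩
  choose! U hU hQ using h
  obtain ⟨t, htA, htc, ht⟩ := TopologicalSpace.countable_cover_nhdsWithin
    (f := fun y => interior (U y)) (s := A)
    (fun y hy => nhdsWithin_le_nhds (interior_mem_nhds.2 (hU y hy)))
  obtain ⟨y₁, hy₁⟩ : t.Nonempty := by
    obtain ⟨y, hy, -⟩ := mem_iUnion₂.1 (ht hy₀)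
    exact ⟨y, hy⟩
  obtain ⟨e, rfl⟩ := htc.exists_eq_range ⟨y₁, hy₁⟩
  set s₀ : ℕ → Set X := fun i => A ∩ interior (U (e i))
  have hs₀ : ∀ i, MeasurableSet (s₀ i) := fun i => hA.inter isOpen_interior.measurableSet
  refine ⟨disjointed s₀, fun i => MeasurableSet.disjointed hs₀ i, disjoint_disjointed s₀, ?_, fun i => ?_⟩
  · rw [iUnion_disjointed, ← inter_iUnion, inter_eq_left]
    refine ht.trans ?_
    simp
  · refine hQ (e i) (htA (mem_range_self i)) _ ?_ (MeasurableSet.disjointed hs₀ i)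
    exact (disjointed_subset s₀ i).trans (inter_subset_inter_right _ interior_subset)

lemma disjoint_image_of_injOn {X Y : Type*} {f : X → Y} {A s t : Set X} (hf : InjOn f A)
    (hs : s ⊆ A) (ht : t ⊆ A) (h : Disjoint s t) : Disjoint (f '' s) (f '' t) :=
  disjoint_image_image fun _ hb _ hc e =>
    disjoint_left.1 h hb ((hf (hs hb) (ht hc) e) ▸ hc)

/-- The density of the solid angle, seen from `p`, with respect to the surface measure. -/
noncomputable def solidAngleDensity (Ω : Set E3) (p y : E3) : ℝ :=
  |⟪p - y, outerNormal Ω y⟫| / ‖p - y‖ ^ 3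

lemma solidAngleDensity_nonneg (Ω : Set E3) (p y : E3) : 0 ≤ solidAngleDensity Ω p y := by
  unfold solidAngleDensity; positivity

lemma measurable_solidAngleDensity (hΩ : IsOpen Ω) (p : E3) :
    Measurable (solidAngleDensity Ω p) := by
  have := measurable_outerNormal hΩ
  unfold solidAngleDensity
  fun_prop

lemma continuousWithinAt_solidAngleDensity (hΩ : IsOpen Ω) {p y : E3} (hy : y ∈ regularBoundary Ω)
    (hp : y ≠ p) : ContinuousWithinAt (solidAngleDensity Ω p) (regularBoundary Ω) y := by
  have h1 := continuousOn_outerNormal hΩ y hy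
  have h2 : ContinuousWithinAt (fun z : E3 => p - z) (regularBoundary Ω) y := by fun_prop
  refine ContinuousWithinAt.div (h2.inner h1).abs (h2.norm.pow 3) ?_
  have : ‖p - y‖ ≠ 0 := norm_ne_zero_iff.2 (sub_ne_zero.2 hp.symm)
  positivity

/-- The surface measure is locally finite at the regular boundary points. -/
lemma exists_nhds_surface_lt_top (hΩ : IsOpen Ω) {y : E3} (hy : y ∈ regularBoundary Ω) :
    ∃ U ∈ 𝓝 y, ∀ A ⊆ frontier Ω ∩ U, MeasurableSet A → (μHE[2] : Measure E3) A < ⊤ := by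
  obtain ⟨U, hU, δ, hδ, -, h⟩ := (flatAt_frontier hΩ hy).exists_slice (norm_outerNormal hy) y
    one_pos one_pos
  refine ⟨U, hU, fun A hA hAm => ?_⟩
  obtain ⟨s, f, -, -, -, h1, h2⟩ := h A hA hAm
  have h3 := h1.trans_lt (ENNReal.mul_lt_top ENNReal.ofReal_lt_top h2)
  rw [ENNReal.mul_lt_top_iff] at h3
  rcases h3 with h | h | h
  · exact h.2
  · simp [not_le.2 hδ.1] at h
  · simp [h]

lemma abs_inner_div_eq (p y n : E3) :
    |⟪n, y - p⟫| / ‖p - y‖ ^ 3 = |⟪p - y, n⟫| / ‖p - y‖ ^ 3 := by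
  rw [real_inner_comm, ← abs_neg, ← inner_neg_left, neg_sub]

lemma sphereMeasure_image_le_add (hΩ : IsOpen Ω) {p : E3} {A : Set E3} (hA : MeasurableSet A)
    (hAr : A ⊆ regularBoundary Ω) (hp : p ∉ A) {ε : ℝ} (hε : 0 < ε) :
    sphereMeasure ((fun y => dir y p) '' A) ≤
      ∫⁻ y in A, (ENNReal.ofReal (solidAngleDensity Ω p y) + ENNReal.ofReal ε)
        ∂(μHE[2] : Measure E3) := by
  obtain ⟨s, hsm, hsd, hsA, hs⟩ := exists_measurable_partition hA
    (Q := fun B => sphereMeasure ((fun y => dir y p) '' B) ≤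
      ∫⁻ y in B, (ENNReal.ofReal (solidAngleDensity Ω p y) + ENNReal.ofReal ε)
        ∂(μHE[2] : Measure E3)) (by simp) (by
      intro y hy
      have hyp : y ≠ p := fun h => hp (h ▸ hy)
      obtain ⟨U, hU, hUA⟩ := (flatAt_frontier hΩ (hAr hy)).sphereMeasure_le
        (norm_outerNormal (hAr hy)) hyp (m := solidAngleDensity Ω p y + ε / 2) (by
          rw [abs_inner_div_eq, solidAngleDensity]; linarith)
      have hw := (continuousWithinAt_solidAngleDensity hΩ (hAr hy) hyp).eventually_const_lt
        (u := solidAngleDensity Ω p y - ε / 2) (by linarith)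
      rw [eventually_nhdsWithin_iff] at hw
      refine ⟨_, Filter.inter_mem hU hw, fun B hB hBm => ?_⟩
      refine (hUA B (fun z hz => ⟨regularBoundary_subset_frontier hΩ (hAr (hB hz).1),
        (hB hz).2.1⟩) hBm).trans ?_
      rw [← setLIntegral_const]
      refine setLIntegral_mono' hBm fun z hz => ?_
      rw [← ENNReal.ofReal_add (solidAngleDensity_nonneg _ _ _) hε.le]
      apply ENNReal.ofReal_le_ofReal
      have := (hB hz).2.2 (hAr (hB hz).1)
      linarith)
  calc _ = sphereMeasure (⋃ i, (fun y => dir y p) '' s i) := by rw [← image_iUnion, hsA]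
    _ ≤ ∑' i, sphereMeasure ((fun y => dir y p) '' s i) := measure_iUnion_le _
    _ ≤ ∑' i, ∫⁻ y in s i, (ENNReal.ofReal (solidAngleDensity Ω p y) + ENNReal.ofReal ε)
        ∂(μHE[2] : Measure E3) := ENNReal.tsum_le_tsum hs
    _ = _ := by rw [← lintegral_iUnion hsm hsd, hsA]

lemma lintegral_solidAngleDensity_le_add (hΩ : IsOpen Ω) {p : E3} {A : Set E3}
    (hA : MeasurableSet A) (hAr : A ⊆ regularBoundary Ω) (hp : p ∉ A)
    (hinj : InjOn (fun y => dir y p) A) {ε : ℝ} (hε : 0 < ε) :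
    ∫⁻ y in A, ENNReal.ofReal (solidAngleDensity Ω p y) ∂(μHE[2] : Measure E3) ≤
      sphereMeasure ((fun y => dir y p) '' A) + ENNReal.ofReal ε * (μHE[2] : Measure E3) A := by
  have hd := measurable_dir_left p
  obtain ⟨s, hsm, hsd, hsA, hs⟩ := exists_measurable_partition hA
    (Q := fun B => ∫⁻ y in B, ENNReal.ofReal (solidAngleDensity Ω p y) ∂(μHE[2] : Measure E3) ≤
      sphereMeasure ((fun y => dir y p) '' B) + ENNReal.ofReal ε * (μHE[2] : Measure E3) B)
      (by simp) (by
      intro y hy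
      have hyp : y ≠ p := fun h => hp (h ▸ hy)
      obtain ⟨U, hU, hUA⟩ := (flatAt_frontier hΩ (hAr hy)).le_sphereMeasure
        (norm_outerNormal (hAr hy)) hyp (m := solidAngleDensity Ω p y - ε / 2) (by
          rw [abs_inner_div_eq, solidAngleDensity]; linarith)
      have hw := (continuousWithinAt_solidAngleDensity hΩ (hAr hy) hyp).eventually_lt_const
        (u := solidAngleDensity Ω p y + ε / 2) (by linarith)
      rw [eventually_nhdsWithin_iff] at hw
      refine ⟨_, Filter.inter_mem hU hw, fun B hB hBm => ?_⟩
      have h1 := hUA B (fun z hz => ⟨regularBoundary_subset_frontier hΩ (hAr (hB hz).1),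
        (hB hz).2.1⟩) hBm (hinj.mono fun z hz => (hB hz).1)
      refine le_trans ?_ (add_le_add_left h1 _)
      rw [← add_mul, ← setLIntegral_const]
      refine setLIntegral_mono' hBm fun z hz => ?_
      have := (hB hz).2.2 (hAr (hB hz).1)
      calc ENNReal.ofReal (solidAngleDensity Ω p z)
          ≤ ENNReal.ofReal ((solidAngleDensity Ω p y - ε / 2) + ε) :=
            ENNReal.ofReal_le_ofReal (by linarith)
        _ ≤ _ := ENNReal.ofReal_add_le)
  have himg : ∀ i, MeasurableSet ((fun y => dir y p) '' s i) := fun i =>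
    (hsm i).image_of_measurable_injOn hd (hinj.mono (hsA ▸ subset_iUnion s i))
  have hdisj : Pairwise (Function.onFun Disjoint fun i => (fun y => dir y p) '' s i) :=
     fun i j hij => disjoint_image_of_injOn hinj (hsA ▸ subset_iUnion s i)
      (hsA ▸ subset_iUnion s j) (hsd hij)
  calc _ = ∑' i, ∫⁻ y in s i, ENNReal.ofReal (solidAngleDensity Ω p y) ∂(μHE[2] : Measure E3) := by
          rw [← lintegral_iUnion hsm hsd, hsA]
    _ ≤ ∑' i, (sphereMeasure ((fun y => dir y p) '' s i) +
          ENNReal.ofReal ε * (μHE[2] : Measure E3) (s i)) := ENNReal.tsum_le_tsum hs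
    _ = _ := by
      rw [ENNReal.tsum_add, ENNReal.tsum_mul_left, ← measure_iUnion hsd hsm, hsA,
        ← measure_iUnion hdisj himg, ← image_iUnion, hsA]

/-- A measurable set of regular points can be partitioned into sets of finite area. -/
lemma exists_finite_partition (hΩ : IsOpen Ω) {A : Set E3} (hA : MeasurableSet A)
    (hAr : A ⊆ regularBoundary Ω) :
    ∃ s : ℕ → Set E3, (∀ i, MeasurableSet (s i)) ∧ Pairwise (fun i j => Disjoint (s i) (s j)) ∧
      ⋃ i, s i = A ∧ ∀ i, (μHE[2] : Measure E3) (s i) ≠ ⊤ :=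
  exists_measurable_partition hA (Q := fun B => (μHE[2] : Measure E3) B ≠ ⊤) (by simp) fun y hy => by
    obtain ⟨U, hU, h⟩ := exists_nhds_surface_lt_top hΩ (hAr hy)
    exact ⟨U, hU, fun B hB hBm => (h B (fun z hz =>
      ⟨regularBoundary_subset_frontier hΩ (hAr (hB hz).1), (hB hz).2⟩) hBm).ne⟩

lemma le_of_forall_pos_le_add_mul {a b c : ℝ≥0∞} (hc : c ≠ ⊤)
    (h : ∀ ε : ℝ, 0 < ε → a ≤ b + ENNReal.ofReal ε * c) : a ≤ b := by
  refine ENNReal.le_of_forall_pos_le_add fun ε hε _ => ?_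
  have h1 := h (ε / (c.toReal + 1)) (by positivity)
  refine h1.trans (add_le_add_right ?_ _)
  rw [← ENNReal.ofReal_toReal hc, ← ENNReal.ofReal_mul (by positivity),
    ENNReal.toReal_ofReal (by positivity)]
  rw [← ENNReal.ofReal_coe_nnreal]
  apply ENNReal.ofReal_le_ofReal
  have : (0 : ℝ) ≤ c.toReal := by positivity
  rw [div_mul_eq_mul_div, div_le_iff₀ (by positivity)]
  have : (0 : ℝ) < ε := hε
  nlinarith

lemma sphereMeasure_image_le (hΩ : IsOpen Ω) {p : E3} {A : Set E3} (hA : MeasurableSet A)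
    (hAr : A ⊆ regularBoundary Ω) (hp : p ∉ A) :
    sphereMeasure ((fun y => dir y p) '' A) ≤
      ∫⁻ y in A, ENNReal.ofReal (solidAngleDensity Ω p y) ∂(μHE[2] : Measure E3) := by
  obtain ⟨s, hsm, hsd, hsA, hs⟩ := exists_finite_partition hΩ hA hAr
  have hsub : ∀ i, s i ⊆ A := fun i => hsA ▸ subset_iUnion s i
  have hm := (measurable_solidAngleDensity hΩ p).ennreal_ofReal
  calc _ = sphereMeasure (⋃ i, (fun y => dir y p) '' s i) := by rw [← image_iUnion, hsA]
    _ ≤ ∑' i, sphereMeasure ((fun y => dir y p) '' s i) := measure_iUnion_le _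
    _ ≤ ∑' i, ∫⁻ y in s i, ENNReal.ofReal (solidAngleDensity Ω p y) ∂(μHE[2] : Measure E3) := by
        refine ENNReal.tsum_le_tsum fun i => le_of_forall_pos_le_add_mul (hs i) fun ε hε => ?_
        have := sphereMeasure_image_le_add hΩ (hsm i) ((hsub i).trans hAr)
          (fun h => hp (hsub i h)) hε
        rwa [lintegral_add_left hm, setLIntegral_const] at this
    _ = _ := by rw [← lintegral_iUnion hsm hsd, hsA]

/-- The solid angle under which a part of the boundary is seen from `p`. -/
lemma sphereMeasure_image_eq (hΩ : IsOpen Ω) {p : E3} {A : Set E3} (hA : MeasurableSet A)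
    (hAr : A ⊆ regularBoundary Ω) (hp : p ∉ A) (hinj : InjOn (fun y => dir y p) A) :
    sphereMeasure ((fun y => dir y p) '' A) =
      ∫⁻ y in A, ENNReal.ofReal (solidAngleDensity Ω p y) ∂(μHE[2] : Measure E3) := by
  refine le_antisymm (sphereMeasure_image_le hΩ hA hAr hp) ?_
  obtain ⟨s, hsm, hsd, hsA, hs⟩ := exists_finite_partition hΩ hA hAr
  have hsub : ∀ i, s i ⊆ A := fun i => hsA ▸ subset_iUnion s i
  have hd := measurable_dir_left p
  have himg : ∀ i, MeasurableSet ((fun y => dir y p) '' s i) := fun i =>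
    (hsm i).image_of_measurable_injOn hd (hinj.mono (hsub i))
  have hdisj : Pairwise (Function.onFun Disjoint fun i => (fun y => dir y p) '' s i) :=
     fun i j hij => disjoint_image_of_injOn hinj (hsub i) (hsub j) (hsd hij)
  calc _ = ∑' i, ∫⁻ y in s i, ENNReal.ofReal (solidAngleDensity Ω p y) ∂(μHE[2] : Measure E3) := by
          rw [← lintegral_iUnion hsm hsd, hsA]
    _ ≤ ∑' i, sphereMeasure ((fun y => dir y p) '' s i) :=
        ENNReal.tsum_le_tsum fun i => le_of_forall_pos_le_add_mul (hs i) fun ε hε =>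
          lintegral_solidAngleDensity_le_add hΩ (hsm i) ((hsub i).trans hAr)
            (fun h => hp (hsub i h)) (hinj.mono (hsub i)) hε
    _ = _ := by rw [← measure_iUnion hdisj himg, ← image_iUnion, hsA]

end RadiativeTransfer

namespace RadiativeTransfer
open scoped ENNReal NNReal

variable {Ω : Set E3}

lemma flatAt_plane (n : E3) (b : ℝ) (y₀ : E3) : FlatAt {q | ⟪n, q⟫ = b} y₀ n := by
  intro ε hε
  refine ⟨univ, Filter.univ_mem, fun z hz w hw => ?_⟩
  rw [inner_sub_right, show ⟪n, z⟫ = b from hz.1, show ⟪n, w⟫ = b from hw.1, sub_self, abs_zero]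
  positivity

lemma dir_sub_smul_sub {p y : E3} {c : ℝ} (hc : 0 < c) : dir (p - c • (p - y)) p = dir y p := by
  rw [dir, dir, sub_sub_cancel, norm_smul, Real.norm_of_nonneg hc.le, smul_smul, mul_inv,
    mul_comm c⁻¹, mul_assoc, inv_mul_cancel₀ hc.ne', mul_one]

/-- Sets of zero area are seen under zero solid angle. -/
lemma sphereMeasure_image_eq_zero {p : E3} {A : Set E3} (hA : MeasurableSet A)
    (hA0 : (μHE[2] : Measure E3) A = 0) (hp : p ∉ A) :
    sphereMeasure ((fun y => dir y p) '' A) = 0 := by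
  obtain ⟨s, -, -, hsA, hs⟩ := exists_measurable_partition hA
    (Q := fun B => sphereMeasure ((fun y => dir y p) '' B) = 0) (by simp) (by
      intro y₀ hy₀
      have hyp : y₀ ≠ p := fun h => hp (h ▸ hy₀)
      set e := dir y₀ p
      have he : ‖e‖ = 1 := norm_dir hyp
      have hee : ⟪e, e⟫ = 1 := by rw [real_inner_self_eq_norm_sq, he]; norm_num
      have hd : 0 < ‖p - y₀‖ := norm_pos_iff.2 (sub_ne_zero.2 hyp.symm)
      have hpy : p - y₀ = ‖p - y₀‖ • e := (norm_smul_dir p y₀).symm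
      have hpos : 0 < ⟪e, p - y₀⟫ := by
        rw [hpy, inner_smul_right, hee, mul_one]; exact hd
      let ρ : E3 → E3 := fun y => p - ⟪e, p - y⟫⁻¹ • (p - y)
      have hρ₀ : ρ y₀ = p - e := by
        simp only [ρ]
        rw [hpy, inner_smul_right, hee, mul_one, smul_smul, inv_mul_cancel₀ hd.ne', one_smul]
      have hρc : ContDiffAt ℝ 1 ρ y₀ := by
        have h1 : ContDiffAt ℝ 1 (fun y : E3 => ⟪e, p - y⟫⁻¹) y₀ :=
          ContDiffAt.inv (contDiffAt_const.inner ℝ (by fun_prop)) hpos.ne'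
        exact contDiffAt_const.sub (h1.smul (by fun_prop))
      obtain ⟨K, t, ht, hK⟩ := hρc.exists_lipschitzOnWith
      obtain ⟨W, hW, hWB⟩ := (flatAt_plane e (⟪e, p⟫ - 1) (p - e)).sphereMeasure_le he (p := p)
        (by simpa using fun h : e = 0 => by simp [h] at he) (m := 2) (by simp [he])
      have hWρ : ∀ᶠ y in 𝓝 y₀, ρ y ∈ interior W :=
        hρc.continuousAt.eventually_mem (by rw [hρ₀]; exact interior_mem_nhds.2 hW)
      have hpos' : ∀ᶠ y in 𝓝 y₀, 0 < ⟪e, p - y⟫ := by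
        have : ContinuousAt (fun y : E3 => ⟪e, p - y⟫) y₀ := by fun_prop
        exact this.eventually_const_lt hpos
      refine ⟨_, Filter.inter_mem ht (hWρ.and hpos'), fun B hB hBm => ?_⟩
      have hB0 : (μHE[2] : Measure E3) (ρ '' B) = 0 := by
        have h1 := euclideanHausdorff_image_le (hK.mono fun z hz => (hB hz).2.1)
        rw [measure_mono_null (fun z hz => (hB hz).1) hA0, mul_zero] at h1
        exact nonpos_iff_eq_zero.1 h1
      set B' := toMeasurable (μHE[2] : Measure E3) (ρ '' B) ∩ ({q | ⟪e, q⟫ = ⟪e, p⟫ - 1} ∩ interior W)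
      have hpl : MeasurableSet {q : E3 | ⟪e, q⟫ = ⟪e, p⟫ - 1} := by
        have : Measurable fun q : E3 => ⟪e, q⟫ := by fun_prop
        exact this (measurableSet_singleton _)
      have hB'm : MeasurableSet B' :=
        (measurableSet_toMeasurable _ _).inter (hpl.inter isOpen_interior.measurableSet)
      have hB'0 : (μHE[2] : Measure E3) B' = 0 :=
        measure_mono_null inter_subset_left ((measure_toMeasurable _).trans hB0)
      have h2 := hWB B' (fun z hz => ⟨hz.2.1, interior_subset hz.2.2⟩) hB'm
      rw [hB'0, mul_zero, nonpos_iff_eq_zero] at h2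
      refine measure_mono_null ?_ h2
      rintro _ ⟨y, hy, rfl⟩
      have hy1 := (hB hy).2.2.1
      have hy2 := (hB hy).2.2.2
      refine ⟨ρ y, ⟨subset_toMeasurable _ _ (mem_image_of_mem _ hy), ?_, hy1⟩, ?_⟩
      · simp only [ρ, mem_ofPred_eq, inner_sub_right e p, inner_smul_right]
        rw [← inner_sub_right, inv_mul_cancel₀ hy2.ne']
      · exact dir_sub_smul_sub (inv_pos.2 hy2))
  rw [← hsA, image_iUnion]
  exact measure_iUnion_null hs

/-- Almost every line through `p` meets the boundary only at regular points, transversally. -/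
lemma ae_inner_outerNormal_ne_zero (hΩ : IsPiecewiseC1Domain Ω) (p : E3) :
    ∀ᵐ ω ∂sphereMeasure, ∀ y ∈ frontier Ω, y ≠ p → dir y p = ω → ⟪p - y, outerNormal Ω y⟫ ≠ 0 := by
  have hm := measurable_outerNormal hΩ.isOpen
  have hr := measurableSet_regularBoundary hΩ.isOpen
  have h1 : sphereMeasure ((fun y => dir y p) '' ((frontier Ω \ regularBoundary Ω) \ {p})) = 0 :=
    sphereMeasure_image_eq_zero
      ((isClosed_frontier.measurableSet.diff hr).diff (measurableSet_singleton p))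
      (measure_mono_null sdiff_subset hΩ.ae_regular) (by simp)
  set T := (regularBoundary Ω ∩ {y | ⟪p - y, outerNormal Ω y⟫ = 0}) \ {p}
  have hT : MeasurableSet T := by
    have : Measurable fun y : E3 => ⟪p - y, outerNormal Ω y⟫ := by fun_prop
    exact (hr.inter (this (measurableSet_singleton 0))).diff (measurableSet_singleton p)
  have h2 : sphereMeasure ((fun y => dir y p) '' T) = 0 := by
    have h := sphereMeasure_image_le hΩ.isOpen hT (fun y hy => hy.1.1) (p := p) (by simp [T])
    rw [setLIntegral_congr_fun (g := fun _ => 0) hT (fun y hy => ?_), lintegral_zero] at h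
    · exact nonpos_iff_eq_zero.1 h
    · have : ⟪p - y, outerNormal Ω y⟫ = 0 := hy.1.2
      simp [solidAngleDensity, this]
  filter_upwards [measure_eq_zero_iff_ae_notMem.1 h1, measure_eq_zero_iff_ae_notMem.1 h2]
    with ω a b y hy hyp hyω h0
  by_cases hyr : y ∈ regularBoundary Ω
  · exact b ⟨y, ⟨⟨hyr, h0⟩, hyp⟩, hyω⟩
  · exact a ⟨y, ⟨⟨hy, hyr⟩, hyp⟩, hyω⟩

section Integrals

variable {V : Type*} [NormedAddCommGroup V] [NormedSpace ℝ V] [MeasurableSpace V] [BorelSpace V]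
  [SecondCountableTopology V]

lemma map_dir_surface (hΩ : IsOpen Ω) {p : E3} {A : Set E3} (hA : MeasurableSet A)
    (hAr : A ⊆ regularBoundary Ω) (hp : p ∉ A) (hinj : InjOn (fun y => dir y p) A) :
    (((μHE[2] : Measure E3).restrict A).withDensity
      fun y => ENNReal.ofReal (solidAngleDensity Ω p y)).map (fun y => dir y p) =
      sphereMeasure.restrict ((fun y => dir y p) '' A) := by
  have hd := measurable_dir_left p
  ext B hB
  rw [Measure.map_apply hd hB, withDensity_apply _ (hd hB), Measure.restrict_restrict (hd hB),
    Measure.restrict_apply hB, ← sphereMeasure_image_eq hΩ ((hd hB).inter hA)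
      (fun y hy => hAr hy.2) (fun h => hp h.2) (hinj.mono inter_subset_right)]
  congr 1
  ext ω
  constructor
  · rintro ⟨y, ⟨h1, h2⟩, rfl⟩; exact ⟨h1, y, h2, rfl⟩
  · rintro ⟨h1, y, h2, rfl⟩; exact ⟨y, ⟨h1, h2⟩, rfl⟩

/-- Change of variables from boundary points to directions. -/
lemma surface_integral (hΩ : IsOpen Ω) {p : E3} {A : Set E3} (hA : MeasurableSet A)
    (hAr : A ⊆ regularBoundary Ω) (hp : p ∉ A) (hinj : InjOn (fun y => dir y p) A)
    {g : E3 → V} (hg : Measurable g)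
    (hgi : IntegrableOn g ((fun y => dir y p) '' A) sphereMeasure) :
    IntegrableOn (fun y => solidAngleDensity Ω p y • g (dir y p)) A (μHE[2] : Measure E3) ∧
    ∫ y in A, solidAngleDensity Ω p y • g (dir y p) ∂(μHE[2] : Measure E3) =
      ∫ ω in (fun y => dir y p) '' A, g ω ∂sphereMeasure := by
  have hd := measurable_dir_left p
  have hw := (measurable_solidAngleDensity hΩ p).ennreal_ofReal
  have hmap := map_dir_surface hΩ hA hAr hp hinj
  have hfin : ∀ᵐ y ∂((μHE[2] : Measure E3).restrict A),
      ENNReal.ofReal (solidAngleDensity Ω p y) < ⊤ := Filter.Eventually.of_forall fun _ => by simp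
  rw [IntegrableOn, ← hmap, integrable_map_measure hg.aestronglyMeasurable hd.aemeasurable,
    integrable_withDensity_iff_integrable_smul' hw hfin] at hgi
  simp only [ENNReal.toReal_ofReal (solidAngleDensity_nonneg _ _ _), Function.comp] at hgi
  refine ⟨hgi, ?_⟩
  rw [← hmap, integral_map hd.aemeasurable hg.aestronglyMeasurable,
    integral_withDensity_eq_integral_toReal_smul hw hfin]
  simp only [ENNReal.toReal_ofReal (solidAngleDensity_nonneg _ _ _)]

/-- Integration in polar coordinates centered at `p`. -/
lemma polar_integral (p : E3) {k : E3 → V} {H : E3 × ℝ → V} (hH : Measurable H) {C T : ℝ}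
    (hC : ∀ ω r, ‖ω‖ = 1 → 0 < r → ‖H (ω, r)‖ ≤ C) (hT : ∀ ω r, T < r → H (ω, r) = 0)
    (hk : ∀ ω r, ‖ω‖ = 1 → 0 < r → k (p - r • ω) = (r ^ 2)⁻¹ • H (ω, r)) :
    Integrable k ∧ Integrable (fun ω => ∫ r in Ioi (0 : ℝ), H (ω, r)) sphereMeasure ∧
      ∫ y, k y = ∫ ω, (∫ r in Ioi (0 : ℝ), H (ω, r)) ∂sphereMeasure := by
  have hprod : sphereMeasure.prod radialMeasure =
      (sphereMeasure.prod (volume.restrict (Ioi (0 : ℝ)))).withDensity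
        fun q => ENNReal.ofReal (q.2 ^ 2) := by
    rw [radialMeasure, prod_withDensity_right (by fun_prop)]
  have hae : ∀ᵐ q ∂(sphereMeasure.prod (volume.restrict (Ioi (0 : ℝ)))), ‖q.1‖ = 1 ∧ 0 < q.2 :=
    (Measure.quasiMeasurePreserving_fst.ae ae_norm_eq_one).and
      (Measure.quasiMeasurePreserving_snd.ae (ae_restrict_mem measurableSet_Ioi))
  have hkm : AEStronglyMeasurable k volume := by
    have hd := measurable_dir_left p
    have hm : Measurable fun y => (‖p - y‖ ^ 2)⁻¹ • H (dir y p, ‖p - y‖) := by fun_prop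
    refine ⟨_, hm.stronglyMeasurable, ?_⟩
    have : ∀ᵐ y : E3, y ≠ p := by
      rw [ae_iff]; simp
    filter_upwards [this] with y hy
    have h := hk (dir y p) ‖p - y‖ (norm_dir hy) (norm_pos_iff.2 (sub_ne_zero.2 hy.symm))
    rwa [sub_norm_smul_dir] at h
  have hHi : Integrable H (sphereMeasure.prod (volume.restrict (Ioi (0 : ℝ)))) := by
    have hdom : Integrable (fun q : E3 × ℝ => (univ ×ˢ Iic T).indicator (fun _ => C) q)
        (sphereMeasure.prod (volume.restrict (Ioi (0 : ℝ)))) := by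
      rw [integrable_indicator_iff (MeasurableSet.univ.prod measurableSet_Iic)]
      refine integrableOn_const ?_
      rw [Measure.prod_prod, Measure.restrict_apply measurableSet_Iic, inter_comm, Ioi_inter_Iic,
        Real.volume_Ioc]
      exact ENNReal.mul_ne_top (measure_ne_top _ _) ENNReal.ofReal_ne_top
    refine hdom.mono' hH.aestronglyMeasurable ?_
    filter_upwards [hae] with q hq
    by_cases h : q.2 ≤ T
    · rw [indicator_of_mem (by simpa using h)]
      exact hC q.1 q.2 hq.1 hq.2
    · rw [show H q = 0 from hT q.1 q.2 (not_le.1 h), norm_zero, indicator_of_notMem (by simpa using h)]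
  have hcongr : (fun q : E3 × ℝ => (ENNReal.ofReal (q.2 ^ 2)).toReal • k (p - q.2 • q.1)) =ᵐ[
      sphereMeasure.prod (volume.restrict (Ioi (0 : ℝ)))] H := by
    filter_upwards [hae] with q hq
    rw [hk q.1 q.2 hq.1 hq.2, ENNReal.toReal_ofReal (by positivity), smul_smul,
      mul_inv_cancel₀ (pow_ne_zero 2 hq.2.ne'), one_smul]
  have hpm : Measurable fun q : E3 × ℝ => p - q.2 • q.1 := by fun_prop
  have hfin : ∀ᵐ q ∂(sphereMeasure.prod (volume.restrict (Ioi (0 : ℝ)))),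
      ENNReal.ofReal (q.2 ^ 2) < ⊤ := Filter.Eventually.of_forall fun _ => by simp
  have hmap := map_polar p
  rw [← hmap] at hkm
  refine ⟨?_, hHi.integral_prod_left, ?_⟩
  · rw [← hmap, integrable_map_measure hkm hpm.aemeasurable, hprod,
      integrable_withDensity_iff_integrable_smul' (by fun_prop) hfin]
    exact hHi.congr hcongr.symm
  · rw [← integral_prod _ hHi, ← hmap, integral_map hpm.aemeasurable hkm, hprod,
      integral_withDensity_eq_integral_toReal_smul (by fun_prop) hfin]
    exact integral_congr_ae hcongr

end Integrals

end RadiativeTransfer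

namespace RadiativeTransfer
open scoped ENNReal NNReal

variable {Ω : Set E3}

/-- The distance from `q` at which the ray coming back from `q` in the direction `-ω` leaves `Ω`
(`0` if it does not enter `Ω`). The upper bound only matters for non-unit vectors `ω`. -/
noncomputable def exitDist (Ω : Set E3) (q ω : E3) : ℝ :=
  sSup {r | 0 < r ∧ r ≤ Metric.diam Ω ∧ ∀ s ∈ Ioo 0 r, q - s • ω ∈ Ω}

lemma exitDist_nonneg (Ω : Set E3) (q ω : E3) : 0 ≤ exitDist Ω q ω :=
  Real.sSup_nonneg fun _ h => h.1.le

lemma exitDist_le (Ω : Set E3) (q ω : E3) : exitDist Ω q ω ≤ Metric.diam Ω :=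
  Real.sSup_le (fun _ h => h.2.1) Metric.diam_nonneg

lemma le_exitDist_iff' {q ω : E3} {r : ℝ} (hr : 0 < r) :
    r ≤ exitDist Ω q ω ↔ r ≤ Metric.diam Ω ∧ ∀ s ∈ Ioo 0 r, q - s • ω ∈ Ω := by
  have hb : BddAbove {r | 0 < r ∧ r ≤ Metric.diam Ω ∧ ∀ s ∈ Ioo 0 r, q - s • ω ∈ Ω} :=
    ⟨_, fun _ h => h.2.1⟩
  constructor
  · intro h
    refine ⟨h.trans (exitDist_le _ _ _), fun s hs => ?_⟩
    have hne : {r | 0 < r ∧ r ≤ Metric.diam Ω ∧ ∀ s ∈ Ioo 0 r, q - s • ω ∈ Ω}.Nonempty := by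
      by_contra hne
      rw [exitDist, not_nonempty_iff_eq_empty.1 hne, Real.sSup_empty] at h
      linarith
    obtain ⟨r', hr', hsr⟩ := exists_lt_of_lt_csSup hne (hs.2.trans_le h)
    exact hr'.2.2 s ⟨hs.1, hsr⟩
  · rintro ⟨h1, h2⟩
    exact le_csSup hb ⟨hr, h1, h2⟩

lemma le_exitDist_iff (hΩ : Bornology.IsBounded Ω) {q ω : E3} (hω : ‖ω‖ = 1) {r : ℝ} (hr : 0 < r) :
    r ≤ exitDist Ω q ω ↔ ∀ s ∈ Ioo 0 r, q - s • ω ∈ Ω := by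
  rw [le_exitDist_iff' hr, and_iff_right_iff_imp]
  intro h
  refine le_of_forall_lt_imp_le_of_dense fun a ha => ?_
  rcases le_or_gt a 0 with h0 | h0
  · exact h0.trans Metric.diam_nonneg
  · refine le_of_forall_pos_lt_add fun ε hε => ?_
    have hm : 0 < min ε a / 2 := by positivity
    have hmε : min ε a ≤ ε := min_le_left _ _
    have hma : min ε a ≤ a := min_le_right _ _
    have h1 := Metric.dist_le_diam_of_mem hΩ (h a ⟨h0, ha⟩)
      (h (min ε a / 2) ⟨hm, by linarith⟩)
    rw [dist_eq_norm, sub_sub_sub_cancel_left, ← sub_smul, norm_smul, hω, mul_one,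
      Real.norm_eq_abs, abs_sub_comm, abs_of_nonneg (by linarith)] at h1
    linarith

lemma measurable_exitDist (hΩ : IsOpen Ω) :
    Measurable fun q : E3 × E3 => exitDist Ω q.1 q.2 := by
  refine measurable_of_Ici fun r => ?_
  rcases le_or_gt r 0 with hr | hr
  · convert MeasurableSet.univ
    ext q
    simpa using hr.trans (exitDist_nonneg _ _ _)
  have : (fun q : E3 × E3 => exitDist Ω q.1 q.2) ⁻¹' Ici r =
      {_q | r ≤ Metric.diam Ω} ∩ ⋂ n : ℕ, {q : E3 × E3 |
        ∀ s ∈ Icc (1 / ((n : ℝ) + 1)) (r - 1 / ((n : ℝ) + 1)), q.1 - s • q.2 ∈ Ω} := by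
    ext q
    simp only [mem_preimage, mem_Ici, le_exitDist_iff' hr, mem_inter_iff, mem_ofPred_eq, mem_iInter]
    refine and_congr_right fun _ => ⟨fun h n s hs => h s ?_, fun h s hs => ?_⟩
    · have : 0 < 1 / ((n : ℝ) + 1) := by positivity
      exact ⟨this.trans_le hs.1, by linarith [hs.2]⟩
    · obtain ⟨n, hn⟩ := exists_nat_one_div_lt (lt_min hs.1 (sub_pos.2 hs.2))
      have h1 := hn.trans_le (min_le_left _ _)
      have h2 := hn.trans_le (min_le_right _ _)
      exact h n s ⟨h1.le, by linarith⟩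
  rw [this]
  refine (MeasurableSet.const _).inter (MeasurableSet.iInter fun n => IsOpen.measurableSet ?_)
  rw [isOpen_iff_eventually]
  intro q hq
  refine isCompact_Icc.eventually_forall_of_forall_eventually fun s hs => ?_
  have hc : Continuous fun z : (E3 × E3) × ℝ => z.1.1 - z.2 • z.1.2 := by fun_prop
  exact hc.continuousAt.eventually_mem (hΩ.mem_nhds (hq s hs))

lemma exitDist_pos (hΩ : Bornology.IsBounded Ω) {q ω : E3} (hω : ‖ω‖ = 1)
    (h : ∀ᶠ t in 𝓝[>] (0 : ℝ), q + t • (-ω) ∈ Ω) : 0 < exitDist Ω q ω := by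
  obtain ⟨r, hr, h⟩ := mem_nhdsGT_iff_exists_Ioo_subset.1 h
  refine lt_of_lt_of_le hr ((le_exitDist_iff hΩ hω hr).2 fun s hs => ?_)
  have := h hs
  simpa [sub_eq_add_neg] using this

lemma exitDist_pos_of_mem (hΩ : IsOpen Ω) (hb : Bornology.IsBounded Ω) {q ω : E3} (hω : ‖ω‖ = 1)
    (hq : q ∈ Ω) : 0 < exitDist Ω q ω :=
  exitDist_pos hb hω ((tendsto_line q (-ω)).eventually_mem (hΩ.mem_nhds hq))

lemma mem_of_lt_exitDist {q ω : E3} {r : ℝ} (hr : 0 < r) (h : r < exitDist Ω q ω) :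
    q - r • ω ∈ Ω :=
  ((le_exitDist_iff' (hr.trans h)).1 le_rfl).2 r ⟨hr, h⟩

lemma exitPoint_mem_frontier (hΩ : IsOpen Ω) (hb : Bornology.IsBounded Ω) {q ω : E3}
    (hω : ‖ω‖ = 1) (h : 0 < exitDist Ω q ω) : q - exitDist Ω q ω • ω ∈ frontier Ω := by
  set τ := exitDist Ω q ω with hτ
  have hc : Continuous fun t : ℝ => q - t • ω := by fun_prop
  rw [hΩ.frontier_eq]
  constructor
  · have h1 : Filter.Tendsto (fun t : ℝ => q - t • ω) (𝓝[<] τ) (𝓝 (q - τ • ω)) :=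
      hc.continuousAt.tendsto.mono_left nhdsWithin_le_nhds
    refine mem_closure_of_tendsto h1 ?_
    filter_upwards [Ioo_mem_nhdsLT h] with t ht
    exact mem_of_lt_exitDist ht.1 ht.2
  · intro hmem
    have h1 := hc.continuousAt.eventually_mem (hΩ.mem_nhds hmem)
    obtain ⟨ε, hε, hball⟩ := Metric.eventually_nhds_iff.1 h1
    have h2 : τ + ε ≤ τ := by
      conv_rhs => rw [hτ]
      rw [le_exitDist_iff hb hω (by positivity)]
      intro s hs
      rcases lt_or_ge s τ with hsτ | hsτ
      · exact mem_of_lt_exitDist hs.1 hsτ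
      · refine hball ?_
        rw [Real.dist_eq, abs_of_nonneg (by linarith)]
        linarith [hs.2]
    linarith

lemma visible_sub_smul_iff {q ω : E3} {r : ℝ} (hr : 0 < r) :
    Visible Ω q (q - r • ω) ↔ ∀ s ∈ Ioo 0 r, q - s • ω ∈ Ω := by
  rw [Visible, openSegment_eq_image']
  constructor
  · intro h s hs
    refine h ⟨s / r, ⟨div_pos hs.1 hr, (div_lt_one hr).2 hs.2⟩, ?_⟩
    simp only [sub_sub_cancel_left, smul_neg, smul_smul]
    rw [div_mul_cancel₀ _ hr.ne', sub_eq_add_neg]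
  · rintro h _ ⟨θ, hθ, rfl⟩
    have := h (θ * r) ⟨mul_pos hθ.1 hr, by nlinarith [hθ.2]⟩
    simpa [mul_smul, sub_eq_add_neg] using this

lemma visible_iff_le_exitDist (hb : Bornology.IsBounded Ω) {q y : E3} (hy : y ≠ q) :
    Visible Ω q y ↔ ‖q - y‖ ≤ exitDist Ω q (dir y q) := by
  have hr : 0 < ‖q - y‖ := norm_pos_iff.2 (sub_ne_zero.2 hy.symm)
  rw [le_exitDist_iff hb (norm_dir hy) hr, ← visible_sub_smul_iff hr, sub_norm_smul_dir]

lemma visible_and_mem_iff (hΩ : IsOpen Ω) (hb : Bornology.IsBounded Ω) {q y : E3} (hy : y ≠ q) :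
    Visible Ω q y ∧ y ∈ Ω ↔ ‖q - y‖ < exitDist Ω q (dir y q) := by
  have hr : 0 < ‖q - y‖ := norm_pos_iff.2 (sub_ne_zero.2 hy.symm)
  rw [visible_iff_le_exitDist hb hy]
  constructor
  · rintro ⟨h, hyΩ⟩
    refine lt_of_le_of_ne h fun he => ?_
    have h1 := exitPoint_mem_frontier hΩ hb (norm_dir hy) (hr.trans_le h)
    rw [← he, sub_norm_smul_dir, hΩ.frontier_eq] at h1
    exact h1.2 hyΩ
  · intro h
    refine ⟨h.le, ?_⟩
    have := mem_of_lt_exitDist hr h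
    rwa [sub_norm_smul_dir] at this

lemma visible_frontier_iff (hΩ : IsOpen Ω) (hb : Bornology.IsBounded Ω) {q y : E3} (hy : y ≠ q)
    (hyf : y ∈ frontier Ω) : Visible Ω q y ↔ exitDist Ω q (dir y q) = ‖q - y‖ := by
  rw [visible_iff_le_exitDist hb hy]
  refine ⟨fun h => (h.eq_of_not_lt fun hlt => ?_).symm, fun h => h.ge⟩
  rw [hΩ.frontier_eq] at hyf
  exact hyf.2 ((visible_and_mem_iff hΩ hb hy).2 hlt).2

/-- If the ray from `y` in the direction `ω` enters `Ω`, then `ω` does not point outwards. -/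
lemma inner_outerNormal_nonpos {y ω : E3} {r : ℝ} (hr : 0 < r)
    (h : ∀ s ∈ Ioo 0 r, y + s • ω ∈ Ω) : ⟪ω, outerNormal Ω y⟫ ≤ 0 := by
  by_cases hy : y ∈ regularBoundary Ω
  · by_contra hc
    rw [not_le, real_inner_comm] at hc
    obtain ⟨t, h1, h2⟩ := (((isOuterUnitNormal_outerNormal hy).eventually_notMem hc).and
      (Ioo_mem_nhdsGT hr)).exists
    exact h1 (h t h2)
  · rw [outerNormal_of_notMem hy, inner_zero_right]

/-! ### Specular reflection -/

/-- Specular reflection of directions in the plane orthogonal to the unit vector `e`. -/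
noncomputable def mirror (e : E3) : E3 ≃ₗᵢ[ℝ] E3 := (ℝ ∙ e)ᗮ.reflection

lemma mirror_apply {e : E3} (he : ‖e‖ = 1) (v : E3) : mirror e v = v - (2 * ⟪e, v⟫) • e := by
  rw [mirror, Submodule.reflection_orthogonal_apply, Submodule.reflection_singleton_apply, he]
  simp only [RCLike.ofReal_real_eq_id, id, one_pow, div_one]
  module

lemma mirror_mirror (e v : E3) : mirror e (mirror e v) = v := Submodule.reflection_reflection _ _

lemma inner_mirror {e : E3} (he : ‖e‖ = 1) (v : E3) : ⟪e, mirror e v⟫ = -⟪e, v⟫ := by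
  rw [mirror_apply he, inner_sub_right, inner_smul_right, real_inner_self_eq_norm_sq, he]; ring

/-- The mirror image of `x` with respect to the plane `⟪e, y⟫ = b`. -/
noncomputable def mirrorImage (e : E3) (b : ℝ) (x : E3) : E3 := x - (2 * (⟪e, x⟫ - b)) • e

lemma mirrorImage_sub {e : E3} (he : ‖e‖ = 1) {b : ℝ} {z : E3} (hz : ⟪e, z⟫ = b) (x : E3) :
    mirrorImage e b x - z = mirror e (x - z) := by
  rw [mirrorImage, mirror_apply he, inner_sub_right, hz]; module

variable {F : Set E3} {e : E3} {b : ℝ} {x y z : E3}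

lemma reflectDir_eq (he : ‖e‖ = 1) (hz : outerNormal Ω z = e) (ω : E3) :
    reflectDir Ω z ω = mirror e ω := by
  rw [reflectDir, hz, mirror_apply he]

lemma IsReflectionPoint.unfold_ray (hΩ : IsOpen Ω) (hb : Bornology.IsBounded Ω) (hFf : F ⊆ frontier Ω)
    (he : ‖e‖ = 1) (hF : ∀ y ∈ F, outerNormal Ω y = e ∧ ⟪e, y⟫ = b) (hx : x ∈ Ω)
    (h : IsReflectionPoint Ω F x y z) :
    z ≠ x ∧ y ≠ z ∧ dir y z = mirror e (dir z x) ∧ dir y (mirrorImage e b x) = mirror e (dir z x) ∧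
      ‖mirrorImage e b x - y‖ = ‖x - z‖ + ‖z - y‖ ∧ exitDist Ω x (dir z x) = ‖x - z‖ ∧
      ‖z - y‖ ≤ exitDist Ω z (dir y z) ∧ ⟪dir z x, e⟫ < 0 := by
  obtain ⟨hzF, h1, h2, h3, h4⟩ := h
  have hzx : z ≠ x := by
    rintro rfl
    have := hFf hzF
    rw [hΩ.frontier_eq] at this
    exact this.2 hx
  obtain ⟨hn, hzb⟩ := hF z hzF
  rw [reflectDir_eq he hn] at h4
  have hyz : y ≠ z := by
    rintro rfl
    have : ‖dir y y‖ = 1 := by rw [h4, LinearIsometryEquiv.norm_map, norm_dir hzx]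
    simp [dir] at this
  have hxz : 0 < ‖x - z‖ := norm_pos_iff.2 (sub_ne_zero.2 hzx.symm)
  have hpos : 0 < ‖x - z‖ + ‖z - y‖ := by positivity
  have hω : ‖mirror e (dir z x)‖ = 1 := by rw [LinearIsometryEquiv.norm_map, norm_dir hzx]
  have h5 : y = mirrorImage e b x - (‖x - z‖ + ‖z - y‖) • mirror e (dir z x) := by
    have e1 : mirrorImage e b x = z + ‖x - z‖ • mirror e (dir z x) := by
      rw [← map_smul, norm_smul_dir, ← mirrorImage_sub he hzb]; abel
    have e2 : y = z - ‖z - y‖ • mirror e (dir z x) := by rw [← h4, sub_norm_smul_dir]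
    rw [e1, add_smul]
    conv_lhs => rw [e2]
    abel
  refine ⟨hzx, hyz, h4, ?_, ?_, (visible_frontier_iff hΩ hb hzx (hFf hzF)).1 h1,
    (visible_iff_le_exitDist hb hyz).1 h2, by rwa [hn] at h3⟩
  · conv_lhs => rw [h5]
    exact dir_sub_smul hpos hω
  · conv_lhs => rw [h5]
    rw [sub_sub_cancel, norm_smul, hω, mul_one, Real.norm_of_nonneg hpos.le]

lemma isReflectionPoint_of_ray (hb : Bornology.IsBounded Ω)
    (he : ‖e‖ = 1) (hF : ∀ y ∈ F, outerNormal Ω y = e ∧ ⟪e, y⟫ = b) {ω : E3} (hω : ‖ω‖ = 1)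
    (hτ : 0 < exitDist Ω x ω) (hz : x - exitDist Ω x ω • ω ∈ F) (hωe : ⟪ω, e⟫ < 0) {s : ℝ}
    (hs : 0 < s) (hs' : s ≤ exitDist Ω (x - exitDist Ω x ω • ω) (mirror e ω)) :
    IsReflectionPoint Ω F x (x - exitDist Ω x ω • ω - s • mirror e ω)
      (x - exitDist Ω x ω • ω) := by
  have hω' : ‖mirror e ω‖ = 1 := by rw [LinearIsometryEquiv.norm_map, hω]
  refine ⟨hz, ?_, ?_, ?_, ?_⟩
  · rw [visible_sub_smul_iff hτ]
    exact ((le_exitDist_iff' hτ).1 le_rfl).2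
  · rw [visible_sub_smul_iff hs]
    exact ((le_exitDist_iff hb hω' hs).1 hs')
  · rw [dir_sub_smul hτ hω, (hF _ hz).1]; exact hωe
  · rw [dir_sub_smul hτ hω, dir_sub_smul hs hω', reflectDir_eq he (hF _ hz).1]

lemma mirrorImage_eq_ray (he : ‖e‖ = 1) {ω : E3} {t : ℝ} (hz : ⟪e, x - t • ω⟫ = b) :
    mirrorImage e b x = x - t • ω + t • mirror e ω := by
  have := mirrorImage_sub he hz x
  rw [sub_sub_cancel, map_smul] at this
  rw [← this]; abel

lemma ifVisible_of_visible {V : Type*} [Zero V] {v : V} (h : Visible Ω x y) :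
    ifVisible Ω x y v = v := if_pos h

lemma ifVisible_of_not_visible {V : Type*} [Zero V] {v : V} (h : ¬ Visible Ω x y) :
    ifVisible Ω x y v = 0 := if_neg h

lemma ifReflected_of_not {V : Type*} [Zero V] {g : E3 → V}
    (h : ¬ ∃ z, IsReflectionPoint Ω F x y z) : ifReflected Ω F x y g = 0 := dif_neg h

/-- On a flat piece there is at most one point of reflection. -/
lemma ifReflected_of_isReflectionPoint {V : Type*} [Zero V] {g : E3 → V} (hΩ : IsOpen Ω)
    (hb : Bornology.IsBounded Ω) (hFf : F ⊆ frontier Ω)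
    (he : ‖e‖ = 1) (hF : ∀ y ∈ F, outerNormal Ω y = e ∧ ⟪e, y⟫ = b) (hx : x ∈ Ω)
    (h : IsReflectionPoint Ω F x y z) : ifReflected Ω F x y g = g z := by
  have hex : ∃ z, IsReflectionPoint Ω F x y z := ⟨z, h⟩
  rw [ifReflected, dif_pos hex]
  obtain ⟨-, -, -, h1, -, h2, -⟩ := h.unfold_ray hΩ hb hFf he hF hx
  obtain ⟨-, -, -, h1', -, h2', -⟩ := hex.choose_spec.unfold_ray hΩ hb hFf he hF hx
  have hd : dir z x = dir hex.choose x := (mirror e).injective (h1.symm.trans h1')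
  congr 1
  rw [← sub_norm_smul_dir x z, ← h2, hd, h2', sub_norm_smul_dir]

end RadiativeTransfer

namespace RadiativeTransfer
open scoped ENNReal NNReal

variable {Ω : Set E3} {κ : E3 → ℝ}

lemma opticalDepth_ray (κ : E3 → ℝ) {q ω : E3} (hω : ‖ω‖ = 1) {r : ℝ} (hr : 0 < r) :
    opticalDepth κ q (q - r • ω) = ∫ s in (0 : ℝ)..r, κ (q - s • ω) := by
  have h1 : ‖q - r • ω - q‖ = r := by
    rw [sub_sub_cancel_left, norm_neg, norm_smul, hω, mul_one, Real.norm_of_nonneg hr.le]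
  have h2 : dir q (q - r • ω) = -ω := by
    rw [dir, h1, sub_sub_cancel_left, smul_neg, smul_smul, inv_mul_cancel₀ hr.ne', one_smul]
  rw [opticalDepth, h1, h2]
  simp only [smul_neg, ← sub_eq_add_neg]

lemma opticalDepth_nonneg (hκ : ∀ x ∈ Ω, 0 < κ x) {q y : E3} (h : Visible Ω q y) :
    0 ≤ opticalDepth κ q y := by
  by_cases hy : y = q
  · simp [opticalDepth, hy]
  have hr : 0 < ‖q - y‖ := norm_pos_iff.2 (sub_ne_zero.2 (Ne.symm hy))
  rw [← sub_norm_smul_dir q y, visible_sub_smul_iff hr] at h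
  rw [← sub_norm_smul_dir q y, opticalDepth_ray κ (norm_dir hy) hr,
    intervalIntegral.integral_of_le hr.le, integral_Ioc_eq_integral_Ioo]
  exact setIntegral_nonneg measurableSet_Ioo fun s hs => (hκ _ (h s hs)).le

lemma exp_neg_opticalDepth_le (hκ : ∀ x ∈ Ω, 0 < κ x) {q y : E3} (h : Visible Ω q y) :
    Real.exp (-opticalDepth κ q y) ≤ 1 :=
  Real.exp_le_one_iff.2 (neg_nonpos.2 (opticalDepth_nonneg hκ h))

lemma measurable_opticalDepth (hκ : Measurable κ) :
    Measurable fun q : E3 × E3 => opticalDepth κ q.1 q.2 := by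
  have h1 : (fun q : E3 × E3 => opticalDepth κ q.1 q.2) = fun q : E3 × E3 =>
      ∫ s : ℝ, {w : (E3 × E3) × ℝ | 0 < w.2 ∧ w.2 ≤ ‖w.1.2 - w.1.1‖}.indicator
        (fun w => κ (w.1.1 + w.2 • dir w.1.1 w.1.2)) (q, s) := by
    ext q
    rw [opticalDepth, intervalIntegral.integral_of_le (norm_nonneg _),
      ← integral_indicator measurableSet_Ioc]
    rfl
  rw [h1]
  have h2 : MeasurableSet {w : (E3 × E3) × ℝ | 0 < w.2 ∧ w.2 ≤ ‖w.1.2 - w.1.1‖} :=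
    (measurableSet_lt measurable_const measurable_snd).inter
      (measurableSet_le measurable_snd (by fun_prop))
  have h3 : Measurable fun w : (E3 × E3) × ℝ => κ (w.1.1 + w.2 • dir w.1.1 w.1.2) := by
    unfold dir
    fun_prop
  exact (StronglyMeasurable.integral_prod_right' (h3.indicator h2).stronglyMeasurable).measurable

/-- Integration of the transport equation along a ray. -/
lemma SolvesTransport.ray_formula {S I : E3 → E3 → ℝ} (hI : SolvesTransport Ω κ S I)
    (hΩ : IsOpen Ω) (hκm : Measurable κ) (hκb : BoundedOn κ Ω) {q ω : E3} (hω : ‖ω‖ = 1) {τ : ℝ}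
    (hτ : 0 < τ) (h : ∀ s ∈ Ioo 0 τ, q - s • ω ∈ Ω) :
    I q ω = Real.exp (-opticalDepth κ q (q - τ • ω)) * I (q - τ • ω) ω +
      ∫ r in (0 : ℝ)..τ, Real.exp (-opticalDepth κ q (q - r • ω)) * S (q - r • ω) ω := by
  obtain ⟨C, hC⟩ := hκb
  have hline : ∀ s : ℝ, q - τ • ω + s • ω = q - (τ - s) • ω := fun s => by module
  obtain ⟨hac, hder⟩ := hI (q - τ • ω) ω τ hω hτ (fun s hs => by
    rw [hline]; exact h _ ⟨by linarith [hs.2], by linarith [hs.1]⟩)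
  simp only [hline] at hac hder
  set k : ℝ → ℝ := fun u => Ω.indicator κ (q - u • ω)
  have hkm : Measurable k := by
    have := hκm.indicator hΩ.measurableSet
    fun_prop
  have hkC : ∀ u, ‖k u‖ ≤ |C| := by
    intro u
    by_cases hu : q - u • ω ∈ Ω
    · simp only [k, indicator_of_mem hu]; exact (hC _ hu).trans (le_abs_self C)
    · simp only [k, indicator_of_notMem hu, norm_zero]; exact abs_nonneg C
  have hki : ∀ a b, IntervalIntegrable k volume a b := fun a b => by
    rw [intervalIntegrable_iff]
    exact Measure.integrableOn_of_bounded (by simp) hkm.aestronglyMeasurable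
      (Filter.Eventually.of_forall hkC)
  set D : ℝ → ℝ := fun r => ∫ u in (0 : ℝ)..r, k u
  have hD : ∀ r, 0 < r → r ≤ τ → D r = opticalDepth κ q (q - r • ω) := by
    intro r hr hrτ
    rw [opticalDepth_ray κ hω hr]
    simp only [D, intervalIntegral.integral_of_le hr.le, integral_Ioc_eq_integral_Ioo]
    refine setIntegral_congr_fun measurableSet_Ioo fun s hs => ?_
    exact indicator_of_mem (h s ⟨hs.1, hs.2.trans_le hrτ⟩) κ
  have hDlip : ∀ a b, |D a - D b| ≤ |C| * |a - b| := by
    intro a b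
    simp only [D]
    rw [intervalIntegral.integral_interval_sub_left (hki _ _) (hki _ _)]
    exact intervalIntegral.norm_integral_le_of_norm_le_const fun u _ => hkC u
  have hElip : ∃ K, LipschitzOnWith K (fun s : ℝ => Real.exp (-D (τ - s))) (uIcc 0 τ) := by
    have hmaps : MapsTo (fun s : ℝ => -D (τ - s)) (uIcc 0 τ) (Icc (-(|C| * τ)) (|C| * τ)) := by
      intro s hs
      rw [uIcc_of_le hτ.le] at hs
      have h1 := hDlip (τ - s) 0
      have h2 : D 0 = 0 := by simp [D]
      rw [h2, sub_zero, sub_zero, abs_of_nonneg (by linarith [hs.2] : 0 ≤ τ - s)] at h1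
      have h3 : |C| * (τ - s) ≤ |C| * τ := by
        have := abs_nonneg C
        nlinarith [hs.1]
      rw [mem_Icc, ← abs_le, abs_neg]
      exact h1.trans h3
    obtain ⟨K, hK⟩ := (Real.contDiff_exp (n := 1)).contDiffOn.exists_lipschitzOnWith (by decide)
      (convex_Icc (-(|C| * τ)) (|C| * τ)) isCompact_Icc
    have hl : LipschitzOnWith |C|.toNNReal (fun s : ℝ => -D (τ - s)) (uIcc 0 τ) := by
      refine LipschitzOnWith.of_dist_le_mul fun a _ b _ => ?_
      rw [Real.coe_toNNReal _ (abs_nonneg C), Real.dist_eq, Real.dist_eq]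
      have := hDlip (τ - b) (τ - a)
      rw [show -D (τ - a) - -D (τ - b) = D (τ - b) - D (τ - a) by ring]
      rwa [show τ - b - (τ - a) = a - b by ring] at this
    exact ⟨_, hK.comp hl hmaps⟩
  obtain ⟨K, hK⟩ := hElip
  have hG := hK.absolutelyContinuousOnInterval.fun_mul hac
  have hDder : ∀ᵐ s : ℝ, s ∈ Ioo 0 τ → HasDerivAt D (k (τ - s)) (τ - s) := by
    have h1 := (hki 0 τ).ae_hasDerivAt_integral
    have h2 := (Measure.measurePreserving_sub_left volume τ).quasiMeasurePreserving.ae h1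
    filter_upwards [h2] with s hs hs'
    refine hs ?_ 0 (by simp)
    rw [uIcc_of_le hτ.le]
    exact ⟨by linarith [hs'.2], by linarith [hs'.1]⟩
  rw [ae_restrict_iff' measurableSet_Ioo] at hder
  have hint := hG.integral_deriv_eq_sub
  have hcongr : ∫ s in (0 : ℝ)..τ, deriv (fun s => Real.exp (-D (τ - s)) * I (q - (τ - s) • ω) ω) s =
      ∫ s in (0 : ℝ)..τ,
        (fun r => Real.exp (-opticalDepth κ q (q - r • ω)) * S (q - r • ω) ω) (τ - s) := by
    simp only [intervalIntegral.integral_of_le hτ.le, integral_Ioc_eq_integral_Ioo]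
    refine setIntegral_congr_ae measurableSet_Ioo ?_
    filter_upwards [hder, hDder] with s h1 h2 hs
    have h3 : HasDerivAt (fun s => D (τ - s)) (-k (τ - s)) s := by
      have h4 : HasDerivAt (fun s : ℝ => τ - s) (-1) s := by
        simpa using (hasDerivAt_id s).const_sub τ
      have h5 := (h2 hs).comp s h4
      rwa [mul_neg_one] at h5
    have h5 := h3.neg.exp.mul (h1 hs)
    have hmem : q - (τ - s) • ω ∈ Ω := h _ ⟨by linarith [hs.2], by linarith [hs.1]⟩
    have hkκ : k (τ - s) = κ (q - (τ - s) • ω) := indicator_of_mem hmem κ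
    refine h5.deriv.trans ?_
    simp only [Pi.neg_apply]
    rw [hkκ, ← hD (τ - s) (by linarith [hs.2]) (by linarith [hs.1])]
    ring
  rw [hcongr, intervalIntegral.integral_comp_sub_left
    (fun r => Real.exp (-opticalDepth κ q (q - r • ω)) * S (q - r • ω) ω), sub_self, sub_zero] at hint
  rw [hint, ← hD τ hτ le_rfl]
  simp [D]

end RadiativeTransfer

namespace RadiativeTransfer
open scoped ENNReal NNReal

variable {Ω : Set E3} {κ : E3 → ℝ} {R Q S : E3 → E3 → ℝ} {CQ CS : ℝ}

lemma measurable_exitDist_comp {α : Type*} [MeasurableSpace α] (hΩ : IsOpen Ω) {f g : α → E3}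
    (hf : Measurable f) (hg : Measurable g) : Measurable fun a => exitDist Ω (f a) (g a) :=
  (measurable_exitDist hΩ).comp (hf.prodMk hg)

lemma measurable_opticalDepth_comp {α : Type*} [MeasurableSpace α] (hκ : Measurable κ) {f g : α → E3}
    (hf : Measurable f) (hg : Measurable g) : Measurable fun a => opticalDepth κ (f a) (g a) := by
  simpa only [Function.comp_def] using (measurable_opticalDepth hκ).comp (hf.prodMk hg)

lemma measurable_uncurry_comp {α : Type*} [MeasurableSpace α]
    (hS : Measurable (Function.uncurry S)) {f g : α → E3}
    (hf : Measurable f) (hg : Measurable g) : Measurable fun a => S (f a) (g a) :=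
  hS.comp (hf.prodMk hg)

/-- The standing assumptions on the domain, the coefficients and the sources at one frequency. -/
structure IsAdmissible (Ω : Set E3) (κ : E3 → ℝ) (R Q S : E3 → E3 → ℝ) (CQ CS : ℝ) : Prop where
  domain : IsPiecewiseC1Domain Ω
  measurable_κ : Measurable κ
  bounded_κ : BoundedOn κ Ω
  pos_κ : ∀ x ∈ Ω, 0 < κ x
  measurable_R : Measurable (Function.uncurry R)
  R_mem : ∀ y ω, (y, ω) ∈ inflow Ω → R y ω ∈ Icc (0 : ℝ) 1
  measurable_Q : Measurable (Function.uncurry Q)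
  Q_le : ∀ y ω, (y, ω) ∈ inflow Ω → |Q y ω| ≤ CQ
  measurable_S : Measurable (Function.uncurry S)
  S_le : ∀ y ω, y ∈ Ω → ‖ω‖ = 1 → |S y ω| ≤ CS

/-- The boundary point from which the ray of direction `ω` arrives at `x`. -/
noncomputable def hitPoint (Ω : Set E3) (x ω : E3) : E3 := x - exitDist Ω x ω • ω

lemma measurable_hitPoint {α : Type*} [MeasurableSpace α] (hΩ : IsOpen Ω) {f g : α → E3}
    (hf : Measurable f) (hg : Measurable g) : Measurable fun a => hitPoint Ω (f a) (g a) :=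
  hf.sub ((measurable_exitDist_comp hΩ hf hg).smul hg)

lemma visible_hitPoint {q ω : E3} (h : 0 < exitDist Ω q ω) : Visible Ω q (hitPoint Ω q ω) :=
  (visible_sub_smul_iff h).2 ((le_exitDist_iff' h).1 le_rfl).2

lemma norm_sub_hitPoint {q ω : E3} (hω : ‖ω‖ = 1) : ‖q - hitPoint Ω q ω‖ = exitDist Ω q ω := by
  rw [hitPoint, sub_sub_cancel, norm_smul, hω, mul_one, Real.norm_of_nonneg (exitDist_nonneg _ _ _)]

lemma dir_hitPoint {q ω : E3} (hω : ‖ω‖ = 1) (h : 0 < exitDist Ω q ω) :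
    dir (hitPoint Ω q ω) q = ω := dir_sub_smul h hω

/-- At a point where the ray crosses the boundary transversally, it enters `Ω`. -/
lemma hitPoint_mem_inflow (hΩ : IsOpen Ω) (hb : Bornology.IsBounded Ω) {q ω : E3} (hω : ‖ω‖ = 1)
    (h : 0 < exitDist Ω q ω) (hne : ⟪ω, outerNormal Ω (hitPoint Ω q ω)⟫ ≠ 0) :
    (hitPoint Ω q ω, ω) ∈ inflow Ω := by
  refine ⟨exitPoint_mem_frontier hΩ hb hω h, hω, lt_of_le_of_ne ?_ hne⟩
  refine inner_outerNormal_nonpos h fun s hs => ?_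
  have : hitPoint Ω q ω + s • ω = q - (exitDist Ω q ω - s) • ω := by rw [hitPoint]; module
  rw [this]
  exact mem_of_lt_exitDist (by linarith [hs.2]) (by linarith [hs.1])

lemma mem_regularBoundary_of_inner_ne_zero {y v : E3} (h : ⟪v, outerNormal Ω y⟫ ≠ 0) :
    y ∈ regularBoundary Ω := by
  by_contra hy
  rw [outerNormal_of_notMem hy, inner_zero_right] at h
  exact h rfl

lemma ae_hitPoint_mem_inflow (hΩ : IsPiecewiseC1Domain Ω) {x : E3} (hx : x ∈ Ω) :
    ∀ᵐ ω ∂sphereMeasure, (hitPoint Ω x ω, ω) ∈ inflow Ω := by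
  filter_upwards [ae_norm_eq_one, ae_inner_outerNormal_ne_zero hΩ x] with ω hω h
  have hτ := exitDist_pos_of_mem hΩ.isOpen hΩ.isBounded hω hx
  have hf := exitPoint_mem_frontier hΩ.isOpen hΩ.isBounded hω hτ
  refine hitPoint_mem_inflow hΩ.isOpen hΩ.isBounded hω hτ ?_
  have hne : hitPoint Ω x ω ≠ x := fun e => by
    have := norm_sub_hitPoint (Ω := Ω) (q := x) hω
    rw [e, sub_self, norm_zero] at this
    linarith
  have h1 := h _ hf hne (dir_hitPoint hω hτ)
  rw [← hitPoint, show x - hitPoint Ω x ω = exitDist Ω x ω • ω by rw [hitPoint]; abel,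
    real_inner_smul_left] at h1
  exact fun h0 => h1 (by rw [h0, mul_zero])

lemma norm_smul_le_of_le {V : Type*} [NormedAddCommGroup V] [NormedSpace ℝ V] {a C : ℝ} {v : V}
    (ha : |a| ≤ C) (hv : ‖v‖ ≤ 1) : ‖a • v‖ ≤ C := by
  rw [norm_smul, Real.norm_eq_abs]
  nlinarith [abs_nonneg a, norm_nonneg v]

section Weighted

variable {V : Type*} [NormedAddCommGroup V] [NormedSpace ℝ V] [MeasurableSpace V] [BorelSpace V]
  [SecondCountableTopology V]

/-- Integration over the boundary of a kernel that comes from a function of the direction. -/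
lemma surface_kernel (hΩ : IsOpen Ω) {p : E3} {A : Set E3} (hA : MeasurableSet A)
    (hAf : A ⊆ frontier Ω) (hAr : A ⊆ regularBoundary Ω) (hp : p ∉ A)
    (hinj : InjOn (fun y => dir y p) A) {k g : E3 → V} (hg : Measurable g)
    (hgi : Integrable g sphereMeasure)
    (hg0 : ∀ᵐ ω ∂sphereMeasure, ω ∉ (fun y => dir y p) '' A → g ω = 0)
    (hkA : ∀ y ∈ A, k y = solidAngleDensity Ω p y • g (dir y p))
    (hk0 : ∀ y ∈ frontier Ω, y ∉ A → k y = 0) :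
    Integrable k (surfaceMeasure Ω) ∧ ∫ y, k y ∂(surfaceMeasure Ω) = ∫ ω, g ω ∂sphereMeasure := by
  obtain ⟨h1, h2⟩ := surface_integral hΩ hA hAr hp hinj hg hgi.integrableOn
  have hk : k =ᵐ[surfaceMeasure Ω]
      A.indicator fun y => solidAngleDensity Ω p y • g (dir y p) := by
    filter_upwards [ae_restrict_mem (μ := (μHE[2] : Measure E3)) isClosed_frontier.measurableSet]
      with y hy
    by_cases hyA : y ∈ A
    · rw [indicator_of_mem hyA, hkA y hyA]
    · rw [indicator_of_notMem hyA, hk0 y hy hyA]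
  have hres : (surfaceMeasure Ω).restrict A = (μHE[2] : Measure E3).restrict A := by
    rw [surfaceMeasure, Measure.restrict_restrict hA, inter_eq_left.2 hAf]
  have hPA : MeasurableSet ((fun y => dir y p) '' A) :=
    hA.image_of_measurable_injOn (measurable_dir_left p) hinj
  constructor
  · rw [integrable_congr hk, integrable_indicator_iff hA, IntegrableOn, hres]
    exact h1
  · rw [integral_congr_ae hk, integral_indicator hA, hres, h2, ← integral_indicator hPA]
    refine integral_congr_ae ?_
    filter_upwards [hg0] with ω hω
    by_cases h : ω ∈ (fun y => dir y p) '' A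
    · rw [indicator_of_mem h]
    · rw [indicator_of_notMem h, hω h]

variable {c : E3 → V} {x : E3}

/-- The contribution of the boundary source to the intensity arriving at `x` in direction `ω`. -/
noncomputable def directBoundary (Ω : Set E3) (κ : E3 → ℝ) (Q : E3 → E3 → ℝ) (c : E3 → V)
    (x ω : E3) : V :=
  (Real.exp (-opticalDepth κ x (hitPoint Ω x ω)) * Q (hitPoint Ω x ω) ω) • c ω

open Classical in
/-- The contribution of the volume source at distance `r` to the intensity arriving at `x` in
direction `ω`. -/
noncomputable def directVolume (Ω : Set E3) (κ : E3 → ℝ) (S : E3 → E3 → ℝ) (c : E3 → V)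
    (x : E3) (q : E3 × ℝ) : V :=
  if 0 < q.2 ∧ q.2 < exitDist Ω x q.1 then
    (Real.exp (-opticalDepth κ x (x - q.2 • q.1)) * S (x - q.2 • q.1) q.1) • c q.1 else 0

/-- The direct contribution of the boundary source at `y`, with weight `c`. -/
noncomputable def boundaryKernel (Ω : Set E3) (κ : E3 → ℝ) (Q : E3 → E3 → ℝ) (c : E3 → V)
    (x y : E3) : V :=
  ifVisible Ω x y
    ((Q y (dir y x) * (negPart ⟪x - y, outerNormal Ω y⟫ / ‖x - y‖ ^ 3) *
      Real.exp (-opticalDepth κ x y)) • c (dir y x))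

/-- The direct contribution of the volume source at `y`, with weight `c`. -/
noncomputable def volumeKernel (Ω : Set E3) (κ : E3 → ℝ) (S : E3 → E3 → ℝ) (c : E3 → V)
    (x y : E3) : V :=
  ifVisible Ω x y ((Real.exp (-opticalDepth κ x y) / ‖x - y‖ ^ 2 * S y (dir y x)) • c (dir y x))

lemma integrable_directBoundary (h : IsAdmissible Ω κ R Q S CQ CS) (hc : Measurable c)
    (hc1 : ∀ ω, ‖ω‖ = 1 → ‖c ω‖ ≤ 1) (hx : x ∈ Ω) :
    Measurable (directBoundary Ω κ Q c x) ∧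
      Integrable (directBoundary Ω κ Q c x) sphereMeasure := by
  have hz : Measurable fun ω : E3 => hitPoint Ω x ω :=
    measurable_hitPoint h.domain.isOpen measurable_const measurable_id
  have hm : Measurable (directBoundary Ω κ Q c x) :=
    ((measurable_opticalDepth_comp h.measurable_κ measurable_const hz).neg.exp.mul
      (measurable_uncurry_comp h.measurable_Q hz measurable_id)).smul hc
  refine ⟨hm, Integrable.of_bound hm.aestronglyMeasurable CQ ?_⟩
  filter_upwards [ae_norm_eq_one, ae_hitPoint_mem_inflow h.domain hx] with ω hω hin
  have hτ := exitDist_pos_of_mem h.domain.isOpen h.domain.isBounded hω hx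
  refine norm_smul_le_of_le ?_ (hc1 ω hω)
  rw [abs_mul, Real.abs_exp]
  have h1 := exp_neg_opticalDepth_le h.pos_κ (visible_hitPoint hτ)
  have h2 := h.Q_le _ _ hin
  nlinarith [abs_nonneg (Q (hitPoint Ω x ω) ω),
    Real.exp_pos (-opticalDepth κ x (hitPoint Ω x ω))]

lemma boundaryKernel_integral (h : IsAdmissible Ω κ R Q S CQ CS) (hc : Measurable c)
    (hc1 : ∀ ω, ‖ω‖ = 1 → ‖c ω‖ ≤ 1) (hx : x ∈ Ω) :
    Integrable (boundaryKernel Ω κ Q c x) (surfaceMeasure Ω) ∧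
      ∫ y, boundaryKernel Ω κ Q c x y ∂(surfaceMeasure Ω) =
        ∫ ω, directBoundary Ω κ Q c x ω ∂sphereMeasure := by
  have hΩ := h.domain.isOpen
  have hb := h.domain.isBounded
  obtain ⟨hgm, hgi⟩ := integrable_directBoundary h hc hc1 hx
  have hxf : ∀ y ∈ frontier Ω, y ≠ x := fun y hy e => by
    rw [hΩ.frontier_eq] at hy
    exact hy.2 (e ▸ hx)
  have hn := measurable_outerNormal hΩ
  set A := (frontier Ω ∩ {y | exitDist Ω x (dir y x) = ‖x - y‖}) ∩ {y | ⟪x - y, outerNormal Ω y⟫ < 0}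
  have hA : MeasurableSet A := by
    refine (isClosed_frontier.measurableSet.inter (measurableSet_eq_fun
      (measurable_exitDist_comp hΩ measurable_const (measurable_dir_left x)) (by fun_prop))).inter ?_
    have : Measurable fun y : E3 => ⟪x - y, outerNormal Ω y⟫ := by fun_prop
    exact this measurableSet_Iio
  have hhit : ∀ y ∈ A, hitPoint Ω x (dir y x) = y := fun y hy => by
    rw [hitPoint, show exitDist Ω x (dir y x) = ‖x - y‖ from hy.1.2, sub_norm_smul_dir]
  refine surface_kernel hΩ hA (fun y hy => hy.1.1)
    (fun y hy => mem_regularBoundary_of_inner_ne_zero (ne_of_lt hy.2)) (fun hxA => hxf x hxA.1.1 rfl)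
    (fun y hy y' hy' e => ?_) hgm hgi ?_ ?_ ?_
  · simp only at e
    rw [← hhit y hy, ← hhit y' hy', e]
  · filter_upwards [ae_norm_eq_one, ae_hitPoint_mem_inflow h.domain hx] with ω hω hin hnot
    have hτ := exitDist_pos_of_mem hΩ hb hω hx
    refine absurd ⟨hitPoint Ω x ω, ⟨⟨hin.1, ?_⟩, ?_⟩, dir_hitPoint hω hτ⟩ hnot
    · rw [mem_ofPred_eq, dir_hitPoint hω hτ, norm_sub_hitPoint hω]
    · have h3 : ⟪ω, outerNormal Ω (hitPoint Ω x ω)⟫ < 0 := hin.2.2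
      rw [mem_ofPred_eq, show x - hitPoint Ω x ω = exitDist Ω x ω • ω by rw [hitPoint]; abel,
        real_inner_smul_left]
      exact mul_neg_of_pos_of_neg hτ h3
  · intro y hy
    have hv : Visible Ω x y := (visible_frontier_iff hΩ hb (hxf y hy.1.1) hy.1.1).2 hy.1.2
    have hneg : ⟪x - y, outerNormal Ω y⟫ < 0 := hy.2
    rw [boundaryKernel, ifVisible_of_visible hv, directBoundary, hhit y hy, smul_smul,
      solidAngleDensity, abs_of_neg hneg, negPart, max_eq_left (by linarith)]
    congr 1
    ring
  · intro y hy hyA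
    by_cases hv : Visible Ω x y
    · have hge : 0 ≤ ⟪x - y, outerNormal Ω y⟫ := by
        by_contra hlt
        exact hyA ⟨⟨hy, (visible_frontier_iff hΩ hb (hxf y hy) hy).1 hv⟩, not_le.1 hlt⟩
      rw [boundaryKernel, ifVisible_of_visible hv, negPart, max_eq_right (by linarith)]
      simp
    · rw [boundaryKernel, ifVisible_of_not_visible hv]

lemma volumeKernel_integral (h : IsAdmissible Ω κ R Q S CQ CS) (hc : Measurable c)
    (hc1 : ∀ ω, ‖ω‖ = 1 → ‖c ω‖ ≤ 1) :
    IntegrableOn (volumeKernel Ω κ S c x) Ω ∧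
      Integrable (fun ω => ∫ r in Ioi (0 : ℝ), directVolume Ω κ S c x (ω, r)) sphereMeasure ∧
      ∫ y in Ω, volumeKernel Ω κ S c x y =
        ∫ ω, (∫ r in Ioi (0 : ℝ), directVolume Ω κ S c x (ω, r)) ∂sphereMeasure := by
  have hΩ := h.domain.isOpen
  have hb := h.domain.isBounded
  rw [← integrable_indicator_iff hΩ.measurableSet, ← integral_indicator hΩ.measurableSet]
  have hy : Measurable fun q : E3 × ℝ => x - q.2 • q.1 := by fun_prop
  have hH : Measurable (directVolume Ω κ S c x) := by
    unfold directVolume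
    refine Measurable.ite ?_ (((measurable_opticalDepth_comp h.measurable_κ measurable_const hy).neg.exp.mul
      (measurable_uncurry_comp h.measurable_S hy measurable_fst)).smul (hc.comp measurable_fst))
      measurable_const
    exact (measurableSet_lt measurable_const measurable_snd).inter
      (measurableSet_lt measurable_snd (measurable_exitDist_comp hΩ measurable_const measurable_fst))
  refine polar_integral x (H := directVolume Ω κ S c x) hH (C := |CS|) (T := Metric.diam Ω) ?_ ?_ ?_
  · intro ω r hω hr
    unfold directVolume
    split_ifs with hif
    · refine norm_smul_le_of_le ?_ (hc1 ω hω)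
      have hv : Visible Ω x (x - r • ω) :=
        (visible_sub_smul_iff hr).2 fun s hs => mem_of_lt_exitDist hs.1 (hs.2.trans hif.2)
      have h1 := exp_neg_opticalDepth_le h.pos_κ hv
      have h2 := h.S_le _ ω (mem_of_lt_exitDist hr hif.2) hω
      rw [abs_mul, Real.abs_exp]
      nlinarith [abs_nonneg (S (x - r • ω) ω), Real.exp_pos (-opticalDepth κ x (x - r • ω)),
        le_abs_self CS]
    · rw [norm_zero]; exact abs_nonneg _
  · intro ω r hr
    unfold directVolume
    exact if_neg fun hif => absurd (hif.2.trans_le (exitDist_le _ _ _)) (not_lt.2 hr.le)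
  · intro ω r hω hr
    have hd : dir (x - r • ω) x = ω := dir_sub_smul hr hω
    have hne : x - r • ω ≠ x := fun e => by
      rw [e] at hd
      rw [← hd] at hω
      simp [dir] at hω
    have hnorm : ‖x - (x - r • ω)‖ = r := by
      rw [sub_sub_cancel, norm_smul, hω, mul_one, Real.norm_of_nonneg hr.le]
    have hiff := visible_and_mem_iff hΩ hb hne
    rw [hd, hnorm] at hiff
    unfold directVolume
    by_cases hif : r < exitDist Ω x ω
    · obtain ⟨hv, hm⟩ := hiff.2 hif
      rw [if_pos ⟨hr, hif⟩, indicator_of_mem hm, volumeKernel, ifVisible_of_visible hv, hnorm, hd,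
        smul_smul]
      congr 1
      ring
    · rw [if_neg (fun h => hif h.2), smul_zero]
      by_cases hm : x - r • ω ∈ Ω
      · rw [indicator_of_mem hm, volumeKernel, ifVisible_of_not_visible fun hv => hif (hiff.1 ⟨hv, hm⟩)]
      · rw [indicator_of_notMem hm]

end Weighted

end RadiativeTransfer

namespace RadiativeTransfer
open scoped ENNReal NNReal

variable {Ω : Set E3} {κ : E3 → ℝ} {R Q S : E3 → E3 → ℝ} {CQ CS : ℝ} {F : Set E3} {e : E3} {b : ℝ}
  {x y z : E3}

/-- A flat piece `F` of the boundary, in the plane `⟪e, y⟫ = b` with outer normal `e`. -/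
structure IsFlatPieceIn (Ω F : Set E3) (e : E3) (b : ℝ) : Prop where
  measurableSet : MeasurableSet F
  subset_frontier : F ⊆ frontier Ω
  norm_eq : ‖e‖ = 1
  normal : ∀ y ∈ F, outerNormal Ω y = e ∧ ⟪e, y⟫ = b

/-- The directions `η` from which rays arriving at `x` are reflected on `F`: `mirror e η` is
the direction after reflection. -/
def reflectedDirs (Ω F : Set E3) (e x : E3) : Set E3 :=
  {η | hitPoint Ω x (mirror e η) ∈ F ∧ ⟪mirror e η, e⟫ < 0}

/-- The length of the ray arriving at `x` after reflection, up to the previous point of the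
boundary. -/
noncomputable def foldedLength (Ω : Set E3) (e x η : E3) : ℝ :=
  exitDist Ω x (mirror e η) + exitDist Ω (hitPoint Ω x (mirror e η)) η

lemma continuous_mirror (e : E3) : Continuous (mirror e) := (mirror e).continuous

lemma measurable_hitPoint_mirror (hΩ : IsOpen Ω) (e x : E3) :
    Measurable fun η => hitPoint Ω x (mirror e η) :=
  measurable_hitPoint hΩ measurable_const (continuous_mirror e).measurable

lemma measurable_exitDist_mirror (hΩ : IsOpen Ω) (e x : E3) :
    Measurable fun η => exitDist Ω x (mirror e η) :=
  measurable_exitDist_comp hΩ measurable_const (continuous_mirror e).measurable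

lemma measurable_foldedLength (hΩ : IsOpen Ω) (e x : E3) : Measurable (foldedLength Ω e x) :=
  (measurable_exitDist_mirror hΩ e x).add
    (measurable_exitDist_comp hΩ (measurable_hitPoint_mirror hΩ e x) measurable_id)

lemma measurableSet_reflectedDirs (hΩ : IsOpen Ω) (hF : MeasurableSet F) (e x : E3) :
    MeasurableSet (reflectedDirs Ω F e x) := by
  have h1 : Measurable fun η : E3 => ⟪mirror e η, e⟫ :=
    ((continuous_mirror e).inner continuous_const).measurable
  exact (measurable_hitPoint_mirror hΩ e x hF).inter (h1 measurableSet_Iio)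

lemma norm_mirror (e v : E3) : ‖mirror e v‖ = ‖v‖ := (mirror e).norm_map v

lemma mirrorImage_sub_smul (hF : IsFlatPieceIn Ω F e b) {η : E3}
    (hη : hitPoint Ω x (mirror e η) ∈ F) (r : ℝ) :
    mirrorImage e b x - r • η =
      hitPoint Ω x (mirror e η) - (r - exitDist Ω x (mirror e η)) • η := by
  have h := mirrorImage_eq_ray hF.norm_eq (x := x) (hF.normal _ hη).2
  rw [mirror_mirror] at h
  rw [h, hitPoint]
  module

/-- The parameters of the broken ray between `x` and `y` with point of reflection `z`, in terms
of the direction in which `y` is seen from the mirror image of `x`. -/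
lemma IsReflectionPoint.params (hΩ : IsOpen Ω) (hb : Bornology.IsBounded Ω)
    (hF : IsFlatPieceIn Ω F e b) (hx : x ∈ Ω) (h : IsReflectionPoint Ω F x y z) :
    y ≠ mirrorImage e b x ∧ z = hitPoint Ω x (mirror e (dir y (mirrorImage e b x))) ∧
      dir z x = mirror e (dir y (mirrorImage e b x)) ∧ dir y z = dir y (mirrorImage e b x) ∧
      ‖mirrorImage e b x - y‖ = ‖x - z‖ + ‖z - y‖ ∧
      dir y (mirrorImage e b x) ∈ reflectedDirs Ω F e x ∧ y ≠ z ∧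
      exitDist Ω x (mirror e (dir y (mirrorImage e b x))) = ‖x - z‖ ∧
      ‖z - y‖ ≤ exitDist Ω z (dir y (mirrorImage e b x)) := by
  obtain ⟨hzx, hyz, h1, h2, h3, h4, h5, h6⟩ :=
    h.unfold_ray hΩ hb hF.subset_frontier hF.norm_eq hF.normal hx
  have hm : mirror e (dir y (mirrorImage e b x)) = dir z x := by rw [h2, mirror_mirror]
  have hz : hitPoint Ω x (dir z x) = z := by rw [hitPoint, h4, sub_norm_smul_dir]
  have hpos : 0 < ‖x - z‖ := norm_pos_iff.2 (sub_ne_zero.2 hzx.symm)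
  refine ⟨fun hy => ?_, by rw [hm, hz], hm.symm, h1.trans h2.symm, h3, ⟨?_, ?_⟩, hyz, by rw [hm, h4], ?_⟩
  · rw [hy, sub_self, norm_zero] at h3
    linarith [norm_nonneg (z - mirrorImage e b x)]
  · rw [hm, hz]; exact h.1
  · rwa [hm]
  · rwa [h2, ← h1]

lemma isReflectionPoint_iff (hΩ : IsOpen Ω) (hb : Bornology.IsBounded Ω)
    (hF : IsFlatPieceIn Ω F e b) (hx : x ∈ Ω) (hy : y ≠ mirrorImage e b x) :
    (∃ z, IsReflectionPoint Ω F x y z) ↔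
      dir y (mirrorImage e b x) ∈ reflectedDirs Ω F e x ∧
      ‖mirrorImage e b x - y‖ ∈ Ioc (exitDist Ω x (mirror e (dir y (mirrorImage e b x))))
        (foldedLength Ω e x (dir y (mirrorImage e b x))) := by
  constructor
  · rintro ⟨z, h⟩
    obtain ⟨-, h1, -, -, h2, h3, h4, h5, h6⟩ := h.params hΩ hb hF hx
    have hpos : 0 < ‖z - y‖ := norm_pos_iff.2 (sub_ne_zero.2 h4.symm)
    refine ⟨h3, ?_, ?_⟩
    · rw [h5, h2]; linarith
    · rw [foldedLength, ← h1, h5, h2]; linarith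
  · rintro ⟨h1, h2, h3⟩
    set η := dir y (mirrorImage e b x)
    have hη : ‖η‖ = 1 := norm_dir hy
    have hω : ‖mirror e η‖ = 1 := by rw [norm_mirror, hη]
    have hτ := exitDist_pos_of_mem hΩ hb hω hx
    have hy' := mirrorImage_sub_smul hF h1.1 ‖mirrorImage e b x - y‖
    rw [sub_norm_smul_dir] at hy'
    refine ⟨hitPoint Ω x (mirror e η), ?_⟩
    have := isReflectionPoint_of_ray hb hF.norm_eq hF.normal hω hτ h1.1 h1.2
      (s := ‖mirrorImage e b x - y‖ - exitDist Ω x (mirror e η)) (by linarith) (by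
        rw [mirror_mirror, ← hitPoint]
        have := h3
        rw [foldedLength] at this
        linarith)
    rw [mirror_mirror, ← hitPoint, ← hy'] at this
    exact this

lemma IsReflectionPoint.mem_iff (hΩ : IsOpen Ω) (hb : Bornology.IsBounded Ω)
    (hF : IsFlatPieceIn Ω F e b) (hx : x ∈ Ω) (h : IsReflectionPoint Ω F x y z) :
    y ∈ Ω ↔ ‖mirrorImage e b x - y‖ < foldedLength Ω e x (dir y (mirrorImage e b x)) := by
  obtain ⟨-, h1, -, h1', h2, h3, h4, h5, h6⟩ := h.params hΩ hb hF hx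
  have h7 := visible_and_mem_iff hΩ hb h4
  rw [and_iff_right h.2.2.1] at h7
  rw [h7, foldedLength, ← h1, h5, h2, h1']
  constructor <;> intro h <;> linarith

lemma IsReflectionPoint.eq_of_mem_frontier (hΩ : IsOpen Ω) (hb : Bornology.IsBounded Ω)
    (hF : IsFlatPieceIn Ω F e b) (hx : x ∈ Ω) (h : IsReflectionPoint Ω F x y z)
    (hy : y ∈ frontier Ω) :
    exitDist Ω z (dir y (mirrorImage e b x)) = ‖z - y‖ := by
  obtain ⟨-, -, -, h1, -, -, h4, -, -⟩ := h.params hΩ hb hF hx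
  rw [← h1]
  exact (visible_frontier_iff hΩ hb h4 hy).1 h.2.2.1

lemma reflectedDirs_inflow (hF : IsFlatPieceIn Ω F e b) {η : E3} (hη : ‖η‖ = 1)
    (h : η ∈ reflectedDirs Ω F e x) :
    (hitPoint Ω x (mirror e η), mirror e η) ∈ inflow Ω :=
  ⟨hF.subset_frontier h.1, by rw [norm_mirror, hη], by rw [(hF.normal _ h.1).1]; exact h.2⟩

lemma exitDist_pos_of_mem_reflectedDirs (hb : Bornology.IsBounded Ω) (hF : IsFlatPieceIn Ω F e b)
    {η : E3} (hη : ‖η‖ = 1) (h : η ∈ reflectedDirs Ω F e x) :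
    0 < exitDist Ω (hitPoint Ω x (mirror e η)) η := by
  have hn := (hF.normal _ h.1).1
  have hreg : hitPoint Ω x (mirror e η) ∈ regularBoundary Ω := by
    refine mem_regularBoundary_of_inner_ne_zero (v := mirror e η) (ne_of_lt ?_)
    rw [hn]; exact h.2
  refine exitDist_pos hb hη ((isOuterUnitNormal_outerNormal hreg).eventually_mem ?_)
  rw [hn]
  have h2 : ⟪mirror e η, e⟫ < 0 := h.2
  rw [real_inner_comm, inner_mirror hF.norm_eq] at h2
  rw [inner_neg_right]
  exact h2

/-- Almost every reflected ray comes from a regular boundary point, transversally. -/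
lemma ae_reflected_mem_inflow (hΩ : IsPiecewiseC1Domain Ω) (hF : IsFlatPieceIn Ω F e b) (hx : x ∈ Ω) :
    ∀ᵐ η ∂sphereMeasure, η ∈ reflectedDirs Ω F e x →
      (hitPoint Ω (hitPoint Ω x (mirror e η)) η, η) ∈ inflow Ω := by
  filter_upwards [ae_norm_eq_one, ae_inner_outerNormal_ne_zero hΩ (mirrorImage e b x)]
    with η hη h hD
  have hω : ‖mirror e η‖ = 1 := by rw [norm_mirror, hη]
  have hτ := exitDist_pos_of_mem hΩ.isOpen hΩ.isBounded hω hx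
  have hτ2 := exitDist_pos_of_mem_reflectedDirs hΩ.isBounded hF hη hD
  have hl : 0 < foldedLength Ω e x η := add_pos hτ hτ2
  refine hitPoint_mem_inflow hΩ.isOpen hΩ.isBounded hη hτ2 ?_
  have hy : hitPoint Ω (hitPoint Ω x (mirror e η)) η =
      mirrorImage e b x - foldedLength Ω e x η • η := by
    rw [mirrorImage_sub_smul hF hD.1, foldedLength, add_sub_cancel_left]
    rfl
  have hd := dir_sub_smul (p := mirrorImage e b x) hl hη
  rw [← hy] at hd
  have hne : hitPoint Ω (hitPoint Ω x (mirror e η)) η ≠ mirrorImage e b x := fun h0 => by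
    rw [h0] at hd
    rw [← hd] at hη
    simp [dir] at hη
  have h1 := h _ (exitPoint_mem_frontier hΩ.isOpen hΩ.isBounded hη hτ2) hne hd
  rw [← hitPoint, show mirrorImage e b x - hitPoint Ω (hitPoint Ω x (mirror e η)) η =
    foldedLength Ω e x η • η by rw [hy]; abel, real_inner_smul_left] at h1
  exact fun h0 => h1 (by rw [h0, mul_zero])

section Weighted

variable {V : Type*} [NormedAddCommGroup V] [NormedSpace ℝ V] {c : E3 → V}

open Classical in
/-- The contribution of the boundary source to the intensity arriving at `x` after reflection on
`F`, as a function of the direction before reflection. -/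
noncomputable def reflectedBoundary (Ω : Set E3) (κ : E3 → ℝ) (R Q : E3 → E3 → ℝ) (F : Set E3)
    (e : E3) (c : E3 → V) (x η : E3) : V :=
  if η ∈ reflectedDirs Ω F e x then
    (Real.exp (-(opticalDepth κ x (hitPoint Ω x (mirror e η)) +
        opticalDepth κ (hitPoint Ω x (mirror e η)) (hitPoint Ω (hitPoint Ω x (mirror e η)) η))) *
      R (hitPoint Ω x (mirror e η)) (mirror e η) *
      Q (hitPoint Ω (hitPoint Ω x (mirror e η)) η) η) • c (mirror e η) else 0

open Classical in
/-- The contribution of the volume source at distance `r` along the ray reflected on `F`, as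
a function of the direction before reflection. -/
noncomputable def reflectedVolume (Ω : Set E3) (κ : E3 → ℝ) (R S : E3 → E3 → ℝ) (F : Set E3)
    (e : E3) (b : ℝ) (c : E3 → V) (x : E3) (q : E3 × ℝ) : V :=
  if q.1 ∈ reflectedDirs Ω F e x ∧ q.2 ∈ Ioo (exitDist Ω x (mirror e q.1)) (foldedLength Ω e x q.1)
  then
    (Real.exp (-(opticalDepth κ x (hitPoint Ω x (mirror e q.1)) +
        opticalDepth κ (hitPoint Ω x (mirror e q.1)) (mirrorImage e b x - q.2 • q.1))) *
      R (hitPoint Ω x (mirror e q.1)) (mirror e q.1) *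
      S (mirrorImage e b x - q.2 • q.1) q.1) • c (mirror e q.1) else 0

/-- The contribution of the boundary source at `y` by reflection on `F`, with weight `c`. -/
noncomputable def reflectedBoundaryKernel (Ω : Set E3) (κ : E3 → ℝ) (R Q : E3 → E3 → ℝ) (F : Set E3)
    (c : E3 → V) (x y : E3) : V :=
  ifReflected Ω F x y fun z =>
    (R z (dir z x) * Q y (dir y z) *
      (negPart ⟪z - y, outerNormal Ω y⟫ *
          Real.exp (-(opticalDepth κ x z + opticalDepth κ z y)) /
        (‖z - y‖ * (‖x - z‖ + ‖z - y‖) ^ 2))) • c (dir z x)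

/-- The contribution of the volume source at `y` by reflection on `F`, with weight `c`. -/
noncomputable def reflectedVolumeKernel (Ω : Set E3) (κ : E3 → ℝ) (R S : E3 → E3 → ℝ) (F : Set E3)
    (c : E3 → V) (x y : E3) : V :=
  ifReflected Ω F x y fun z =>
    (Real.exp (-(opticalDepth κ x z + opticalDepth κ z y)) / (‖x - z‖ + ‖z - y‖) ^ 2 *
      R z (dir z x) * S y (dir y z)) • c (dir z x)

variable [MeasurableSpace V] [BorelSpace V] [SecondCountableTopology V]

lemma integrable_reflectedBoundary (h : IsAdmissible Ω κ R Q S CQ CS) (hF : IsFlatPieceIn Ω F e b)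
    (hc : Measurable c) (hc1 : ∀ ω, ‖ω‖ = 1 → ‖c ω‖ ≤ 1) (hx : x ∈ Ω) :
    Measurable (reflectedBoundary Ω κ R Q F e c x) ∧
      Integrable (reflectedBoundary Ω κ R Q F e c x) sphereMeasure := by
  have hΩ := h.domain.isOpen
  have hb := h.domain.isBounded
  have hz := measurable_hitPoint_mirror hΩ e x
  have hy : Measurable fun η => hitPoint Ω (hitPoint Ω x (mirror e η)) η :=
    measurable_hitPoint hΩ hz measurable_id
  have hmm := (continuous_mirror e).measurable
  have hm : Measurable (reflectedBoundary Ω κ R Q F e c x) := by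
    unfold reflectedBoundary
    refine Measurable.ite (measurableSet_reflectedDirs hΩ hF.measurableSet e x) ?_ measurable_const
    exact ((((measurable_opticalDepth_comp h.measurable_κ measurable_const hz).add
      (measurable_opticalDepth_comp h.measurable_κ hz hy)).neg.exp.mul
      (measurable_uncurry_comp h.measurable_R hz hmm)).mul
      (measurable_uncurry_comp h.measurable_Q hy measurable_id)).smul (hc.comp hmm)
  refine ⟨hm, Integrable.of_bound hm.aestronglyMeasurable |CQ| ?_⟩
  filter_upwards [ae_norm_eq_one, ae_reflected_mem_inflow h.domain hF hx] with η hη hin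
  have hω : ‖mirror e η‖ = 1 := by rw [norm_mirror, hη]
  have hτ := exitDist_pos_of_mem hΩ hb hω hx
  unfold reflectedBoundary
  split_ifs with hD
  · have hτ2 := exitDist_pos_of_mem_reflectedDirs hb hF hη hD
    refine norm_smul_le_of_le ?_ (hc1 _ hω)
    rw [abs_mul, abs_mul, Real.abs_exp, neg_add, Real.exp_add]
    have h1 := exp_neg_opticalDepth_le h.pos_κ (visible_hitPoint hτ)
    have h2 := exp_neg_opticalDepth_le h.pos_κ (visible_hitPoint hτ2)
    have h3 := (h.Q_le _ _ (hin hD)).trans (le_abs_self CQ)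
    obtain ⟨h4, h5⟩ := h.R_mem _ _ (reflectedDirs_inflow hF hη hD)
    rw [abs_of_nonneg h4]
    calc _ ≤ 1 * 1 * 1 * |CQ| := by gcongr
      _ = |CQ| := by ring
  · rw [norm_zero]; exact abs_nonneg _

lemma reflectedBoundaryKernel_integral (h : IsAdmissible Ω κ R Q S CQ CS)
    (hF : IsFlatPieceIn Ω F e b) (hc : Measurable c) (hc1 : ∀ ω, ‖ω‖ = 1 → ‖c ω‖ ≤ 1) (hx : x ∈ Ω) :
    Integrable (reflectedBoundaryKernel Ω κ R Q F c x) (surfaceMeasure Ω) ∧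
      ∫ y, reflectedBoundaryKernel Ω κ R Q F c x y ∂(surfaceMeasure Ω) =
        ∫ η, reflectedBoundary Ω κ R Q F e c x η ∂sphereMeasure := by
  have hΩ := h.domain.isOpen
  have hb := h.domain.isBounded
  obtain ⟨hgm, hgi⟩ := integrable_reflectedBoundary h hF hc hc1 hx
  have hn := measurable_outerNormal hΩ
  set p := mirrorImage e b x with hp
  have hdm := measurable_dir_left p
  set A : Set E3 := (((frontier Ω \ {p}) ∩ {y | ⟪p - y, outerNormal Ω y⟫ < 0}) ∩
    ((fun y => dir y p) ⁻¹' (reflectedDirs Ω F e x))) ∩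
    {y | ‖p - y‖ ∈ Ioc (exitDist Ω x (mirror e (dir y p))) (foldedLength Ω e x (dir y p))} with hAdef
  have hA : MeasurableSet A := by
    refine (((isClosed_frontier.measurableSet.diff (measurableSet_singleton p)).inter ?_).inter
      (hdm (measurableSet_reflectedDirs hΩ hF.measurableSet e x))).inter ?_
    · have : Measurable fun y : E3 => ⟪p - y, outerNormal Ω y⟫ := by fun_prop
      exact this measurableSet_Iio
    · exact (measurableSet_lt ((measurable_exitDist_mirror hΩ e x).comp hdm) (by fun_prop)).inter
        (measurableSet_le (by fun_prop) ((measurable_foldedLength hΩ e x).comp hdm))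
  have hAz : ∀ y ∈ A, ∃ z, IsReflectionPoint Ω F x y z := fun y hy =>
    (isReflectionPoint_iff hΩ hb hF hx hy.1.1.1.2).2 ⟨hy.1.2, hy.2⟩
  have hhit : ∀ y ∈ A, hitPoint Ω (hitPoint Ω x (mirror e (dir y p))) (dir y p) = y := by
    intro y hy
    obtain ⟨z, hz⟩ := hAz y hy
    have h1 := hz.eq_of_mem_frontier hΩ hb hF hx hy.1.1.1.1
    obtain ⟨-, h2, -, h3, -⟩ := hz.params hΩ hb hF hx
    rw [← h2, hitPoint, h1, ← h3, sub_norm_smul_dir]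
  refine surface_kernel hΩ hA (fun y hy => hy.1.1.1.1)
    (fun y hy => mem_regularBoundary_of_inner_ne_zero (ne_of_lt hy.1.1.2))
    (fun hpA => hpA.1.1.1.2 rfl) (fun y hy y' hy' he => ?_) hgm hgi ?_ ?_ ?_
  · simp only at he
    rw [← hhit y hy, ← hhit y' hy', he]
  · filter_upwards [ae_norm_eq_one, ae_reflected_mem_inflow h.domain hF hx] with η hη hin hnot
    unfold reflectedBoundary
    split_ifs with hD
    · exfalso
      have hω : ‖mirror e η‖ = 1 := by rw [norm_mirror, hη]
      have hτ := exitDist_pos_of_mem hΩ hb hω hx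
      have hτ2 := exitDist_pos_of_mem_reflectedDirs hb hF hη hD
      have hl : 0 < foldedLength Ω e x η := add_pos hτ hτ2
      have hy : hitPoint Ω (hitPoint Ω x (mirror e η)) η = p - foldedLength Ω e x η • η := by
        rw [hp, mirrorImage_sub_smul hF hD.1, foldedLength, add_sub_cancel_left]
        rfl
      have hd := dir_sub_smul (p := p) hl hη
      have hin' := hin hD
      have hin1 : hitPoint Ω (hitPoint Ω x (mirror e η)) η ∈ frontier Ω := hin'.1
      have hin2 : ⟪η, outerNormal Ω (hitPoint Ω (hitPoint Ω x (mirror e η)) η)⟫ < 0 := hin'.2.2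
      rw [hy] at hin1 hin2
      refine hnot ⟨p - foldedLength Ω e x η • η, ⟨⟨⟨⟨hin1, fun h0 => ?_⟩, ?_⟩, ?_⟩, ?_⟩, hd⟩
      · rw [mem_singleton_iff] at h0
        rw [h0] at hd
        rw [← hd] at hη
        simp [dir] at hη
      · rw [mem_ofPred_eq, sub_sub_cancel, real_inner_smul_left]
        exact mul_neg_of_pos_of_neg hl hin2
      · rw [mem_preimage, hd]; exact hD
      · rw [mem_ofPred_eq, hd, sub_sub_cancel, norm_smul, hη, mul_one, Real.norm_of_nonneg hl.le]
        exact ⟨by rw [foldedLength]; linarith, le_rfl⟩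
    · rfl
  · intro y hy
    obtain ⟨z, hz⟩ := hAz y hy
    have hhy := hhit y hy
    obtain ⟨-, h2, h3, h4, h5, h6, h7, -, -⟩ := hz.params hΩ hb hF hx
    rw [← hp] at h2 h3 h4 h5 h6
    have hneg : ⟪p - y, outerNormal Ω y⟫ < 0 := hy.1.1.2
    have hzy : 0 < ‖z - y‖ := norm_pos_iff.2 (sub_ne_zero.2 h7.symm)
    have hl : 0 < ‖p - y‖ := by rw [h5]; positivity
    have hip : ⟪z - y, outerNormal Ω y⟫ = ‖z - y‖ / ‖p - y‖ * ⟪p - y, outerNormal Ω y⟫ := by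
      have e1 : z - y = (‖z - y‖ / ‖p - y‖) • (p - y) := by
        rw [div_eq_mul_inv, mul_smul, show ‖p - y‖⁻¹ • (p - y) = dir y p from rfl, ← h4,
          norm_smul_dir]
      conv_lhs => rw [e1]
      rw [real_inner_smul_left]
    rw [reflectedBoundaryKernel, ifReflected_of_isReflectionPoint hΩ hb hF.subset_frontier hF.norm_eq
      hF.normal hx hz, reflectedBoundary, if_pos h6, ← h2, ← h3, h4, smul_smul]
    rw [← h2] at hhy
    rw [hhy]
    congr 1
    rw [← h5, solidAngleDensity, abs_of_neg hneg, negPart, hip, max_eq_left (by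
      rw [neg_nonneg]; exact mul_nonpos_of_nonneg_of_nonpos (by positivity) hneg.le)]
    field_simp
  · intro y hy hyA
    by_cases hex : ∃ z, IsReflectionPoint Ω F x y z
    · obtain ⟨z, hz⟩ := hex
      obtain ⟨h1, h2, h3, h4, h5, h6, h7, -, -⟩ := hz.params hΩ hb hF hx
      rw [← hp] at h1 h4 h5
      have hge : 0 ≤ ⟪p - y, outerNormal Ω y⟫ := by
        by_contra hlt
        obtain ⟨h8, h9⟩ := (isReflectionPoint_iff hΩ hb hF hx h1).1 ⟨z, hz⟩
        exact hyA ⟨⟨⟨⟨hy, h1⟩, not_le.1 hlt⟩, h8⟩, h9⟩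
      have hzy : 0 < ‖z - y‖ := norm_pos_iff.2 (sub_ne_zero.2 h7.symm)
      have hl : 0 < ‖p - y‖ := by rw [h5]; positivity
      have hip : 0 ≤ ⟪z - y, outerNormal Ω y⟫ := by
        rw [← norm_smul_dir p y, real_inner_smul_left] at hge
        rw [← norm_smul_dir z y, h4, real_inner_smul_left]
        exact mul_nonneg hzy.le (nonneg_of_mul_nonneg_right hge hl)
      rw [reflectedBoundaryKernel, ifReflected_of_isReflectionPoint hΩ hb hF.subset_frontier
        hF.norm_eq hF.normal hx hz, negPart, max_eq_right (by linarith)]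
      simp
    · rw [reflectedBoundaryKernel, ifReflected_of_not hex]

lemma reflectedVolumeKernel_integral (h : IsAdmissible Ω κ R Q S CQ CS)
    (hF : IsFlatPieceIn Ω F e b) (hc : Measurable c) (hc1 : ∀ ω, ‖ω‖ = 1 → ‖c ω‖ ≤ 1) (hx : x ∈ Ω) :
    IntegrableOn (reflectedVolumeKernel Ω κ R S F c x) Ω ∧
      Integrable (fun η => ∫ r in Ioi (0 : ℝ), reflectedVolume Ω κ R S F e b c x (η, r))
        sphereMeasure ∧
      ∫ y in Ω, reflectedVolumeKernel Ω κ R S F c x y =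
        ∫ η, (∫ r in Ioi (0 : ℝ), reflectedVolume Ω κ R S F e b c x (η, r)) ∂sphereMeasure := by
  have hΩ := h.domain.isOpen
  have hb := h.domain.isBounded
  rw [← integrable_indicator_iff hΩ.measurableSet, ← integral_indicator hΩ.measurableSet]
  set p := mirrorImage e b x with hp
  have hy : Measurable fun q : E3 × ℝ => p - q.2 • q.1 := by fun_prop
  have hz : Measurable fun q : E3 × ℝ => hitPoint Ω x (mirror e q.1) :=
    (measurable_hitPoint_mirror hΩ e x).comp measurable_fst
  have hmm : Measurable fun q : E3 × ℝ => mirror e q.1 :=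
    (continuous_mirror e).measurable.comp measurable_fst
  have hH : Measurable (reflectedVolume Ω κ R S F e b c x) := by
    unfold reflectedVolume
    refine Measurable.ite ?_ ?_ measurable_const
    · exact ((measurableSet_reflectedDirs hΩ hF.measurableSet e x).preimage measurable_fst).inter
        ((measurableSet_lt ((measurable_exitDist_mirror hΩ e x).comp measurable_fst)
          measurable_snd).inter
        (measurableSet_lt measurable_snd ((measurable_foldedLength hΩ e x).comp measurable_fst)))
    · exact ((((measurable_opticalDepth_comp h.measurable_κ measurable_const hz).add
        (measurable_opticalDepth_comp h.measurable_κ hz hy)).neg.exp.mul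
        (measurable_uncurry_comp h.measurable_R hz hmm)).mul
        (measurable_uncurry_comp h.measurable_S hy measurable_fst)).smul (hc.comp hmm)
  have hray : ∀ η r, ‖η‖ = 1 → η ∈ reflectedDirs Ω F e x →
      r ∈ Ioo (exitDist Ω x (mirror e η)) (foldedLength Ω e x η) →
      Visible Ω (hitPoint Ω x (mirror e η)) (p - r • η) ∧ p - r • η ∈ Ω := by
    intro η r hη hD hr
    rw [hp, mirrorImage_sub_smul hF hD.1]
    have h1 : 0 < r - exitDist Ω x (mirror e η) := by linarith [hr.1]
    have h2 : r - exitDist Ω x (mirror e η) < exitDist Ω (hitPoint Ω x (mirror e η)) η := by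
      have := hr.2
      rw [foldedLength] at this
      linarith
    exact ⟨(visible_sub_smul_iff h1).2 fun s hs => mem_of_lt_exitDist hs.1 (hs.2.trans h2),
      mem_of_lt_exitDist h1 h2⟩
  refine polar_integral p (H := reflectedVolume Ω κ R S F e b c x) hH (C := |CS|)
    (T := Metric.diam Ω + Metric.diam Ω) ?_ ?_ ?_
  · intro η r hη hr
    unfold reflectedVolume
    split_ifs with hif
    · have hω : ‖mirror e η‖ = 1 := by rw [norm_mirror, hη]
      have hτ := exitDist_pos_of_mem hΩ hb hω hx
      obtain ⟨hv, hm⟩ := hray η r hη hif.1 hif.2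
      refine norm_smul_le_of_le ?_ (hc1 _ hω)
      have h1 := exp_neg_opticalDepth_le h.pos_κ (visible_hitPoint hτ)
      have h2 := exp_neg_opticalDepth_le h.pos_κ hv
      have h3 := (h.S_le _ η hm hη).trans (le_abs_self CS)
      obtain ⟨h4, h5⟩ := h.R_mem _ _ (reflectedDirs_inflow hF hη hif.1)
      rw [abs_mul, abs_mul, Real.abs_exp, neg_add, Real.exp_add, abs_of_nonneg h4]
      calc _ ≤ 1 * 1 * 1 * |CS| := by gcongr
        _ = |CS| := by ring
    · rw [norm_zero]; exact abs_nonneg _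
  · intro η r hr
    unfold reflectedVolume
    refine if_neg fun hif => ?_
    have h1 := hif.2.2
    rw [foldedLength] at h1
    have h2 := exitDist_le Ω x (mirror e η)
    have h3 := exitDist_le Ω (hitPoint Ω x (mirror e η)) η
    simp only at h1
    linarith
  · intro η r hη hr
    have hd : dir (p - r • η) p = η := dir_sub_smul hr hη
    have hne : p - r • η ≠ p := fun h0 => by
      rw [h0] at hd
      rw [← hd] at hη
      simp [dir] at hη
    have hnorm : ‖p - (p - r • η)‖ = r := by
      rw [sub_sub_cancel, norm_smul, hη, mul_one, Real.norm_of_nonneg hr.le]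
    have hiff := isReflectionPoint_iff hΩ hb hF hx hne
    rw [← hp, hd, hnorm] at hiff
    unfold reflectedVolume
    by_cases hif : η ∈ reflectedDirs Ω F e x ∧
        r ∈ Ioo (exitDist Ω x (mirror e η)) (foldedLength Ω e x η)
    · obtain ⟨z, hz⟩ := hiff.2 ⟨hif.1, hif.2.1, hif.2.2.le⟩
      obtain ⟨-, hm⟩ := hray η r hη hif.1 hif.2
      obtain ⟨-, h2, h3, h4, h5, -⟩ := hz.params hΩ hb hF hx
      rw [← hp, hd] at h2 h3 h4
      rw [← hp, hnorm] at h5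
      rw [if_pos hif, indicator_of_mem hm, reflectedVolumeKernel,
        ifReflected_of_isReflectionPoint hΩ hb hF.subset_frontier hF.norm_eq hF.normal hx hz,
        ← h5, h3, h4, ← h2, smul_smul]
      congr 1
      ring
    · rw [if_neg hif, smul_zero]
      by_cases hm : p - r • η ∈ Ω
      · rw [indicator_of_mem hm, reflectedVolumeKernel, ifReflected_of_not]
        rintro ⟨z, hz⟩
        have h1 := (hz.mem_iff hΩ hb hF hx).1 hm
        rw [← hp, hd, hnorm] at h1
        obtain ⟨h2, h3⟩ := hiff.1 ⟨z, hz⟩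
        exact hif ⟨h2, h3.1, h1⟩
      · rw [indicator_of_notMem hm]

end Weighted

end RadiativeTransfer

namespace RadiativeTransfer
open scoped ENNReal NNReal

variable {Ω : Set E3} {κ : E3 → ℝ} {R Q S I : E3 → E3 → ℝ} {CQ CS : ℝ} {x : E3}
  {V : Type*} [NormedAddCommGroup V] [NormedSpace ℝ V] {c : E3 → V}

open Classical in
lemma integral_Ioi_ite_Ioo [CompleteSpace V] {l u : ℝ} (hl : 0 ≤ l) (hlu : l ≤ u) (f : ℝ → ℝ) (v : V) :
    ∫ r in Ioi (0 : ℝ), (if r ∈ Ioo l u then f r • v else 0) = (∫ r in l..u, f r) • v := by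
  have h : (fun r => if r ∈ Ioo l u then f r • v else 0) = (Ioo l u).indicator fun r => f r • v := by
    ext r
    simp only [indicator]
  rw [h, setIntegral_indicator measurableSet_Ioo,
    inter_eq_right.2 fun r (hr : r ∈ Ioo l u) => mem_Ioi.2 (hl.trans_lt hr.1), integral_smul_const,
    intervalIntegral.integral_of_le hlu, integral_Ioc_eq_integral_Ioo]

lemma measurePreserving_mirror (e : E3) : MeasurePreserving (mirror e) sphereMeasure sphereMeasure :=
  ⟨(continuous_mirror e).measurable, map_sphereMeasure (mirror e)⟩

lemma integral_comp_mirror (e : E3) (g : E3 → V) :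
    ∫ ω, g (mirror e ω) ∂sphereMeasure = ∫ η, g η ∂sphereMeasure :=
  (measurePreserving_mirror e).integral_comp (mirror e).toHomeomorph.measurableEmbedding g

/-- The contribution to the intensity arriving at `x` after reflection on `F`, as a function of the
direction before reflection. -/
noncomputable def reflectedContribution (Ω : Set E3) (κ : E3 → ℝ) (R Q S : E3 → E3 → ℝ)
    (F : Set E3) (e : E3) (b : ℝ) (c : E3 → V) (x η : E3) : V :=
  reflectedBoundary Ω κ R Q F e c x η +
    ∫ r in Ioi (0 : ℝ), reflectedVolume Ω κ R S F e b c x (η, r)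

lemma reflectedContribution_of_notMem {F : Set E3} {e : E3} {b : ℝ} {η : E3}
    (h : η ∉ reflectedDirs Ω F e x) : reflectedContribution Ω κ R Q S F e b c x η = 0 := by
  have h1 : ∀ r, reflectedVolume Ω κ R S F e b c x (η, r) = 0 := fun r =>
    if_neg fun h2 => h h2.1
  simp only [reflectedContribution, h1, integral_zero, add_zero]
  exact if_neg h

section

variable [MeasurableSpace V] [BorelSpace V] [SecondCountableTopology V]

lemma reflectedContribution_integral (h : IsAdmissible Ω κ R Q S CQ CS)
    {F : Set E3} {e : E3} {b : ℝ} (hF : IsFlatPieceIn Ω F e b) (hc : Measurable c)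
    (hc1 : ∀ ω, ‖ω‖ = 1 → ‖c ω‖ ≤ 1) (hx : x ∈ Ω) :
    Integrable (fun ω => reflectedContribution Ω κ R Q S F e b c x (mirror e ω)) sphereMeasure ∧
      ∫ ω, reflectedContribution Ω κ R Q S F e b c x (mirror e ω) ∂sphereMeasure =
        (∫ y, reflectedBoundaryKernel Ω κ R Q F c x y ∂(surfaceMeasure Ω)) +
          ∫ y in Ω, reflectedVolumeKernel Ω κ R S F c x y := by
  obtain ⟨h1, h2⟩ := reflectedBoundaryKernel_integral h hF hc hc1 hx
  obtain ⟨-, h3⟩ := integrable_reflectedBoundary h hF hc hc1 hx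
  obtain ⟨h4, h5, h6⟩ := reflectedVolumeKernel_integral h hF hc hc1 hx
  have h7 := h3.add h5
  refine ⟨(measurePreserving_mirror e).integrable_comp_of_integrable h7, ?_⟩
  rw [integral_comp_mirror e (reflectedContribution Ω κ R Q S F e b c x), h2, h6]
  exact integral_add h3 h5

end

variable [CompleteSpace V]

lemma integral_directVolume (ω : E3) :
    ∫ r in Ioi (0 : ℝ), directVolume Ω κ S c x (ω, r) =
      (∫ r in (0 : ℝ)..exitDist Ω x ω,
        Real.exp (-opticalDepth κ x (x - r • ω)) * S (x - r • ω) ω) • c ω :=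
  integral_Ioi_ite_Ioo le_rfl (exitDist_nonneg _ _ _)
    (fun r => Real.exp (-opticalDepth κ x (x - r • ω)) * S (x - r • ω) ω) (c ω)

lemma integral_reflectedVolume {F : Set E3} {e : E3} {b : ℝ} (hF : IsFlatPieceIn Ω F e b) {η : E3}
    (h : η ∈ reflectedDirs Ω F e x) :
    ∫ r in Ioi (0 : ℝ), reflectedVolume Ω κ R S F e b c x (η, r) =
      (Real.exp (-opticalDepth κ x (hitPoint Ω x (mirror e η))) *
        R (hitPoint Ω x (mirror e η)) (mirror e η) *
        ∫ r in (0 : ℝ)..exitDist Ω (hitPoint Ω x (mirror e η)) η,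
          Real.exp (-opticalDepth κ (hitPoint Ω x (mirror e η))
            (hitPoint Ω x (mirror e η) - r • η)) *
          S (hitPoint Ω x (mirror e η) - r • η) η) • c (mirror e η) := by
  set z := hitPoint Ω x (mirror e η) with hz
  have h1 : ∀ r, reflectedVolume Ω κ R S F e b c x (η, r) =
      if r ∈ Ioo (exitDist Ω x (mirror e η)) (foldedLength Ω e x η) then
        ((fun s => Real.exp (-opticalDepth κ x z) * R z (mirror e η) *
          (Real.exp (-opticalDepth κ z (z - s • η)) * S (z - s • η) η))
            (r - exitDist Ω x (mirror e η))) • c (mirror e η) else 0 := by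
    intro r
    rw [reflectedVolume, mirrorImage_sub_smul hF h.1]
    simp only [h, true_and, ← hz]
    congr 2
    rw [neg_add, Real.exp_add]
    ring
  simp only [h1]
  have h2 := integral_Ioi_ite_Ioo (exitDist_nonneg Ω x (mirror e η))
    (le_add_of_nonneg_right (exitDist_nonneg Ω z η)) (fun r =>
      (fun s => Real.exp (-opticalDepth κ x z) * R z (mirror e η) *
          (Real.exp (-opticalDepth κ z (z - s • η)) * S (z - s • η) η))
            (r - exitDist Ω x (mirror e η))) (c (mirror e η))
  rw [foldedLength]
  refine h2.trans ?_
  rw [intervalIntegral.integral_comp_sub_right (fun s => Real.exp (-opticalDepth κ x z) *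
    R z (mirror e η) * (Real.exp (-opticalDepth κ z (z - s • η)) * S (z - s • η) η)),
    sub_self, add_sub_cancel_left, intervalIntegral.integral_const_mul]

lemma reflectedContribution_eq (h : IsAdmissible Ω κ R Q S CQ CS)
    (hI : SolvesTransport Ω κ S I) (hBC : ReflectiveBC Ω R Q I) (hx : x ∈ Ω)
    (hR : NoMultipleReflectionAt Ω R x) {F : Set E3} {e : E3} {b : ℝ} (hF : IsFlatPieceIn Ω F e b)
    {η : E3} (hη : ‖η‖ = 1) (hD : η ∈ reflectedDirs Ω F e x)
    (hin : (hitPoint Ω (hitPoint Ω x (mirror e η)) η, η) ∈ inflow Ω) :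
    reflectedContribution Ω κ R Q S F e b c x η =
      (Real.exp (-opticalDepth κ x (hitPoint Ω x (mirror e η))) *
        (R (hitPoint Ω x (mirror e η)) (mirror e η) * I (hitPoint Ω x (mirror e η)) η)) •
          c (mirror e η) := by
  have hΩ := h.domain.isOpen
  have hb := h.domain.isBounded
  have hω : ‖mirror e η‖ = 1 := by rw [norm_mirror, hη]
  have hτ := exitDist_pos_of_mem hΩ hb hω hx
  have hτ2 := exitDist_pos_of_mem_reflectedDirs hb hF hη hD
  have hrefl := isReflectionPoint_of_ray hb hF.norm_eq hF.normal hω hτ hD.1 hD.2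
    (s := exitDist Ω (hitPoint Ω x (mirror e η)) η) hτ2 (by rw [mirror_mirror]; rfl)
  rw [mirror_mirror, ← hitPoint, ← hitPoint] at hrefl
  rw [reflectedContribution, integral_reflectedVolume hF hD, reflectedBoundary, if_pos hD,
    ← add_smul]
  set z := hitPoint Ω x (mirror e η) with hz
  have hdz : dir z x = mirror e η := dir_hitPoint hω hτ
  have hdy : dir (hitPoint Ω z η) z = η := dir_hitPoint hη hτ2
  have hRR := hR (hitPoint Ω z η) z (by rw [hdy]; exact hin)
    ⟨hF.subset_frontier hrefl.1, hrefl.2⟩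
  rw [hdz, hdy] at hRR
  have hray := hI.ray_formula hΩ h.measurable_κ h.bounded_κ hη hτ2
    fun s hs => mem_of_lt_exitDist hs.1 hs.2
  rw [← hitPoint, hBC _ _ hin] at hray
  rw [hray]
  congr 1
  rw [neg_add, Real.exp_add]
  linear_combination -Real.exp (-opticalDepth κ x z) * Real.exp (-opticalDepth κ z (hitPoint Ω z η)) *
    I (hitPoint Ω z η) (reflectDir Ω (hitPoint Ω z η) η) * hRR

/-- The intensity arriving at `x` in direction `ω`, when no ray is reflected more than once. -/
lemma intensity_eq (h : IsAdmissible Ω κ R Q S CQ CS)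
    (hI : SolvesTransport Ω κ S I) (hBC : ReflectiveBC Ω R Q I) (hx : x ∈ Ω)
    (hR : NoMultipleReflectionAt Ω R x) {M : ℕ} {F : Fin M → Set E3} {e : Fin M → E3} {b : Fin M → ℝ}
    (hF : ∀ n, IsFlatPieceIn Ω (F n) (e n) (b n))
    (hFdisj : Pairwise fun m n => Disjoint (F m) (F n))
    (hRF : ∀ q ∈ inflow Ω, (∀ n, q.1 ∉ F n) → R q.1 q.2 = 0)
    {ω : E3} (hω : ‖ω‖ = 1) (hin : (hitPoint Ω x ω, ω) ∈ inflow Ω)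
    (hin' : ∀ n, mirror (e n) ω ∈ reflectedDirs Ω (F n) (e n) x →
      (hitPoint Ω (hitPoint Ω x ω) (mirror (e n) ω), mirror (e n) ω) ∈ inflow Ω) :
    I x ω • c ω = directBoundary Ω κ Q c x ω + (∫ r in Ioi (0 : ℝ), directVolume Ω κ S c x (ω, r)) +
      ∑ n, reflectedContribution Ω κ R Q S (F n) (e n) (b n) c x (mirror (e n) ω) := by
  have hΩ := h.domain.isOpen
  have hb := h.domain.isBounded
  have hτ := exitDist_pos_of_mem hΩ hb hω hx
  have hray := hI.ray_formula hΩ h.measurable_κ h.bounded_κ hω hτ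
    fun s hs => mem_of_lt_exitDist hs.1 hs.2
  rw [← hitPoint, hBC _ _ hin] at hray
  have hsum : ∑ n, reflectedContribution Ω κ R Q S (F n) (e n) (b n) c x (mirror (e n) ω) =
      (Real.exp (-opticalDepth κ x (hitPoint Ω x ω)) *
        (R (hitPoint Ω x ω) ω * I (hitPoint Ω x ω) (reflectDir Ω (hitPoint Ω x ω) ω))) • c ω := by
    by_cases hz : ∃ n, hitPoint Ω x ω ∈ F n
    · obtain ⟨n, hn⟩ := hz
      have hD : mirror (e n) ω ∈ reflectedDirs Ω (F n) (e n) x := by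
        refine ⟨by rwa [mirror_mirror], ?_⟩
        rw [mirror_mirror, ← ((hF n).normal _ hn).1]
        exact hin.2.2
      rw [Finset.sum_eq_single n, reflectedContribution_eq h hI hBC hx hR (hF n)
        (by rw [norm_mirror, hω]) hD (by rw [mirror_mirror]; exact hin' n hD), mirror_mirror,
        reflectDir_eq (hF n).norm_eq ((hF n).normal _ hn).1]
      · intro m _ hm
        refine reflectedContribution_of_notMem fun hD' => ?_
        have hm' := hD'.1
        rw [mirror_mirror] at hm'
        exact (hFdisj hm).le_bot ⟨hm', hn⟩
      · simp
    · push Not at hz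
      rw [hRF _ hin hz, zero_mul, mul_zero, zero_smul]
      refine Finset.sum_eq_zero fun m _ => reflectedContribution_of_notMem fun hD' => hz m ?_
      have hm' := hD'.1
      rwa [mirror_mirror] at hm'
  rw [hsum, integral_directVolume, directBoundary, hray, ← add_smul, ← add_smul]
  congr 1
  ring

variable [MeasurableSpace V] [BorelSpace V] [SecondCountableTopology V]

/-- The moment of the intensity with weight `c`, as a sum of integrals over the boundary and
the domain. -/
theorem weighted_moment (h : IsAdmissible Ω κ R Q S CQ CS)
    (hI : SolvesTransport Ω κ S I) (hBC : ReflectiveBC Ω R Q I) (hx : x ∈ Ω)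
    (hR : NoMultipleReflectionAt Ω R x) {M : ℕ} {F : Fin M → Set E3} {e : Fin M → E3} {b : Fin M → ℝ}
    (hF : ∀ n, IsFlatPieceIn Ω (F n) (e n) (b n))
    (hFdisj : Pairwise fun m n => Disjoint (F m) (F n))
    (hRF : ∀ q ∈ inflow Ω, (∀ n, q.1 ∉ F n) → R q.1 q.2 = 0) (hc : Measurable c)
    (hc1 : ∀ ω, ‖ω‖ = 1 → ‖c ω‖ ≤ 1) :
    Integrable (fun ω => I x ω • c ω) sphereMeasure ∧
      ∫ ω, I x ω • c ω ∂sphereMeasure =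
        (∫ y, boundaryKernel Ω κ Q c x y ∂(surfaceMeasure Ω)) +
        (∑ n, ∫ y, reflectedBoundaryKernel Ω κ R Q (F n) c x y ∂(surfaceMeasure Ω)) +
        ∫ y in Ω, (volumeKernel Ω κ S c x y + ∑ n, reflectedVolumeKernel Ω κ R S (F n) c x y) := by
  obtain ⟨h1, h2⟩ := boundaryKernel_integral h hc hc1 hx
  obtain ⟨-, h3⟩ := integrable_directBoundary h hc hc1 hx
  obtain ⟨h4, h5, h6⟩ := volumeKernel_integral (x := x) h hc hc1
  have h7 := fun n => reflectedContribution_integral h (hF n) hc hc1 hx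
  have h8 := fun n => (reflectedVolumeKernel_integral h (hF n) hc hc1 hx).1
  have hae : (fun ω => I x ω • c ω) =ᵐ[sphereMeasure] fun ω =>
      directBoundary Ω κ Q c x ω + (∫ r in Ioi (0 : ℝ), directVolume Ω κ S c x (ω, r)) +
      ∑ n, reflectedContribution Ω κ R Q S (F n) (e n) (b n) c x (mirror (e n) ω) := by
    have hn : ∀ᵐ ω ∂sphereMeasure, ∀ n, mirror (e n) ω ∈ reflectedDirs Ω (F n) (e n) x →
        (hitPoint Ω (hitPoint Ω x ω) (mirror (e n) ω), mirror (e n) ω) ∈ inflow Ω := by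
      refine ae_all_iff.2 fun n => ?_
      have := (measurePreserving_mirror (e n)).quasiMeasurePreserving.ae
        (ae_reflected_mem_inflow h.domain (hF n) hx)
      simpa only [mirror_mirror] using this
    filter_upwards [ae_norm_eq_one, ae_hitPoint_mem_inflow h.domain hx, hn] with ω hω hin hin'
    exact intensity_eq h hI hBC hx hR hF hFdisj hRF hω hin hin'
  have hsum := integrable_finsetSum Finset.univ fun n _ => (h7 n).1
  refine ⟨((h3.add h5).add hsum).congr hae.symm, ?_⟩
  rw [integral_congr_ae hae, integral_add (by exact h3.add h5) hsum, integral_add h3 h5,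
    integral_finsetSum _ fun n _ => (h7 n).1, integral_add h4 (integrable_finsetSum _ fun n _ => h8 n),
    integral_finsetSum _ fun n _ => h8 n, h2, h6]
  simp only [fun n => (h7 n).2, Finset.sum_add_distrib]
  abel

end RadiativeTransfer

namespace RadiativeTransfer
open scoped ENNReal NNReal

variable {Ω : Set E3} {κ : E3 → ℝ} {R Q S I : E3 → E3 → ℝ} {CQ CS : ℝ} {x : E3}

lemma boundaryKernel_one : boundaryKernel Ω κ Q (fun _ => (1 : ℝ)) x = kernelSE1 Ω κ Q x := by
  ext y
  simp only [boundaryKernel, kernelSE1, smul_eq_mul, mul_one]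

lemma reflectedBoundaryKernel_one (F : Set E3) :
    reflectedBoundaryKernel Ω κ R Q F (fun _ => (1 : ℝ)) x = kernelSE2 Ω κ R Q F x := by
  ext y
  simp only [reflectedBoundaryKernel, kernelSE2, smul_eq_mul, mul_one]

lemma volumeKernel_add_sum_one {M : ℕ} (F : Fin M → Set E3) :
    (fun y => volumeKernel Ω κ S (fun _ => (1 : ℝ)) x y +
      ∑ n, reflectedVolumeKernel Ω κ R S (F n) (fun _ => (1 : ℝ)) x y) = kernelJ Ω κ R S F x := by
  ext y
  simp only [volumeKernel, reflectedVolumeKernel, kernelJ, smul_eq_mul, mul_one]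

lemma boundaryKernel_id : boundaryKernel Ω κ Q id x = kernelKE1 Ω κ Q x := by
  ext1 y
  simp only [boundaryKernel, kernelKE1, dir, id, smul_smul]
  congr 2
  ring

lemma reflectedBoundaryKernel_id (F : Set E3) :
    reflectedBoundaryKernel Ω κ R Q F id x = kernelKE2 Ω κ R Q F x := rfl

lemma volumeKernel_add_sum_id {M : ℕ} (F : Fin M → Set E3) :
    (fun y => volumeKernel Ω κ S id x y + ∑ n, reflectedVolumeKernel Ω κ R S (F n) id x y) =
      kernelK Ω κ R S F x := by
  ext1 y
  simp only [volumeKernel, reflectedVolumeKernel, kernelK, dir, id, smul_smul]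
  congr 3
  ring

/-- The integral formulas for the moments of the intensity at a point at which no ray arrives after
more than one reflection. -/
theorem momentFormulasAt (h : IsAdmissible Ω κ R Q S CQ CS)
    (hI : SolvesTransport Ω κ S I) (hBC : ReflectiveBC Ω R Q I) (hx : x ∈ Ω)
    (hR : NoMultipleReflectionAt Ω R x) {M : ℕ} {F : Fin M → Set E3} (hF : ∀ n, IsFlatPiece Ω (F n))
    (hFdisj : Pairwise fun m n => Disjoint (F m) (F n))
    (hRF : ∀ q ∈ inflow Ω, (∀ n, q.1 ∉ F n) → R q.1 q.2 = 0) :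
    MomentFormulasAt Ω κ R Q S F I x := by
  choose hFm hFs e b he hFn using hF
  have hF' : ∀ n, IsFlatPieceIn Ω (F n) (e n) (b n) := fun n => ⟨hFm n, hFs n, he n, hFn n⟩
  have hc1 : ∀ ω : E3, ‖ω‖ = 1 → ‖(1 : ℝ)‖ ≤ 1 := fun _ _ => norm_one.le
  have hc2 : ∀ ω : E3, ‖ω‖ = 1 → ‖id ω‖ ≤ 1 := fun _ h => h.le
  have hm1 : Measurable fun _ : E3 => (1 : ℝ) := measurable_const
  obtain ⟨hi, hf⟩ := weighted_moment h hI hBC hx hR hF' hFdisj hRF hm1 hc1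
  obtain ⟨-, hfK⟩ := weighted_moment h hI hBC hx hR hF' hFdisj hRF measurable_id hc2
  simp only [smul_eq_mul, mul_one, id] at hi hf hfK
  refine ⟨(integrable_sphere_iff _).2 hi, ?_, fun n => ?_, ?_, ?_, fun n => ?_, ?_, ?_, ?_⟩
  · rw [← boundaryKernel_one]
    exact (boundaryKernel_integral h hm1 hc1 hx).1
  · rw [← reflectedBoundaryKernel_one]
    exact (reflectedBoundaryKernel_integral h (hF' n) hm1 hc1 hx).1
  · rw [← volumeKernel_add_sum_one]
    exact (volumeKernel_integral h hm1 hc1).1.add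
      (integrable_finsetSum _ fun n _ => (reflectedVolumeKernel_integral h (hF' n) hm1 hc1 hx).1)
  · rw [← boundaryKernel_id]
    exact (boundaryKernel_integral h measurable_id hc2 hx).1
  · rw [← reflectedBoundaryKernel_id]
    exact (reflectedBoundaryKernel_integral h (hF' n) measurable_id hc2 hx).1
  · rw [← volumeKernel_add_sum_id]
    exact (volumeKernel_integral h measurable_id hc2).1.add (integrable_finsetSum _ fun n _ =>
      (reflectedVolumeKernel_integral h (hF' n) measurable_id hc2 hx).1)
  · rw [meanIntensity, integral_sphere_eq (fun ω => I x ω), hf, volumeKernel_add_sum_one,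
      boundaryKernel_one, sourceE1, sourceE2, volumeJ, mul_add, mul_add, Finset.mul_sum]
    simp only [reflectedBoundaryKernel_one]
  · rw [meanFlux, integral_sphere_eq (fun ω => I x ω • ω), hfK]
    have h1 := volumeKernel_add_sum_id (Ω := Ω) (κ := κ) (R := R) (S := S) (x := x) F
    have h2 := boundaryKernel_id (Ω := Ω) (κ := κ) (Q := Q) (x := x)
    have h3 := fun n => reflectedBoundaryKernel_id (Ω := Ω) (κ := κ) (R := R) (Q := Q) (x := x) (F n)
    rw [h1, h2, fluxE1, fluxE2, volumeK, smul_add, smul_add, Finset.smul_sum]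
    simp only [h3]

lemma measurable_planck (hbar c k ν : ℝ) : Measurable (planck hbar c k ν) := by
  unfold planck
  fun_prop

lemma abs_planck_le {hbar c k ν T C : ℝ} (hh : 0 < hbar) (hc : 0 < c) (hk : 0 < k) (hν : 0 < ν)
    (hT : 0 ≤ T) (hTC : T ≤ C) : |planck hbar c k ν T| ≤ 2 * ν ^ 2 * k * C / c ^ 2 := by
  rcases hT.eq_or_lt with rfl | hT
  · simp only [planck, mul_zero, div_zero, Real.exp_zero, sub_self, abs_zero]
    positivity
  · have h1 := Real.add_one_le_exp (hbar * ν / (k * T))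
    have h2 : 0 < hbar * ν / (k * T) := by positivity
    have h3 : 0 < Real.exp (hbar * ν / (k * T)) - 1 := by linarith
    rw [planck, abs_of_nonneg (by positivity)]
    calc 2 * hbar * ν ^ 3 / (c ^ 2 * (Real.exp (hbar * ν / (k * T)) - 1))
        ≤ 2 * hbar * ν ^ 3 / (c ^ 2 * (hbar * ν / (k * T))) := by
          gcongr
          linarith
      _ = 2 * ν ^ 2 * k * T / c ^ 2 := by field_simp
      _ ≤ _ := by gcongr

lemma boundedOn_planck {hbar c k ν : ℝ} (hh : 0 < hbar) (hc : 0 < c) (hk : 0 < k) (hν : 0 < ν)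
    {T : E3 → ℝ} (hT : ∀ x ∈ Ω, 0 ≤ T x) (hTb : BoundedOn T Ω) :
    BoundedOn (fun x => planck hbar c k ν (T x)) Ω := by
  obtain ⟨C, hC⟩ := hTb
  exact ⟨_, fun x hx => abs_planck_le hh hc hk hν (hT x hx) ((le_abs_self _).trans (hC x hx))⟩

variable {a β B J : E3 → ℝ} {K : E3 → E3}

lemma measurable_source (hκ : Measurable κ) (ha : Measurable a) (hβ : Measurable β)
    (hB : Measurable B) (hJ : Measurable J) (hK : Measurable K) :
    Measurable (Function.uncurry (source κ a β B J K)) := by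
  have h : Measurable fun q : E3 × E3 => ⟪q.2, K q.1⟫ := measurable_snd.inner (hK.comp measurable_fst)
  have h1 : Measurable fun q : E3 × E3 => q.1 := measurable_fst
  exact (((hκ.comp h1).mul ((ha.comp h1).const_sub 1)).mul
    ((hB.comp h1).add ((hβ.comp h1).mul h))).add (((hκ.comp h1).mul (ha.comp h1)).mul (hJ.comp h1))

lemma abs_source_le {Cκ Cβ CB CJ CK : ℝ} {ω : E3} (hω : ‖ω‖ = 1) (hκ : |κ x| ≤ Cκ)
    (ha : a x ∈ Icc (0 : ℝ) 1) (hβ : |β x| ≤ Cβ) (hB : |B x| ≤ CB) (hJ : |J x| ≤ CJ)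
    (hK : ‖K x‖ ≤ CK) :
    |source κ a β B J K x ω| ≤ Cκ * 1 * (CB + Cβ * CK) + Cκ * 1 * CJ := by
  have h1 : |⟪ω, K x⟫| ≤ CK := (abs_real_inner_le_norm _ _).trans (by rwa [hω, one_mul])
  have h2 : |a x| ≤ 1 := abs_le.2 ⟨by linarith [ha.1], ha.2⟩
  have h3 : |1 - a x| ≤ 1 := abs_le.2 ⟨by linarith [ha.2], by linarith [ha.1]⟩
  have h4 : |B x + β x * ⟪ω, K x⟫| ≤ CB + Cβ * CK := by
    refine (abs_add_le _ _).trans (add_le_add hB ?_)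
    rw [abs_mul]
    exact mul_le_mul hβ h1 (abs_nonneg _) ((abs_nonneg _).trans hβ)
  have h5 : 0 ≤ Cκ := (abs_nonneg _).trans hκ
  refine (abs_add_le _ _).trans (add_le_add ?_ ?_)
  · rw [abs_mul, abs_mul]; gcongr
  · rw [abs_mul, abs_mul]; gcongr

lemma boundedOn_source (hκ : BoundedOn κ Ω) (ha : ∀ x ∈ Ω, a x ∈ Icc (0 : ℝ) 1)
    (hβ : BoundedOn β Ω) (hB : BoundedOn B Ω) (hJ : BoundedOn J Ω) (hK : BoundedOn K Ω) :
    ∃ C, ∀ y ω, y ∈ Ω → ‖ω‖ = 1 → |source κ a β B J K y ω| ≤ C := by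
  obtain ⟨Cκ, hκ⟩ := hκ
  obtain ⟨Cβ, hβ⟩ := hβ
  obtain ⟨CB, hB⟩ := hB
  obtain ⟨CJ, hJ⟩ := hJ
  obtain ⟨CK, hK⟩ := hK
  exact ⟨_, fun y ω hy hω =>
    abs_source_le hω (hκ y hy) (ha y hy) (hβ y hy) (hB y hy) (hJ y hy) (hK y hy)⟩

lemma measurable_meanIntensity (hI : Measurable (Function.uncurry I)) :
    Measurable (meanIntensity I) := by
  have h : Measurable fun q : E3 × Metric.sphere (0 : E3) 1 => I q.1 q.2 :=
    measurable_uncurry_comp hI measurable_fst (measurable_subtype_coe.comp measurable_snd)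
  exact (h.stronglyMeasurable.integral_prod_right (ν := (volume : Measure E3).toSphere)).measurable.const_mul _

lemma measurable_meanFlux (hI : Measurable (Function.uncurry I)) : Measurable (meanFlux I) := by
  have h0 : Measurable fun q : E3 × Metric.sphere (0 : E3) 1 => (q.2 : E3) :=
    measurable_subtype_coe.comp measurable_snd
  have h : Measurable fun q : E3 × Metric.sphere (0 : E3) 1 => I q.1 q.2 • (q.2 : E3) :=
    (measurable_uncurry_comp hI measurable_fst h0).smul h0
  exact (h.stronglyMeasurable.integral_prod_right
    (ν := (volume : Measure E3).toSphere)).measurable.const_smul ((4 * Real.pi)⁻¹ : ℝ)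

lemma boundedOn_meanIntensity
    (hI : BoundedOn (Function.uncurry I) (Ω ×ˢ Metric.sphere (0 : E3) 1)) :
    BoundedOn (meanIntensity I) Ω := by
  obtain ⟨C, hC⟩ := hI
  refine ⟨‖(4 * Real.pi)⁻¹‖ * (C * ((volume : Measure E3).toSphere).real univ), fun x hx => ?_⟩
  rw [meanIntensity, norm_mul]
  gcongr
  exact norm_integral_le_of_norm_le_const (Filter.Eventually.of_forall fun ω => hC (x, ω) ⟨hx, ω.2⟩)

lemma boundedOn_meanFlux
    (hI : BoundedOn (Function.uncurry I) (Ω ×ˢ Metric.sphere (0 : E3) 1)) :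
    BoundedOn (meanFlux I) Ω := by
  obtain ⟨C, hC⟩ := hI
  refine ⟨‖(4 * Real.pi)⁻¹‖ * (C * ((volume : Measure E3).toSphere).real univ), fun x hx => ?_⟩
  rw [meanFlux, norm_smul]
  gcongr
  refine norm_integral_le_of_norm_le_const (Filter.Eventually.of_forall fun ω => ?_)
  rw [norm_smul, show ‖(ω : E3)‖ = 1 by simp, mul_one]
  exact hC (x, ω) ⟨hx, ω.2⟩

end RadiativeTransfer
theorem proposition2
    (hbar c k : ℝ) (hhbar : 0 < hbar) (hc : 0 < c) (hk : 0 < k)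
    (Ω : Set E3) (hΩ : IsPiecewiseC1Domain Ω)
    -- the reflecting boundaries
    (M : ℕ) (F : Fin M → Set E3) (hF : ∀ n, IsFlatPiece Ω (F n))
    (hFdisj : Pairwise fun m n => Disjoint (F m) (F n))
    -- absorption, scattering and anisotropy coefficients
    (κ a β : ℝ → E3 → ℝ)
    (hκm : ∀ ν > 0, Measurable (κ ν)) (hκb : ∀ ν > 0, BoundedOn (κ ν) Ω)
    (hκ : ∀ ν > 0, ∀ x ∈ Ω, 0 < κ ν x)
    (ham : ∀ ν > 0, Measurable (a ν)) (ha : ∀ ν > 0, ∀ x ∈ Ω, a ν x ∈ Set.Icc (0 : ℝ) 1)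
    (hβm : ∀ ν > 0, Measurable (β ν)) (hβb : ∀ ν > 0, BoundedOn (β ν) Ω)
    -- reflection coefficient and boundary source
    (R Q : ℝ → E3 → E3 → ℝ)
    (hRm : ∀ ν > 0, Measurable (Function.uncurry (R ν)))
    (hR : ∀ ν > 0, ∀ q ∈ inflow Ω, R ν q.1 q.2 ∈ Set.Icc (0 : ℝ) 1)
    (hRF : ∀ ν > 0, ∀ q ∈ inflow Ω, (∀ n, q.1 ∉ F n) → R ν q.1 q.2 = 0)
    (hQm : ∀ ν > 0, Measurable (Function.uncurry (Q ν)))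
    (hQb : ∀ ν > 0, BoundedOn (Function.uncurry (Q ν)) (inflow Ω)) :
    -- one step of the iterations
    (∀ ν > 0, ∀ (J₀ : E3 → ℝ) (K₀ : E3 → E3) (T₀ : E3 → ℝ) (I : E3 → E3 → ℝ),
      Measurable J₀ → BoundedOn J₀ Ω → Measurable K₀ → BoundedOn K₀ Ω →
      Measurable T₀ → BoundedOn T₀ Ω → (∀ x ∈ Ω, 0 ≤ T₀ x) →
      SolvesTransport Ω (κ ν)
        (source (κ ν) (a ν) (β ν) (fun x => planck hbar c k ν (T₀ x)) J₀ K₀) I →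
      ReflectiveBC Ω (R ν) (Q ν) I →
      ∀ x ∈ Ω, NoMultipleReflectionAt Ω (R ν) x →
        MomentFormulasAt Ω (κ ν) (R ν) (Q ν)
          (source (κ ν) (a ν) (β ν) (fun x => planck hbar c k ν (T₀ x)) J₀ K₀) F I x) ∧
    -- solutions of the radiative transfer equations
    (∀ (I : ℝ → E3 → E3 → ℝ) (T : E3 → ℝ),
      IsRTESolution hbar c k Ω κ a β R Q I T →
      ∀ ν > 0, ∀ x ∈ Ω, NoMultipleReflectionAt Ω (R ν) x →
        MomentFormulasAt Ω (κ ν) (R ν) (Q ν)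
          (source (κ ν) (a ν) (β ν) (fun x => planck hbar c k ν (T x))
            (meanIntensity (I ν)) (meanFlux (I ν))) F (I ν) x) := by
  have key : ∀ ν > 0, ∀ (J : E3 → ℝ) (K : E3 → E3) (T : E3 → ℝ) (I : E3 → E3 → ℝ),
      Measurable J → BoundedOn J Ω → Measurable K → BoundedOn K Ω →
      Measurable T → BoundedOn T Ω → (∀ x ∈ Ω, 0 ≤ T x) →
      SolvesTransport Ω (κ ν)
        (source (κ ν) (a ν) (β ν) (fun x => planck hbar c k ν (T x)) J K) I →
      ReflectiveBC Ω (R ν) (Q ν) I →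
      ∀ x ∈ Ω, NoMultipleReflectionAt Ω (R ν) x →
        MomentFormulasAt Ω (κ ν) (R ν) (Q ν)
          (source (κ ν) (a ν) (β ν) (fun x => planck hbar c k ν (T x)) J K) F I x := by
    intro ν hν J K T I hJm hJb hKm hKb hTm hTb hT hI hBC x hx hNR
    obtain ⟨CQ, hCQ⟩ := hQb ν hν
    obtain ⟨CS, hCS⟩ := boundedOn_source (hκb ν hν) (ha ν hν) (hβb ν hν)
      (boundedOn_planck hhbar hc hk hν hT hTb) hJb hKb
    have hadm : IsAdmissible Ω (κ ν) (R ν) (Q ν)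
        (source (κ ν) (a ν) (β ν) (fun x => planck hbar c k ν (T x)) J K) CQ CS :=
      { domain := hΩ
        measurable_κ := hκm ν hν
        bounded_κ := hκb ν hν
        pos_κ := hκ ν hν
        measurable_R := hRm ν hν
        R_mem := fun y ω h => hR ν hν (y, ω) h
        measurable_Q := hQm ν hν
        Q_le := fun y ω h => hCQ (y, ω) h
        measurable_S := measurable_source (hκm ν hν) (ham ν hν) (hβm ν hν)
          ((measurable_planck hbar c k ν).comp hTm) hJm hKm
        S_le := hCS }
    exact momentFormulasAt hadm hI hBC hx hNR hF hFdisj (hRF ν hν)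
  refine ⟨key, fun I T h ν hν => ?_⟩
  exact key ν hν _ _ T (I ν) (measurable_meanIntensity (h.measurable_I ν hν))
    (boundedOn_meanIntensity (h.bounded_I ν hν)) (measurable_meanFlux (h.measurable_I ν hν))
    (boundedOn_meanFlux (h.bounded_I ν hν)) h.measurable_T h.bounded_T h.nonneg_T
    (h.transport ν hν) (h.boundary ν hν)
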